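/- **Problem.** Let $f(\mathbf x,\mathbf y)=\mathbb E_\xi[f(\mathbf x,\mathbf y;\xi)]$ and $g(\mathbf x,\mathbf y)=\mathbb E_\zeta[g(\mathbf x,\mathbf y;\zeta)]$ for $\mathbf x\in\mathbb R^d$, $\mathbf y\in\mathbb R^{d'}$, let $\mathbf y^*(\mathbf x)\in\arg\min_{\mathbf y}g(\mathbf x,\mathbf y)$ and $F(\mathbf x)=f(\mathbf x,\mathbf y^*(\mathbf x))$. For vectors $\|\cdot\|$ is the Euclidean norm, for matrices the spectral norm; $\|\cdot\|_F$ is the Frobenius norm. $\nabla^2_{xy}g$ is the $d\times d'$ matrix with entries $\partial^2 g/\partial x_i\partial y_j$. The functions $f(\cdot,\cdot;\xi)$, $g(\mathbf x,\cdot;\zeta)$ and $\nabla_y g(\cdot,\cdot;\zeta)$ are differentiable. **Assumption 1.** $L_gI\succeq\nabla^2_{yy}g(\mathbf x,\mathbf y)\succeq\lambda I$ for all $\mathbf x,\mathbf y$, where $0<\lambda\le L_g$. **Assumption 2.** (i) For every sample, $\nabla_xf(\cdot,\cdot;\xi)$, $\nabla_yf(\cdot,\cdot;\xi)$, $\nabla_yg(\cdot,\cdot;\zeta)$,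 $\nabla^2_{xy}g(\cdot,\cdot;\zeta)$, $\nabla^2_{yy}g(\cdot,\cdot;\zeta)$ are Lipschitz in $(\mathbf x,\mathbf y)$ with constants $L_{fx},L_{fy},L_{gy},L_{gxy},L_{gyy}$ (Frobenius norm for matrices). (ii) At every $(\mathbf x,\mathbf y)$ each of these five has variance at most $\sigma^2$ about the corresponding derivative of $f$ or $g$ (Frobenius norm for matrices). (iii) $\|\nabla_yf(\mathbf x,\mathbf y)\|\le C_{fy}$ and $\|\nabla^2_{xy}g(\mathbf x,\mathbf y)\|\le C_{gxy}$ for all $\mathbf x,\mathbf y$. (iv) $F(\mathbf x_0)-F(\mathbf x)\le\Delta$ for all $\mathbf x$. **Method (SVRB).** Start from points $\mathbf x_0,\mathbf y_0$ and (possibly random) estimators $\mathbf u_1,\mathbf v_1,V_1,H_1,\mathbf w_1$ of $\nabla_xf,\nabla_yf,\nabla^2_{xy}g,\nabla^2_{yy}g,\nabla_yg$ at $(\mathbf x_0,\mathbf y_0)$, with $\|\mathbf v_1\|\le C_{fy}$, $\|V_1\|\le C_{gxy}$, $H_1\succeq\lambda I$. Let $D$ be an upper bound for $\|\mathbf y_0-\mathbf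 y^*(\mathbf x_0)\|^2$ and for the mean squared errors of the five initial estimators (Frobenius norm for matrices). For $t\ge1$ the sample pairs $(\xi_t,\zeta_t)$ are independent of one another and of the initial estimators, $\xi_t$ and $\zeta_t$ having the laws of $\xi$ and $\zeta$, and $$\begin{aligned} \mathbf u_{t+1}&=(1-\beta_{fx,t})(\mathbf u_t-\nabla_xf(\mathbf x_{t-1},\mathbf y_{t-1};\xi_t))+\nabla_xf(\mathbf x_t,\mathbf y_t;\xi_t),\\ \mathbf v_{t+1}&=\Pi_{C_{fy}}\big[(1-\beta_{fy,t})(\mathbf v_t-\nabla_yf(\mathbf x_{t-1},\mathbf y_{t-1};\xi_t))+\nabla_yf(\mathbf x_t,\mathbf y_t;\xi_t)\big],\\ V_{t+1}&=\mathbf S^u_{C_{gxy}}\big[(1-\beta_{gxy,t})(V_t-\nabla^2_{xy}g(\mathbf x_{t-1},\mathbf y_{t-1};\zeta_t))+\nabla^2_{xy}g(\mathbf x_t,\mathbf y_t;\zeta_t)\big],\\ H_{t+1}&=\mathbf S^l_{\lambda}\big[(1-\beta_{gyy,t})(H_t-\nabla^2_{yy}g(\mathbf x_{t-1},\mathbf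 y_{t-1};\zeta_t))+\nabla^2_{yy}g(\mathbf x_t,\mathbf y_t;\zeta_t)\big],\\ \mathbf w_{t+1}&=(1-\beta_{gy,t})(\mathbf w_t-\nabla_yg(\mathbf x_{t-1},\mathbf y_{t-1};\zeta_t))+\nabla_yg(\mathbf x_t,\mathbf y_t;\zeta_t), \end{aligned}$$ where $\Pi_C$, $\mathbf S^u_C$, $\mathbf S^l_\lambda$ are the projections (Frobenius norm for matrices) onto the ball of radius $C$, onto $\{X:\|X\|\le C\}$ and onto the symmetric matrices $X\succeq\lambda I$. For all $t\ge0$, with $\mathbf z_{t+1}=\mathbf u_{t+1}-V_{t+1}H_{t+1}^{-1}\mathbf v_{t+1}$, $$\mathbf x_{t+1}=\mathbf x_t-\eta_t\gamma\,\mathbf z_{t+1},\qquad \mathbf y_{t+1}=\mathbf y_t-\tau_t\tau\,\mathbf w_{t+1}.$$ **Parameters.** Put $L_y=C_{gxy}/\lambda$, $\Sigma=L_{gy}^2+L_{fx}^2+L_{fy}^2+L_{gxy}^2+L_{gyy}^2$, $C_0=2L_{fx}^2+\frac{6C_{fy}^2L_{gxy}^2}{\lambda^2}+\frac{6C_{fy}^2C_{gxy}^2L_{gyy}^2}{\lambda^4}+\frac{6L_{fy}^2C_{gxy}^2}{\lambda^2}$,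 $C_1=2$, $C_2=\frac{6C_{fy}^2}{\lambda^2}$, $C_3=\frac{6C_{fy}^2C_{gxy}^2}{\lambda^4}$, $C_4=\frac{6C_{gxy}^2}{\lambda^2}$, and let $L_F>0$ be any constant with $L_F\ge(1+L_y)\big(L_{fx}+\frac{L_{fy}C_{gxy}}{\lambda}+C_{fy}\big(\frac{L_{gxy}}{\lambda}+\frac{C_{gxy}L_{gyy}}{\lambda^2}\big)\big)$ (the standard Lipschitz constant of $\nabla F$). Let $c,\tau,\gamma>0$, $\tau\le\frac1{3L_g}$, $C=\max\{\frac{4C_0}{\tau\lambda},\frac{4\Sigma}{\gamma}\}$, $\gamma\le\min\{\frac{\sqrt{\tau\lambda}}{8\sqrt C\,L_y},\frac1{16\Sigma}\}$ (a vanishing denominator means no restriction), $\eta_t=\tau_t=c/(c_0+t)^{1/3}$, $$c_0\ge\max\Big\{2,\ (4L_Fc)^3,\ \big(\tfrac{16C\gamma\tau c^2}{\lambda}\big)^{3/2},\ \big(\tfrac2{7L_Fc}\big)^{3/2},\ \big(2(C_1+C_2+C_3+C_4)\gamma c^2\big)^{3/2}\Big\},$$ and $\beta_{gy,t+1}=(\frac1{7L_Fc^3}+\frac{8C\gamma\tau_t\tau}{\lambda\eta_t})\eta_t^2$,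 $\beta_{fx,t+1}=(\frac1{7L_Fc^3}+C_1\gamma)\eta_t^2$, $\beta_{fy,t+1}=(\frac1{7L_Fc^3}+C_4\gamma)\eta_t^2$, $\beta_{gxy,t+1}=(\frac1{7L_Fc^3}+C_2\gamma)\eta_t^2$, $\beta_{gyy,t+1}=(\frac1{7L_Fc^3}+C_3\gamma)\eta_t^2$ for $t\ge0$. **Theorem 1.** There are a constant $K$, an integer $p\ge0$ and numbers of iterations $N(\varepsilon)$ that depend only on the constants in the assumptions, on the parameters $c,c_0,\tau,\gamma,L_F$ and on $D$, such that under Assumptions 1 and 2: $F$ is differentiable, every $\mathbb E\|\nabla F(\mathbf x_t)\|^2$ is finite, and for all $T\ge1$ $$\mathbb E\Big[\frac1{T+1}\sum_{t=0}^T\|\nabla F(\mathbf x_t)\|^2\Big]\le\frac{K\log^p(T+2)}{T^{2/3}}=\widetilde O\big(T^{-2/3}\big).$$ Moreover, for every $0<\varepsilon\le\frac12$, running $T=N(\varepsilon)$ iterations and returning $\mathbf x_{\tilde t}$ with $\tilde t$ uniform on $\{0,\dots,T\}$ and independent of the run gives $\mathbb E\|\nabla F(\mathbf x_{\tilde t})\|\le\varepsilon$,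 and the number $2N(\varepsilon)$ of samples drawn in these iterations is at most $K\varepsilon^{-3}\log^p(1/\varepsilon)=\widetilde O(\varepsilon^{-3})$. -/

import Mathlib

open MeasureTheory ProbabilityTheory

noncomputable section

namespace Bilevel

/-- The Euclidean space of dimension `n`. -/
abbrev Vec (n : ℕ) : Type := EuclideanSpace ℝ (Fin n)

/-! ### Norms, Lipschitz continuity, projections -/

/-- Frobenius norm of a linear map (matrix): square root of the sum of the squared norms of its
columns. The operator norm `‖A‖` of a continuous linear map is its spectral norm. -/
def frobNorm {m n : ℕ} (A : Vec n →L[ℝ] Vec m) : ℝ :=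
  √(∑ j : Fin n, ‖A (EuclideanSpace.single j (1 : ℝ))‖ ^ 2)

/-- `h` is `L`-Lipschitz with respect to the pair `(x, y)`, distances of values being measured
by the norm `N`. -/
def LipschitzXY {d e : ℕ} {E : Type*} [Sub E] (N : E → ℝ) (L : ℝ) (h : Vec d → Vec e → E) : Prop :=
  ∀ x y x' y', N (h x y - h x' y') ≤ L * √(‖x - x'‖ ^ 2 + ‖y - y'‖ ^ 2)

/-- `b` is the projection of `a` onto the set `S` with respect to the norm `N`. -/
def IsProjection {E : Type*} [Sub E] (N : E → ℝ) (S : Set E) (a b : E) : Prop :=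
  b ∈ S ∧ ∀ b' ∈ S, N (a - b) ≤ N (a - b')

/-- The symmetric matrices `X` with `X ⪰ l I`. -/
def matricesAbove {e : ℕ} (l : ℝ) : Set (Vec e →L[ℝ] Vec e) :=
  {A | IsSelfAdjoint A ∧ ∀ p, l * ‖p‖ ^ 2 ≤ inner ℝ (A p) p}

/-- The matrices of spectral norm at most `C`. -/
def matricesBelow {d e : ℕ} (C : ℝ) : Set (Vec e →L[ℝ] Vec d) := {A | ‖A‖ ≤ C}

/-! ### Partial derivatives of a function of `(x, y)` -/

/-- The partial gradient in `x`. -/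
def gradX {d e : ℕ} (h : Vec d → Vec e → ℝ) (x : Vec d) (y : Vec e) : Vec d :=
  gradient (fun x' => h x' y) x

/-- The partial gradient in `y`. -/
def gradY {d e : ℕ} (h : Vec d → Vec e → ℝ) (x : Vec d) (y : Vec e) : Vec e :=
  gradient (fun y' => h x y') y

/-- The `d × e` matrix of the mixed second derivatives `∂²h / ∂xᵢ ∂yⱼ`: the transpose of the
Jacobian in `x` of the partial gradient in `y`. -/
def hessXY {d e : ℕ} (h : Vec d → Vec e → ℝ) (x : Vec d) (y : Vec e) : Vec e →L[ℝ] Vec d :=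
  ContinuousLinearMap.adjoint (fderiv ℝ (fun x' => gradY h x' y) x)

/-- The Hessian in `y`. -/
def hessYY {d e : ℕ} (h : Vec d → Vec e → ℝ) (x : Vec d) (y : Vec e) : Vec e →L[ℝ] Vec e :=
  fderiv ℝ (fun y' => gradY h x y') y

/-! ### The stochastic bilevel problem -/

/-- The data of a stochastic bilevel problem: the laws of the random variables `ξ` and `ζ`, and
the functions `f(x, y; ξ)` and `g(x, y; ζ)`. -/
structure Problem (d e : ℕ) (Ξ Z : Type*) [MeasurableSpace Ξ] [MeasurableSpace Z] where
  lawXi : Measure Ξ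
  lawZeta : Measure Z
  f : Vec d → Vec e → Ξ → ℝ
  g : Vec d → Vec e → Z → ℝ

namespace Problem

variable {d e : ℕ} {Ξ Z : Type*} [MeasurableSpace Ξ] [MeasurableSpace Z]

/-- `f(·, ·; ξ)` for a fixed sample `ξ`. -/
def fAt (P : Problem d e Ξ Z) (ξ : Ξ) : Vec d → Vec e → ℝ := fun x y => P.f x y ξ

/-- `g(·, ·; ζ)` for a fixed sample `ζ`. -/
def gAt (P : Problem d e Ξ Z) (ζ : Z) : Vec d → Vec e → ℝ := fun x y => P.g x y ζ

/-- `f(x, y) = 𝔼 f(x, y; ξ)`. -/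
def fMean (P : Problem d e Ξ Z) : Vec d → Vec e → ℝ := fun x y => ∫ ξ, P.f x y ξ ∂P.lawXi

/-- `g(x, y) = 𝔼 g(x, y; ζ)`. -/
def gMean (P : Problem d e Ξ Z) : Vec d → Vec e → ℝ := fun x y => ∫ ζ, P.g x y ζ ∂P.lawZeta

/-- The solution `y*(x)` of the lower-level problem: a minimizer of `g(x, ·)`. -/
def yStar (P : Problem d e Ξ Z) (x : Vec d) : Vec e :=
  Classical.epsilon fun y => ∀ y', P.gMean x y ≤ P.gMean x y'

/-- The objective `F(x) = f(x, y*(x))`. -/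
def F (P : Problem d e Ξ Z) (x : Vec d) : ℝ := P.fMean x (P.yStar x)

/-- What it takes for the problem to make sense: `ξ`, `ζ` are random variables, `f(x, y; ·)` and
`g(x, y; ·)` have expectations, and the derivatives that the method evaluates exist. -/
structure WellPosed (P : Problem d e Ξ Z) : Prop where
  probXi : IsProbabilityMeasure P.lawXi
  probZeta : IsProbabilityMeasure P.lawZeta
  measurable_f : ∀ x y, Measurable (P.f x y)
  measurable_g : ∀ x y, Measurable (P.g x y)
  integrable_f : ∀ x y, Integrable (P.f x y) P.lawXi
  integrable_g : ∀ x y, Integrable (P.g x y) P.lawZeta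
  diff_f : ∀ ξ, Differentiable ℝ fun p : Vec d × Vec e => P.f p.1 p.2 ξ
  diff_g : ∀ ζ x, Differentiable ℝ fun y : Vec e => P.g x y ζ
  diff_gradY_g : ∀ ζ, Differentiable ℝ fun p : Vec d × Vec e => gradY (P.gAt ζ) p.1 p.2

end Problem

/-! ### Constants and assumptions -/

/-- The constants of the assumptions. -/
structure Consts where
  lam : ℝ
  Lg : ℝ
  Lfx : ℝ
  Lfy : ℝ
  Lgy : ℝ
  Lgxy : ℝ
  Lgyy : ℝ
  Cfy : ℝ
  Cgxy : ℝ
  sigma : ℝ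
  Delta : ℝ

namespace Consts

/-- The sign conditions that are implicit in the role of the constants. -/
structure Valid (k : Consts) : Prop where
  lam_pos : 0 < k.lam
  lam_le : k.lam ≤ k.Lg
  Lfx_nonneg : 0 ≤ k.Lfx
  Lfy_nonneg : 0 ≤ k.Lfy
  Lgy_nonneg : 0 ≤ k.Lgy
  Lgxy_nonneg : 0 ≤ k.Lgxy
  Lgyy_nonneg : 0 ≤ k.Lgyy
  Cfy_nonneg : 0 ≤ k.Cfy
  Cgxy_nonneg : 0 ≤ k.Cgxy
  sigma_nonneg : 0 ≤ k.sigma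
  Delta_nonneg : 0 ≤ k.Delta

/-- The standard Lipschitz constant of `y*`. -/
def Ly (k : Consts) : ℝ := k.Cgxy / k.lam

/-- The standard Lipschitz constant of `∇F`. -/
def gradLip (k : Consts) : ℝ :=
  (1 + k.Ly) * (k.Lfx + k.Lfy * k.Cgxy / k.lam
    + k.Cfy * (k.Lgxy / k.lam + k.Cgxy * k.Lgyy / k.lam ^ 2))

/-- The sum of the squares of the Lipschitz constants of the stochastic oracles. -/
def sumLsq (k : Consts) : ℝ :=
  k.Lgy ^ 2 + k.Lfx ^ 2 + k.Lfy ^ 2 + k.Lgxy ^ 2 + k.Lgyy ^ 2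

/-- The constant `C₀`. -/
def C0 (k : Consts) : ℝ :=
  2 * k.Lfx ^ 2 + 6 * k.Cfy ^ 2 * k.Lgxy ^ 2 / k.lam ^ 2
    + 6 * k.Cfy ^ 2 * k.Cgxy ^ 2 * k.Lgyy ^ 2 / k.lam ^ 4
    + 6 * k.Lfy ^ 2 * k.Cgxy ^ 2 / k.lam ^ 2

/-- The constant `C₁`. -/
def C1 (_ : Consts) : ℝ := 2

/-- The constant `C₂`. -/
def C2 (k : Consts) : ℝ := 6 * k.Cfy ^ 2 / k.lam ^ 2

/-- The constant `C₃`. -/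
def C3 (k : Consts) : ℝ := 6 * k.Cfy ^ 2 * k.Cgxy ^ 2 / k.lam ^ 4

/-- The constant `C₄`. -/
def C4 (k : Consts) : ℝ := 6 * k.Cgxy ^ 2 / k.lam ^ 2

end Consts

/-- For every `x`, `g(x, ·)` is `Lg`-smooth and `lam`-strongly convex:
`Lg I ⪰ ∇²_yy g(x, y) ⪰ lam I`. -/
def StronglyConvexLower {d e : ℕ} {Ξ Z : Type*} [MeasurableSpace Ξ] [MeasurableSpace Z]
    (P : Problem d e Ξ Z) (k : Consts) : Prop :=
  ∀ x y p, k.lam * ‖p‖ ^ 2 ≤ inner ℝ (hessYY P.gMean x y p) p ∧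
    inner ℝ (hessYY P.gMean x y p) p ≤ k.Lg * ‖p‖ ^ 2

/-- The nonnegative random variable `X` has an expectation, and it is at most `b`. -/
def ExpectLE {Ω : Type*} [MeasurableSpace Ω] (μ : Measure Ω) (X : Ω → ℝ) (b : ℝ) : Prop :=
  Integrable X μ ∧ ∫ ω, X ω ∂μ ≤ b

/-- The conditions on the stochastic oracles: Lipschitz continuity for every sample, variance at
most `sigma²`, and the two bounds on the expected functions. Distances of matrices are
Frobenius distances, the bound on `∇²_xy g` is in the spectral norm. -/
structure OracleConditions {d e : ℕ} {Ξ Z : Type*} [MeasurableSpace Ξ] [MeasurableSpace Z]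
    (P : Problem d e Ξ Z) (k : Consts) : Prop where
  lip_fx : ∀ ξ, LipschitzXY norm k.Lfx (gradX (P.fAt ξ))
  lip_fy : ∀ ξ, LipschitzXY norm k.Lfy (gradY (P.fAt ξ))
  lip_gy : ∀ ζ, LipschitzXY norm k.Lgy (gradY (P.gAt ζ))
  lip_gxy : ∀ ζ, LipschitzXY frobNorm k.Lgxy (hessXY (P.gAt ζ))
  lip_gyy : ∀ ζ, LipschitzXY frobNorm k.Lgyy (hessYY (P.gAt ζ))
  var_fx : ∀ x y, ExpectLE P.lawXi
    (fun ξ => ‖gradX (P.fAt ξ) x y - gradX P.fMean x y‖ ^ 2) (k.sigma ^ 2)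
  var_fy : ∀ x y, ExpectLE P.lawXi
    (fun ξ => ‖gradY (P.fAt ξ) x y - gradY P.fMean x y‖ ^ 2) (k.sigma ^ 2)
  var_gy : ∀ x y, ExpectLE P.lawZeta
    (fun ζ => ‖gradY (P.gAt ζ) x y - gradY P.gMean x y‖ ^ 2) (k.sigma ^ 2)
  var_gxy : ∀ x y, ExpectLE P.lawZeta
    (fun ζ => frobNorm (hessXY (P.gAt ζ) x y - hessXY P.gMean x y) ^ 2) (k.sigma ^ 2)
  var_gyy : ∀ x y, ExpectLE P.lawZeta
    (fun ζ => frobNorm (hessYY (P.gAt ζ) x y - hessYY P.gMean x y) ^ 2) (k.sigma ^ 2)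
  bound_fy : ∀ x y, ‖gradY P.fMean x y‖ ≤ k.Cfy
  bound_gxy : ∀ x y, ‖hessXY P.gMean x y‖ ≤ k.Cgxy

/-! ### Parameters of the method -/

/-- The parameters `c, c₀` of the step sizes, the factors `τ, γ` and the constant `L_F`. -/
structure Params where
  c : ℝ
  c0 : ℝ
  tau : ℝ
  gam : ℝ
  LF : ℝ

namespace Params

/-- The constant `C`. -/
def bigC (h : Params) (k : Consts) : ℝ :=
  max (4 * k.C0 / (h.tau * k.lam)) (4 * k.sumLsq / h.gam)

/-- The common step size `η_t = τ_t = c / (c₀ + t)^(1/3)`. -/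
def eta (h : Params) (t : ℕ) : ℝ := h.c / (h.c0 + t) ^ (1 / 3 : ℝ)

/-- The momentum parameter `β_{t+1} = (1 / (7 L_F c³) + A) η_t²` (and `β_0 = 0`, which is never
used). -/
def momentum (h : Params) (A : ℝ) : ℕ → ℝ
  | 0 => 0
  | t + 1 => (1 / (7 * h.LF * h.c ^ 3) + A) * h.eta t ^ 2

def betaGy (h : Params) (k : Consts) : ℕ → ℝ :=
  h.momentum (8 * h.bigC k * h.gam * h.tau / k.lam)

def betaFx (h : Params) (k : Consts) : ℕ → ℝ := h.momentum (k.C1 * h.gam)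

def betaFy (h : Params) (k : Consts) : ℕ → ℝ := h.momentum (k.C4 * h.gam)

def betaGxy (h : Params) (k : Consts) : ℕ → ℝ := h.momentum (k.C2 * h.gam)

def betaGyy (h : Params) (k : Consts) : ℕ → ℝ := h.momentum (k.C3 * h.gam)

/-- The conditions on the parameters. The two upper bounds on `γ` are multiplied out, so that a
vanishing denominator means no restriction. -/
structure Admissible (h : Params) (k : Consts) : Prop where
  c_pos : 0 < h.c
  tau_pos : 0 < h.tau
  gam_pos : 0 < h.gam
  LF_pos : 0 < h.LF
  LF_ge : k.gradLip ≤ h.LF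
  tau_le : h.tau ≤ 1 / (3 * k.Lg)
  gam_le_first : h.gam * (8 * √(h.bigC k) * k.Ly) ≤ √(h.tau * k.lam)
  gam_le_second : h.gam * (16 * k.sumLsq) ≤ 1
  c0_ge_two : 2 ≤ h.c0
  c0_ge_smooth : (4 * h.LF * h.c) ^ 3 ≤ h.c0
  c0_ge_gy : (16 * h.bigC k * h.gam * h.tau * h.c ^ 2 / k.lam) ^ (3 / 2 : ℝ) ≤ h.c0
  c0_ge_step : (2 / (7 * h.LF * h.c)) ^ (3 / 2 : ℝ) ≤ h.c0
  c0_ge_rest : (2 * (k.C1 + k.C2 + k.C3 + k.C4) * h.gam * h.c ^ 2) ^ (3 / 2 : ℝ) ≤ h.c0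

end Params

/-! ### The method -/

/-- The random sequences of the method: samples `ξ_t, ζ_t`, iterates `x_t, y_t` and estimators
`u_t, v_t, V_t, H_t, w_t` (`x_t, y_t` are used for `t ≥ 0`, the other sequences for `t ≥ 1`). -/
structure Sequences (d e : ℕ) (Ξ Z Ω : Type*) where
  xi : ℕ → Ω → Ξ
  zeta : ℕ → Ω → Z
  x : ℕ → Ω → Vec d
  y : ℕ → Ω → Vec e
  u : ℕ → Ω → Vec d
  v : ℕ → Ω → Vec e
  V : ℕ → Ω → Vec e →L[ℝ] Vec d
  H : ℕ → Ω → Vec e →L[ℝ] Vec e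
  w : ℕ → Ω → Vec e

namespace Sequences

variable {d e : ℕ} {Ξ Z Ω : Type*} [MeasurableSpace Ξ] [MeasurableSpace Z] [MeasurableSpace Ω]

/-- `z_t = u_t - V_t H_t⁻¹ v_t`. -/
def z (s : Sequences d e Ξ Z Ω) (t : ℕ) (ω : Ω) : Vec d :=
  s.u t ω - s.V t ω ((s.H t ω).inverse (s.v t ω))

/-- The samples: for `t ≥ 1` the pairs `(ξ_t, ζ_t)` are independent of one another and of the
initial estimators, and `ξ_t`, `ζ_t` have the laws of `ξ`, `ζ`. -/
structure Sampling (s : Sequences d e Ξ Z Ω) (P : Problem d e Ξ Z) (μ : Measure Ω) : Prop where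
  measurable_xi : ∀ t, Measurable (s.xi (t + 1))
  measurable_zeta : ∀ t, Measurable (s.zeta (t + 1))
  law_xi : ∀ t, μ.map (s.xi (t + 1)) = P.lawXi
  law_zeta : ∀ t, μ.map (s.zeta (t + 1)) = P.lawZeta
  indep : iIndepFun (fun (t : ℕ) ω => (s.xi (t + 1) ω, s.zeta (t + 1) ω)) μ
  indep_init : IndepFun (fun ω => (s.u 1 ω, s.v 1 ω, s.V 1 ω, s.H 1 ω, s.w 1 ω))
    (fun ω (t : ℕ) => (s.xi (t + 1) ω, s.zeta (t + 1) ω)) μ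

/-- The initialization: deterministic points `x₀, y₀` with `F(x₀) - inf F ≤ Delta`, and possibly
random initial estimators of the five derivatives at `(x₀, y₀)`, the projected ones in their
constraint sets; `D` bounds the initial squared errors. -/
structure Initial (s : Sequences d e Ξ Z Ω) (P : Problem d e Ξ Z) (k : Consts) (D : ℝ)
    (μ : Measure Ω) (x₀ : Vec d) (y₀ : Vec e) : Prop where
  x_zero : ∀ ω, s.x 0 ω = x₀
  y_zero : ∀ ω, s.y 0 ω = y₀
  gap : ∀ x, P.F x₀ - P.F x ≤ k.Delta
  measurable_u : Measurable (s.u 1)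
  measurable_v : Measurable (s.v 1)
  measurable_V : Measurable (s.V 1)
  measurable_H : Measurable (s.H 1)
  measurable_w : Measurable (s.w 1)
  v_mem : ∀ ω, s.v 1 ω ∈ Metric.closedBall 0 k.Cfy
  V_mem : ∀ ω, s.V 1 ω ∈ matricesBelow k.Cgxy
  H_mem : ∀ ω, s.H 1 ω ∈ matricesAbove k.lam
  err_y : ‖y₀ - P.yStar x₀‖ ^ 2 ≤ D
  err_u : ExpectLE μ (fun ω => ‖s.u 1 ω - gradX P.fMean x₀ y₀‖ ^ 2) D
  err_v : ExpectLE μ (fun ω => ‖s.v 1 ω - gradY P.fMean x₀ y₀‖ ^ 2) D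
  err_V : ExpectLE μ (fun ω => frobNorm (s.V 1 ω - hessXY P.gMean x₀ y₀) ^ 2) D
  err_H : ExpectLE μ (fun ω => frobNorm (s.H 1 ω - hessYY P.gMean x₀ y₀) ^ 2) D
  err_w : ExpectLE μ (fun ω => ‖s.w 1 ω - gradY P.gMean x₀ y₀‖ ^ 2) D

/-- The updates. The estimators with index `t + 2` are computed in iteration `t + 1` from the
samples `ξ_{t+1}, ζ_{t+1}`, evaluated at the points with indices `t` and `t + 1`. -/
structure Updates (s : Sequences d e Ξ Z Ω) (P : Problem d e Ξ Z) (k : Consts) (h : Params) :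
    Prop where
  u_step : ∀ t ω, s.u (t + 2) ω =
    (1 - h.betaFx k (t + 1)) •
        (s.u (t + 1) ω - gradX (P.fAt (s.xi (t + 1) ω)) (s.x t ω) (s.y t ω))
      + gradX (P.fAt (s.xi (t + 1) ω)) (s.x (t + 1) ω) (s.y (t + 1) ω)
  v_step : ∀ t ω, IsProjection norm (Metric.closedBall 0 k.Cfy)
    ((1 - h.betaFy k (t + 1)) •
        (s.v (t + 1) ω - gradY (P.fAt (s.xi (t + 1) ω)) (s.x t ω) (s.y t ω))
      + gradY (P.fAt (s.xi (t + 1) ω)) (s.x (t + 1) ω) (s.y (t + 1) ω)) (s.v (t + 2) ω)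
  V_step : ∀ t ω, IsProjection frobNorm (matricesBelow k.Cgxy)
    ((1 - h.betaGxy k (t + 1)) •
        (s.V (t + 1) ω - hessXY (P.gAt (s.zeta (t + 1) ω)) (s.x t ω) (s.y t ω))
      + hessXY (P.gAt (s.zeta (t + 1) ω)) (s.x (t + 1) ω) (s.y (t + 1) ω)) (s.V (t + 2) ω)
  H_step : ∀ t ω, IsProjection frobNorm (matricesAbove k.lam)
    ((1 - h.betaGyy k (t + 1)) •
        (s.H (t + 1) ω - hessYY (P.gAt (s.zeta (t + 1) ω)) (s.x t ω) (s.y t ω))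
      + hessYY (P.gAt (s.zeta (t + 1) ω)) (s.x (t + 1) ω) (s.y (t + 1) ω)) (s.H (t + 2) ω)
  w_step : ∀ t ω, s.w (t + 2) ω =
    (1 - h.betaGy k (t + 1)) •
        (s.w (t + 1) ω - gradY (P.gAt (s.zeta (t + 1) ω)) (s.x t ω) (s.y t ω))
      + gradY (P.gAt (s.zeta (t + 1) ω)) (s.x (t + 1) ω) (s.y (t + 1) ω)
  x_step : ∀ t ω, s.x (t + 1) ω = s.x t ω - (h.eta t * h.gam) • s.z (t + 1) ω
  y_step : ∀ t ω, s.y (t + 1) ω = s.y t ω - (h.eta t * h.tau) • s.w (t + 1) ω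

/-- `s` is a run of the method on the problem `P`, started at `(x₀, y₀)`. -/
structure IsSVRB (s : Sequences d e Ξ Z Ω) (P : Problem d e Ξ Z) (k : Consts) (h : Params) (D : ℝ)
    (μ : Measure Ω) (x₀ : Vec d) (y₀ : Vec e) : Prop where
  sampling : s.Sampling P μ
  init : s.Initial P k D μ x₀ y₀
  updates : s.Updates P k h

end Sequences

/-- Number of samples that `T` iterations draw: one `ξ` and one `ζ` in each. -/
def sampleCount (T : ℕ) : ℕ := 2 * T

/-- The joint law of the randomness of the method and of an independent index that is uniformly
distributed on `{0, …, T}`. -/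
def withUniformIndex {Ω : Type*} [MeasurableSpace Ω] (μ : Measure Ω) (T : ℕ) :
    Measure (Ω × Fin (T + 1)) :=
  μ.prod (PMF.uniformOfFintype (Fin (T + 1))).toMeasure

end Bilevel

end

noncomputable section

namespace Bilevel

/-! ### Matrices and the Frobenius norm -/

/-! The proof rests on a potential that decreases in expectation up to summable-to-log noise. Let a
be the expected gap of F above its lower bound, b the mean squared distance of y_t from y*(x_t), and
E the sum of the five mean squared estimator errors. The potential is a + Cγ b + E/η_t.

Implicit differentiation of ∇_y g(x, y*(x)) = 0 shows that ∇F is ∇_x f − ∇²_xy g [∇²_yy g]⁻¹ ∇_y f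
at y*(x) (`hasFDerivAt_yStar`, `hasGradientAt_F`). The formula is Lipschitz in its ingredients as
long as these obey the constraint bounds. Hence ∇F is Lipschitz, and ‖∇F(x_t) − z_{t+1}‖² is bounded
by distance and estimator errors (`norm_gradient_F_sub_sq_le`). The descent lemma (`F_sub_smul_le`)
then lowers the gap by multiples of ‖∇F‖² and ‖z‖² up to this bias. The y-step contracts the
distance to y*(x_t) up to the error of w, and the drift of y* is controlled by the x-step
(`norm_sub_yStar_step_sq_le`, `norm_sub_yStar_sq_le`).

Each estimator evaluates one fresh sample at two consecutive points. Its new error is therefore 1 −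
β times the old one plus a mean-zero term of size β times the noise plus L times the displacement
(`IsOracle.integral_step`). Unbiasedness is obtained by differentiating under the expectation. The
projections do no harm because the true derivatives lie in the constraint sets.

In the weighted sum of these inequalities, one part of β pays for the growth of 1/η_t and the other
cancels the bias; the constants C and γ are such that the ‖z‖² and ‖w‖² terms cancel too. What
remains (`potential_succ_le`) is a decrease by (ηγ/2) 𝔼‖∇F‖² up to a multiple of η³. As η_t³ =
c³/(c₀ + t), the noise sums to a logarithm; as 1/η_T grows like T^{1/3}, the average of 𝔼‖∇F‖² is of
order log T / T^{2/3} (`exists_average_le`).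

The decrease is used only from an index t₀ on, where η_t is small enough. Before it, the moments
obey a crude affine recursion (`exists_total_le`). Both steps work with real sequences satisfying
`Moments.Bounds`, so every constant is uniform in the problem, the dimensions and the run. -/

/-- The columns of a matrix, as a vector of a Euclidean space. -/
def columns {m n : ℕ} : (Vec n →L[ℝ] Vec m) →L[ℝ] PiLp 2 (fun _ : Fin n => Vec m) :=
  ((PiLp.continuousLinearEquiv 2 ℝ (fun _ : Fin n => Vec m)).symm :
      (Fin n → Vec m) →L[ℝ] PiLp 2 (fun _ : Fin n => Vec m)).comp
    (ContinuousLinearMap.pi fun j =>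
      ContinuousLinearMap.apply ℝ (Vec m) (EuclideanSpace.single j (1 : ℝ)))

lemma columns_apply {m n : ℕ} (A : Vec n →L[ℝ] Vec m) (j : Fin n) :
    columns A j = A (EuclideanSpace.single j (1 : ℝ)) := rfl

lemma frobNorm_eq {m n : ℕ} (A : Vec n →L[ℝ] Vec m) : frobNorm A = ‖columns A‖ := by
  rw [PiLp.norm_eq_of_L2]; rfl

lemma apply_eq_sum_columns {m n : ℕ} (A : Vec n →L[ℝ] Vec m) (p : Vec n) :
    A p = ∑ j, p j • columns A j := by
  conv_lhs => rw [← (EuclideanSpace.basisFun (Fin n) ℝ).sum_repr p]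
  simp [map_sum, columns_apply]

lemma opNorm_le_frobNorm {m n : ℕ} (A : Vec n →L[ℝ] Vec m) : ‖A‖ ≤ frobNorm A := by
  refine A.opNorm_le_bound (Real.sqrt_nonneg _) fun p => ?_
  rw [apply_eq_sum_columns, frobNorm, EuclideanSpace.norm_eq p, ← Real.sqrt_mul (by positivity)]
  refine Real.le_sqrt_of_sq_le ?_
  calc ‖∑ j, p j • columns A j‖ ^ 2 ≤ (∑ j, ‖columns A j‖ * ‖p j‖) ^ 2 := by
        gcongr
        refine (norm_sum_le _ _).trans_eq (Finset.sum_congr rfl fun j _ => ?_)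
        rw [norm_smul, mul_comm]
    _ ≤ _ := Finset.sum_mul_sq_le_sq_mul_sq _ _ _

/-- A matrix from its columns. -/
def ofColumns {m n : ℕ} (c : Fin n → Vec m) : Vec n →L[ℝ] Vec m :=
  ∑ j, (EuclideanSpace.proj j : Vec n →L[ℝ] ℝ).smulRight (c j)

lemma eq_ofColumns {m n : ℕ} (A : Vec n →L[ℝ] Vec m) :
    A = ofColumns fun j => A (EuclideanSpace.single j (1 : ℝ)) := by
  ext1 p
  rw [apply_eq_sum_columns]
  simp [ofColumns, sum_apply, columns_apply]

lemma continuous_ofColumns {m n : ℕ} : Continuous (ofColumns : (Fin n → Vec m) → _) := by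
  unfold ofColumns
  refine continuous_finsetSum _ fun j _ => ?_
  exact ((ContinuousLinearMap.smulRightL ℝ (Vec n) (Vec m)
    (EuclideanSpace.proj j : Vec n →L[ℝ] ℝ)).continuous).comp (continuous_apply j)

/-- A matrix is a continuous function of its finitely many columns, so measurability can be checked
on vectors, where derivatives are limits of difference quotients. -/
lemma measurable_matrix_of_apply {α : Type*} {mα : MeasurableSpace α} {m n : ℕ}
    {A : α → Vec n →L[ℝ] Vec m} (hA : ∀ p, Measurable fun a => A a p) : Measurable A := by
  have : A = fun a => ofColumns fun j => A a (EuclideanSpace.single j (1 : ℝ)) :=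
    funext fun a => eq_ofColumns (A a)
  rw [this]
  exact continuous_ofColumns.measurable.comp (measurable_pi_lambda _ fun j => hA _)

/-! ### Projections -/

/-- The variational inequality ⟨a − b, w − b⟩ ≤ 0 for w in S, taken at both projections and added,
gives ‖b − b'‖² ≤ ⟨a − a', b − b'⟩. The argument runs in the image under Φ because matrices carry
the operator norm while the projection refers to the Frobenius norm; `columns` is the Φ that makes
the latter Hilbertian. -/
lemma IsProjection.norm_sub_le {E H : Type*} [AddCommGroup E] [Module ℝ E]
    [NormedAddCommGroup H] [InnerProductSpace ℝ H] (Φ : E →ₗ[ℝ] H) {N : E → ℝ}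
    (hN : ∀ x, N x = ‖Φ x‖) {S : Set E} (hS : Convex ℝ S) {a a' b b' : E}
    (h : IsProjection N S a b) (h' : IsProjection N S a' b') : N (b - b') ≤ N (a - a') := by
  have hconv : Convex ℝ (Φ '' S) := hS.linear_image Φ
  have key : ∀ {a b : E}, IsProjection N S a b → ∀ w ∈ S,
      inner ℝ (Φ a - Φ b) (Φ w - Φ b) ≤ 0 := by
    intro a b h w hw
    have hb : Φ b ∈ Φ '' S := ⟨b, h.1, rfl⟩
    refine (norm_eq_iInf_iff_real_inner_le_zero hconv (u := Φ a) hb).1 ?_ (Φ w) ⟨w, hw, rfl⟩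
    have : Nonempty (Φ '' S) := ⟨⟨_, hb⟩⟩
    refine le_antisymm (le_ciInf ?_)
      (ciInf_le (f := fun w : Φ '' S => ‖Φ a - w‖)
        ⟨0, by rintro _ ⟨w, rfl⟩; positivity⟩ (⟨_, hb⟩ : Φ '' S))
    rintro ⟨_, w, hw, rfl⟩
    have := h.2 w hw
    rwa [hN, hN, map_sub, map_sub] at this
  have h1 := key h b' h'.1
  have h2 := key h' b h.1
  rw [hN, hN, map_sub, map_sub]
  set α := Φ a - Φ a'
  set ρ := Φ b - Φ b'
  have h3 : ‖ρ‖ ^ 2 ≤ inner ℝ α ρ := by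
    have e1 : Φ b' - Φ b = -ρ := by simp [ρ]
    rw [e1, inner_neg_right] at h1
    have e2 : α - ρ = (Φ a - Φ b) - (Φ a' - Φ b') := by simp only [α, ρ]; abel
    have e3 : inner ℝ (α - ρ) ρ ≥ 0 := by rw [e2, inner_sub_left]; linarith
    rw [inner_sub_left, real_inner_self_eq_norm_sq] at e3
    linarith
  have h4 := real_inner_le_norm α ρ
  by_contra! hlt
  have hρ : 0 < ‖ρ‖ := (norm_nonneg α).trans_lt hlt
  nlinarith

lemma isProjection_self {E : Type*} [AddCommGroup E] {N : E → ℝ} (h0 : N 0 = 0)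
    (hN : ∀ x, 0 ≤ N x) {S : Set E} {a : E} (h : a ∈ S) : IsProjection N S a a :=
  ⟨h, fun b' _ => by rw [sub_self, h0]; exact hN _⟩

/-- A point of S is its own projection, so nonexpansiveness applies. With m the true derivative,
this is why projected estimators obey the same error recursion as unprojected ones. -/
lemma IsProjection.norm_sub_mem_le {E H : Type*} [AddCommGroup E] [Module ℝ E]
    [NormedAddCommGroup H] [InnerProductSpace ℝ H] (Φ : E →ₗ[ℝ] H) {N : E → ℝ}
    (hN : ∀ x, N x = ‖Φ x‖) {S : Set E} (hS : Convex ℝ S) {a b m : E}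
    (h : IsProjection N S a b) (hm : m ∈ S) : N (b - m) ≤ N (a - m) :=
  h.norm_sub_le Φ hN hS (isProjection_self (by simp [hN]) (fun x => by simp [hN]) hm)

/-- A projection is the restriction of a continuous map. -/
lemma exists_continuous_projection {E H : Type*} [NormedAddCommGroup E] [NormedSpace ℝ E]
    [FiniteDimensional ℝ E]
    [NormedAddCommGroup H] [InnerProductSpace ℝ H] (Φ : E →L[ℝ] H) {N : E → ℝ}
    (hN : ∀ x, N x = ‖Φ x‖) (hle : ∀ x, ‖x‖ ≤ N x) {S : Set E} (hS : Convex ℝ S) :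
    ∃ π : E → E, Continuous π ∧ ∀ a b, IsProjection N S a b → b = π a := by
  classical
  -- Projections are only known to exist at the points that the method meets. A choice among them is
  -- Lipschitz on the set where they exist, and a Lipschitz map into a finite-dimensional space
  -- extends to the whole space.
  let f : E → E := fun a => if h : ∃ b, IsProjection N S a b then h.choose else 0
  have hf : ∀ a, (∃ b, IsProjection N S a b) → IsProjection N S a (f a) := by
    intro a h
    simp only [f, dif_pos h]
    exact h.choose_spec
  have hL : LipschitzOnWith ‖Φ‖₊ f {a | ∃ b, IsProjection N S a b} := by
    refine LipschitzOnWith.of_dist_le_mul fun a ha a' ha' => ?_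
    rw [dist_eq_norm, dist_eq_norm]
    refine (hle _).trans (((hf a ha).norm_sub_le Φ.toLinearMap hN hS (hf a' ha')).trans ?_)
    rw [hN]
    exact Φ.le_opNorm _
  obtain ⟨π, hπ, heq⟩ := hL.extend_finite_dimension
  refine ⟨π, hπ.continuous, fun a b h => ?_⟩
  rw [← heq ⟨b, h⟩]
  -- Nonexpansiveness at equal arguments is uniqueness, so b is the chosen projection.
  have := h.norm_sub_le Φ.toLinearMap hN hS (hf a ⟨b, h⟩)
  have h0 : N (a - a) = 0 := by simp [hN]
  rw [h0] at this
  exact sub_eq_zero.1 (norm_le_zero_iff.1 ((hle _).trans this))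

lemma convex_matricesAbove {e : ℕ} (l : ℝ) : Convex ℝ (matricesAbove l : Set (Vec e →L[ℝ] Vec e)) := by
  rintro A ⟨hA, hA'⟩ B ⟨hB, hB'⟩ s t hs ht hst
  refine ⟨?_, fun p => ?_⟩
  · exact IsSelfAdjoint.add (R := Vec e →L[ℝ] Vec e) (IsSelfAdjoint.smul (IsSelfAdjoint.all s) hA)
      (IsSelfAdjoint.smul (IsSelfAdjoint.all t) hB)
  have h1 := mul_le_mul_of_nonneg_left (hA' p) hs
  have h2 := mul_le_mul_of_nonneg_left (hB' p) ht
  simp only [add_apply, smul_apply, inner_add_left,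
    real_inner_smul_left]
  calc l * ‖p‖ ^ 2 = (s + t) * (l * ‖p‖ ^ 2) := by rw [hst, one_mul]
    _ ≤ _ := by linarith

lemma convex_matricesBelow {d e : ℕ} (C : ℝ) :
    Convex ℝ (matricesBelow C : Set (Vec e →L[ℝ] Vec d)) := by
  have : (matricesBelow C : Set (Vec e →L[ℝ] Vec d)) = Metric.closedBall 0 C := by
    ext A; simp [matricesBelow]
  rw [this]
  exact convex_closedBall _ _

/-! ### Inverses of coercive matrices -/

section Inverse

variable {e : ℕ} {l : ℝ} {A B : Vec e →L[ℝ] Vec e}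

lemma norm_le_of_coercive (hA : ∀ p, l * ‖p‖ ^ 2 ≤ inner ℝ (A p) p) (p : Vec e) :
    l * ‖p‖ ≤ ‖A p‖ := by
  have h := (hA p).trans (real_inner_le_norm _ _)
  rcases (norm_nonneg p).eq_or_lt with h0 | h0
  · rw [← h0]; simp
  · nlinarith

/-- Coercivity gives ‖A p‖ ≥ l‖p‖, hence injectivity, which suffices in finite dimension. -/
lemma isInvertible_of_coercive (hl : 0 < l) (hA : ∀ p, l * ‖p‖ ^ 2 ≤ inner ℝ (A p) p) :
    A.IsInvertible := by
  have hinj : Function.Injective A.toLinearMap := by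
    refine (injective_iff_map_eq_zero _).2 fun p hp => ?_
    have := norm_le_of_coercive hA p
    have h0 : A p = 0 := hp
    rw [h0, norm_zero] at this
    exact norm_le_zero_iff.1 (by nlinarith)
  refine ⟨(LinearEquiv.ofInjectiveEndo A.toLinearMap hinj).toContinuousLinearEquiv, ?_⟩
  ext1 p
  rfl

lemma apply_inverse_of_coercive (hl : 0 < l) (hA : ∀ p, l * ‖p‖ ^ 2 ≤ inner ℝ (A p) p)
    (p : Vec e) : A (A.inverse p) = p := by
  obtain ⟨E, rfl⟩ := isInvertible_of_coercive hl hA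
  simp [ContinuousLinearMap.inverse_equiv]

lemma inverse_apply_of_coercive (hl : 0 < l) (hA : ∀ p, l * ‖p‖ ^ 2 ≤ inner ℝ (A p) p)
    (p : Vec e) : A.inverse (A p) = p := by
  obtain ⟨E, rfl⟩ := isInvertible_of_coercive hl hA
  simp [ContinuousLinearMap.inverse_equiv]

lemma norm_inverse_apply_le (hl : 0 < l) (hA : ∀ p, l * ‖p‖ ^ 2 ≤ inner ℝ (A p) p) (p : Vec e) :
    ‖A.inverse p‖ ≤ ‖p‖ / l := by
  rw [le_div_iff₀ hl, mul_comm]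
  simpa [apply_inverse_of_coercive hl hA] using norm_le_of_coercive hA (A.inverse p)

/-- A⁻¹ − B⁻¹ = A⁻¹(B − A)B⁻¹, and each inverse costs a factor 1/l. -/
lemma norm_inverse_sub_inverse_apply_le (hl : 0 < l)
    (hA : ∀ p, l * ‖p‖ ^ 2 ≤ inner ℝ (A p) p) (hB : ∀ p, l * ‖p‖ ^ 2 ≤ inner ℝ (B p) p)
    (p : Vec e) : ‖A.inverse p - B.inverse p‖ ≤ ‖A - B‖ * (‖p‖ / l) / l := by
  have h : A.inverse p - B.inverse p = A.inverse ((B - A) (B.inverse p)) := by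
    rw [sub_apply, map_sub, apply_inverse_of_coercive hl hB,
      inverse_apply_of_coercive hl hA]
  rw [h]
  refine (norm_inverse_apply_le hl hA _).trans ?_
  gcongr
  refine ((B - A).le_opNorm _).trans ?_
  rw [norm_sub_rev]
  gcongr
  exact norm_inverse_apply_le hl hB _

lemma inner_inverse_comm (hl : 0 < l) (hA : A ∈ matricesAbove l) (p q : Vec e) :
    inner ℝ (A.inverse p) q = inner ℝ p (A.inverse q) := by
  have hs := (ContinuousLinearMap.isSelfAdjoint_iff_isSymmetric.1 hA.1) (A.inverse p) (A.inverse q)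
  simp only [ContinuousLinearMap.coe_coe] at hs
  rw [apply_inverse_of_coercive hl hA.2, apply_inverse_of_coercive hl hA.2] at hs
  exact hs.symm

/-- Inversion is Lipschitz on the set of admissible matrices; its continuous extension to all
matrices can be composed with measurable maps. -/
lemma measurable_inverse_apply {α : Type*} {mα : MeasurableSpace α} (hl : 0 < l)
    {H : α → Vec e →L[ℝ] Vec e} {v : α → Vec e} (hH : Measurable H) (hv : Measurable v)
    (hmem : ∀ a, H a ∈ matricesAbove l) : Measurable fun a => (H a).inverse (v a) := by
  have hL : LipschitzOnWith (Real.toNNReal (1 / l / l))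
      (fun A : Vec e →L[ℝ] Vec e => A.inverse) (matricesAbove l) := by
    refine LipschitzOnWith.of_dist_le_mul fun A hA B hB => ?_
    rw [dist_eq_norm, dist_eq_norm, Real.coe_toNNReal _ (by positivity)]
    refine ContinuousLinearMap.opNorm_le_bound _ (by positivity) fun p => ?_
    rw [sub_apply]
    refine (norm_inverse_sub_inverse_apply_le hl hA.2 hB.2 p).trans_eq ?_
    field_simp
  obtain ⟨I, hI, heq⟩ := hL.extend_finite_dimension
  have : (fun a => (H a).inverse (v a)) = fun a => I (H a) (v a) :=
    funext fun a => by rw [← heq (hmem a)]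
  rw [this]
  have hc : Continuous fun q : (Vec e →L[ℝ] Vec e) × Vec e => q.1 q.2 := by fun_prop
  exact hc.measurable.comp ((hI.continuous.measurable.comp hH).prodMk hv)

end Inverse

/-! ### Quadratic bounds -/

/-- Mean value theorem for φ(s) − φ'(0)s − Ms²/2, whose derivative is nonpositive on (0, 1). Being
one-sided, it serves for upper quadratic bounds through φ and for lower ones through −φ. -/
lemma le_add_add_half_of_deriv_le {φ φ' : ℝ → ℝ} {M : ℝ} (hd : ∀ s, HasDerivAt φ (φ' s) s)
    (h : ∀ s, 0 < s → s < 1 → φ' s ≤ φ' 0 + M * s) : φ 1 ≤ φ 0 + φ' 0 + M / 2 := by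
  have hψ : ∀ s, HasDerivAt (fun s => φ s - φ' 0 * s - M / 2 * s ^ 2) (φ' s - φ' 0 - M * s) s := by
    intro s
    have := ((hd s).sub ((hasDerivAt_id s).const_mul (φ' 0))).sub
      ((hasDerivAt_pow 2 s).const_mul (M / 2))
    have hv : φ' s - φ' 0 - M * s = φ' s - φ' 0 * 1 - M / 2 * (↑(2 : ℕ) * s ^ (2 - 1)) := by
      norm_num; ring
    rw [hv]
    exact this
  obtain ⟨s, ⟨hs0, hs1⟩, hs⟩ := exists_hasDerivAt_eq_slope _ _ (zero_lt_one' ℝ)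
    (fun s _ => (hψ s).continuousAt.continuousWithinAt) (fun s _ => hψ s)
  have := h s hs0 hs1
  norm_num at hs
  linarith

section Quadratic

variable {n : ℕ} {f : Vec n → ℝ} {G : Vec n → Vec n}

lemma hasDerivAt_comp_line (hG : ∀ y, HasGradientAt f (G y) y) (y p : Vec n) (s : ℝ) :
    HasDerivAt (fun s : ℝ => f (y + s • p)) (inner ℝ (G (y + s • p)) p) s := by
  have hl : HasDerivAt (fun s : ℝ => y + s • p) p s := by
    simpa using ((hasDerivAt_id s).smul_const p).const_add y
  have := (hG (y + s • p)).hasFDerivAt.comp_hasDerivAt s hl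
  rwa [InnerProductSpace.toDual_apply_apply] at this

lemma le_quadratic_of_lipschitz (hG : ∀ y, HasGradientAt f (G y) y) {L : ℝ}
    (hL : ∀ y y', ‖G y - G y'‖ ≤ L * ‖y - y'‖) (y p : Vec n) :
    f (y + p) ≤ f y + inner ℝ (G y) p + L / 2 * ‖p‖ ^ 2 := by
  have := le_add_add_half_of_deriv_le (M := L * ‖p‖ ^ 2)
    (fun s => hasDerivAt_comp_line hG y p s) fun s hs0 _ => by
      rw [← sub_le_iff_le_add', ← inner_sub_left]
      refine (real_inner_le_norm _ _).trans ?_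
      have h1 := hL (y + s • p) (y + (0 : ℝ) • p)
      have h2 : ‖y + s • p - (y + (0 : ℝ) • p)‖ = s * ‖p‖ := by
        rw [zero_smul, add_zero, add_sub_cancel_left, norm_smul, Real.norm_of_nonneg hs0.le]
      rw [h2] at h1
      calc _ ≤ L * (s * ‖p‖) * ‖p‖ := by gcongr
        _ = _ := by ring
  simp only [one_smul, zero_smul, add_zero] at this
  linarith

variable {B : Vec n → Vec n →L[ℝ] Vec n}

/-- The mean value theorem along a segment transfers bounds on the Hessian to increments of the
gradient without integrating the Hessian or assuming it continuous. -/
lemma exists_inner_gradient_sub (hB : ∀ y, HasFDerivAt G (B y) y) (y p : Vec n) {s : ℝ}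
    (hs : 0 < s) :
    ∃ q, inner ℝ (G (y + s • p)) p - inner ℝ (G (y + (0 : ℝ) • p)) p = inner ℝ (B q p) p * s := by
  have hφ : ∀ r : ℝ, HasDerivAt (fun r : ℝ => (inner ℝ (G (y + r • p)) p : ℝ))
      (inner ℝ (B (y + r • p) p) p) r := by
    intro r
    have hl : HasDerivAt (fun s : ℝ => y + s • p) p r := by
      simpa using ((hasDerivAt_id r).smul_const p).const_add y
    have := ((hB (y + r • p)).comp_hasDerivAt r hl).inner ℝ (hasDerivAt_const r p)
    simpa using this
  obtain ⟨r, -, hr⟩ := exists_hasDerivAt_eq_slope _ _ hs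
    (fun s _ => (hφ s).continuousAt.continuousWithinAt) (fun s _ => hφ s)
  refine ⟨y + r • p, ?_⟩
  rw [hr, sub_zero, div_mul_cancel₀ _ hs.ne']

lemma le_quadratic_of_hessian_le (hG : ∀ y, HasGradientAt f (G y) y)
    (hB : ∀ y, HasFDerivAt G (B y) y) {L : ℝ} (hL : ∀ y p, inner ℝ (B y p) p ≤ L * ‖p‖ ^ 2)
    (y p : Vec n) : f (y + p) ≤ f y + inner ℝ (G y) p + L / 2 * ‖p‖ ^ 2 := by
  have := le_add_add_half_of_deriv_le (M := L * ‖p‖ ^ 2)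
    (fun s => hasDerivAt_comp_line hG y p s) fun s hs0 _ => by
      obtain ⟨q, hq⟩ := exists_inner_gradient_sub hB y p hs0
      have := mul_le_mul_of_nonneg_right (hL q p) hs0.le
      linarith
  simp only [one_smul, zero_smul, add_zero] at this
  linarith

lemma quadratic_le_of_le_hessian (hG : ∀ y, HasGradientAt f (G y) y)
    (hB : ∀ y, HasFDerivAt G (B y) y) {l : ℝ} (hl : ∀ y p, l * ‖p‖ ^ 2 ≤ inner ℝ (B y p) p)
    (y p : Vec n) : f y + inner ℝ (G y) p + l / 2 * ‖p‖ ^ 2 ≤ f (y + p) := by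
  have := le_add_add_half_of_deriv_le (M := -(l * ‖p‖ ^ 2))
    (fun s => (hasDerivAt_comp_line hG y p s).neg) fun s hs0 _ => by
      obtain ⟨q, hq⟩ := exists_inner_gradient_sub hB y p hs0
      have := mul_le_mul_of_nonneg_right (hl q p) hs0.le
      linarith
  simp only [one_smul, zero_smul, add_zero, Pi.neg_apply] at this
  linarith

/-- The quadratic lower bound at 0 tends to infinity with ‖y‖, so the continuous f attains its
minimum. -/
lemma exists_minimizer_of_coercive (hG : ∀ y, HasGradientAt f (G y) y)
    (hB : ∀ y, HasFDerivAt G (B y) y) {l : ℝ} (h0 : 0 < l)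
    (hl : ∀ y p, l * ‖p‖ ^ 2 ≤ inner ℝ (B y p) p) : ∃ y, ∀ y', f y ≤ f y' := by
  have hc : Continuous f := continuous_iff_continuousAt.2 fun y => (hG y).continuousAt
  refine hc.exists_forall_le ?_
  have hlow : ∀ y, f 0 - ‖G 0‖ * ‖y‖ + l / 2 * ‖y‖ ^ 2 ≤ f y := by
    intro y
    have h1 := quadratic_le_of_le_hessian hG hB hl 0 y
    have h2 := neg_le_of_abs_le (abs_real_inner_le_norm (G 0) y)
    rw [zero_add] at h1
    linarith
  refine Filter.tendsto_atTop_mono hlow ?_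
  have hp : Filter.Tendsto (fun r : ℝ => f 0 + r * (l / 2 * r - ‖G 0‖)) Filter.atTop Filter.atTop :=
    Filter.tendsto_atTop_add_const_left _ _ (Filter.tendsto_id.atTop_mul_atTop₀
      (Filter.tendsto_atTop_add_const_right _ _
        (Filter.tendsto_id.const_mul_atTop (by positivity))))
  have := hp.comp (tendsto_norm_cocompact_atTop (E := Vec n))
  refine this.congr fun y => ?_
  simp only [Function.comp]
  ring

end Quadratic

/-! ### Integrals that depend on a parameter -/

/-- On the unit ball around p the derivative is dominated by |L| + ‖h' p a‖, which is integrable.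
This is the source of the unbiasedness of all five oracles. -/
lemma hasFDerivAt_integral_of_lipschitz {α E G : Type*} [MeasurableSpace α] {ν : Measure α}
    [IsFiniteMeasure ν] [NormedAddCommGroup E] [NormedSpace ℝ E] [NormedAddCommGroup G]
    [NormedSpace ℝ G] {h : E → α → G} {h' : E → α → E →L[ℝ] G} {L : ℝ}
    (hi : ∀ p, Integrable (h p) ν) (hi' : ∀ p, Integrable (h' p) ν)
    (hd : ∀ a p, HasFDerivAt (fun p => h p a) (h' p a) p)
    (hL : ∀ a p p', ‖h' p a - h' p' a‖ ≤ L * ‖p - p'‖) (p : E) :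
    HasFDerivAt (fun p => ∫ a, h p a ∂ν) (∫ a, h' p a ∂ν) p := by
  refine hasFDerivAt_integral_of_dominated_of_fderiv_le (bound := fun a => |L| + ‖h' p a‖)
    (Metric.ball_mem_nhds p one_pos) (Filter.Eventually.of_forall fun q => (hi q).1) (hi p)
    (hi' p).1 (Filter.Eventually.of_forall fun a q hq => ?_)
    ((integrable_const _).add (hi' p).norm) (Filter.Eventually.of_forall fun a q _ => hd a q)
  have h1 := hL a q p
  have h2 : ‖q - p‖ ≤ 1 := by rw [← dist_eq_norm]; exact (Metric.mem_ball.1 hq).le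
  have h3 : L * ‖q - p‖ ≤ |L| := by
    calc L * ‖q - p‖ ≤ |L| * 1 := mul_le_mul (le_abs_self _) h2 (norm_nonneg _) (abs_nonneg _)
      _ = |L| := mul_one _
  have h4 := norm_sub_norm_le (h' q a) (h' p a)
  linarith

/-- The directional derivative is the pointwise limit of the quotients k(h(p + v/k) − h(p)), which
are measurable in the sample. -/
lemma measurable_apply_of_hasFDerivAt {α E G : Type*} [MeasurableSpace α] [NormedAddCommGroup E]
    [NormedSpace ℝ E] [NormedAddCommGroup G] [NormedSpace ℝ G] [MeasurableSpace G] [BorelSpace G]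
    [SecondCountableTopology G] {h : E → α → G} {h' : α → E →L[ℝ] G} {p : E}
    (hm : ∀ p, Measurable (h p)) (hd : ∀ a, HasFDerivAt (fun p => h p a) (h' a) p) (v : E) :
    Measurable fun a => h' a v := by
  refine measurable_of_tendsto_metrizable
    (f := fun (k : ℕ) a => (k : ℝ) • (h (p + (k : ℝ)⁻¹ • v) a - h p a)) (fun k => ?_) ?_
  · exact ((hm _).sub (hm _)).const_smul _
  · refine tendsto_pi_nhds.2 fun a => ?_
    refine (hd a).lim v (c := fun k : ℕ => (k : ℝ)) (l := Filter.atTop) ?_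
    simpa using tendsto_natCast_atTop_atTop (R := ℝ)

lemma measurable_of_hasGradientAt {α : Type*} [MeasurableSpace α] {n : ℕ} {h : Vec n → α → ℝ}
    {G : α → Vec n} {p : Vec n} (hm : ∀ p, Measurable (h p))
    (hd : ∀ a, HasGradientAt (fun p => h p a) (G a) p) : Measurable G := by
  have hc : ∀ i, Measurable fun a => G a i := by
    intro i
    have := measurable_apply_of_hasFDerivAt hm (fun a => (hd a).hasFDerivAt)
      (EuclideanSpace.single i (1 : ℝ))
    simpa [EuclideanSpace.inner_single_right] using this
  have : G = fun a => WithLp.toLp 2 fun i => G a i := rfl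
  rw [this]
  exact (WithLp.measurable_toLp 2 _).comp (measurable_pi_lambda _ hc)

lemma memLp_two_of_sub {α E : Type*} [MeasurableSpace α] {ν : Measure α}
    [NormedAddCommGroup E] [MeasurableSpace E] [BorelSpace E]
    [SecondCountableTopology E] {X : α → E} {c : E} (hX : Measurable X)
    (h : Integrable (fun a => ‖X a - c‖ ^ 2) ν) : MemLp (fun a => X a - c) 2 ν :=
  (memLp_two_iff_integrable_sq_norm (hX.sub measurable_const).aestronglyMeasurable).2 h

lemma integrable_of_sub {α E : Type*} [MeasurableSpace α] {ν : Measure α} [IsFiniteMeasure ν]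
    [NormedAddCommGroup E] [MeasurableSpace E] [BorelSpace E]
    [SecondCountableTopology E] {X : α → E} {c : E} (hX : Measurable X)
    (h : Integrable (fun a => ‖X a - c‖ ^ 2) ν) : Integrable X ν := by
  have := ((memLp_two_of_sub hX h).integrable one_le_two).add (integrable_const c)
  refine this.congr (Filter.Eventually.of_forall fun a => ?_)
  simp

/-! ### Stochastic oracles -/

lemma integral_norm_const_add_sq {α E : Type*} [MeasurableSpace α] {ν : Measure α}
    [IsProbabilityMeasure ν] [NormedAddCommGroup E] [InnerProductSpace ℝ E] [CompleteSpace E]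
    {Y : α → E} (hY : MemLp Y 2 ν) (c : E) :
    Integrable (fun a => ‖c + Y a‖ ^ 2) ν ∧
    ∫ a, ‖c + Y a‖ ^ 2 ∂ν = ‖c‖ ^ 2 + 2 * inner ℝ c (∫ a, Y a ∂ν) + ∫ a, ‖Y a‖ ^ 2 ∂ν := by
  have h1 : Integrable Y ν := hY.integrable one_le_two
  have h2 : Integrable (fun a => ‖Y a‖ ^ 2) ν := hY.integrable_norm_pow two_ne_zero
  have h3 : Integrable (fun a => 2 * inner ℝ c (Y a)) ν := (h1.const_inner c).const_mul 2
  have h4 : (fun a => ‖c + Y a‖ ^ 2) = fun a => ‖c‖ ^ 2 + 2 * inner ℝ c (Y a) + ‖Y a‖ ^ 2 :=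
    funext fun a => norm_add_sq_real _ _
  rw [h4]
  have h5 : Integrable (fun a => ‖c‖ ^ 2 + 2 * inner ℝ c (Y a)) ν := (integrable_const _).add h3
  refine ⟨h5.add h2, ?_⟩
  rw [integral_add h5 h2, integral_add (integrable_const _) h3, integral_const_mul,
    integral_inner h1]
  simp

/-- `O(x, y; ·)` is an unbiased estimator of `m(x, y)` of variance at most `σ²`, every sample of
which is `L`-Lipschitz in `(x, y)`. -/
structure IsOracle {α E : Type*} [MeasurableSpace α] (ν : Measure α) {d e : ℕ}
    [NormedAddCommGroup E] [InnerProductSpace ℝ E] [MeasurableSpace E]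
    (O : α → Vec d → Vec e → E) (m : Vec d → Vec e → E) (L σ : ℝ) : Prop where
  meas : ∀ x y, Measurable fun a => O a x y
  lip : ∀ a, LipschitzXY norm L (O a)
  mean : ∀ x y, ∫ a, O a x y ∂ν = m x y
  var : ∀ x y, ExpectLE ν (fun a => ‖O a x y - m x y‖ ^ 2) (σ ^ 2)

namespace IsOracle

variable {α E : Type*} [MeasurableSpace α] {ν : Measure α} {d e : ℕ}
    [NormedAddCommGroup E] [InnerProductSpace ℝ E] [MeasurableSpace E] [BorelSpace E]
    {O : α → Vec d → Vec e → E} {m : Vec d → Vec e → E} {L σ : ℝ}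

/-- Carathéodory: continuity in (x, y) and measurability in the sample give joint measurability, so
the oracle may be evaluated at random points. -/
lemma measurable_comp (hO : IsOracle ν O m L σ) {Ω : Type*} {mΩ : MeasurableSpace Ω} {ξ : Ω → α}
    {x : Ω → Vec d} {y : Ω → Vec e} (hξ : Measurable ξ) (hx : Measurable x) (hy : Measurable y) :
    Measurable fun ω => O (ξ ω) (x ω) (y ω) := by
  have hc : ∀ a, Continuous fun p : Vec d × Vec e => O a p.1 p.2 := by
    intro a
    refine continuous_iff_continuousAt.2 fun p => ?_
    refine tendsto_iff_norm_sub_tendsto_zero.2 (squeeze_zero (fun _ => norm_nonneg _)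
      (fun q => hO.lip a q.1 q.2 p.1 p.2) ?_)
    have : Continuous fun q : Vec d × Vec e => L * √(‖q.1 - p.1‖ ^ 2 + ‖q.2 - p.2‖ ^ 2) := by
      fun_prop
    simpa using this.tendsto p
  have := measurable_uncurry_of_continuous_of_measurable
    (u := fun (p : Vec d × Vec e) a => O a p.1 p.2) hc (fun p => hO.meas p.1 p.2)
  exact this.comp ((hx.prodMk hy).prodMk hξ)

variable [IsProbabilityMeasure ν] [SecondCountableTopology E]

lemma integrable (hO : IsOracle ν O m L σ) (x : Vec d) (y : Vec e) :
    Integrable (fun a => O a x y) ν := integrable_of_sub (hO.meas x y) (hO.var x y).1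

lemma lip_mean (hO : IsOracle ν O m L σ) : LipschitzXY norm L m := by
  intro x y x' y'
  rw [← hO.mean, ← hO.mean, ← integral_sub (hO.integrable _ _) (hO.integrable _ _)]
  refine (norm_integral_le_of_norm_le_const
    (Filter.Eventually.of_forall fun a => hO.lip a x y x' y')).trans_eq ?_
  simp

lemma measurable_mean_comp (hO : IsOracle ν O m L σ) {Ω : Type*} {mΩ : MeasurableSpace Ω}
    {x : Ω → Vec d} {y : Ω → Vec e} (hx : Measurable x) (hy : Measurable y) :
    Measurable fun ω => m (x ω) (y ω) := by
  have hc : Continuous fun p : Vec d × Vec e => m p.1 p.2 := by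
    refine continuous_iff_continuousAt.2 fun p => ?_
    refine tendsto_iff_norm_sub_tendsto_zero.2 (squeeze_zero (fun _ => norm_nonneg _)
      (fun q => hO.lip_mean q.1 q.2 p.1 p.2) ?_)
    have : Continuous fun q : Vec d × Vec e => L * √(‖q.1 - p.1‖ ^ 2 + ‖q.2 - p.2‖ ^ 2) := by
      fun_prop
    simpa using this.tendsto p
  exact hc.measurable.comp (hx.prodMk hy)

variable [CompleteSpace E]

/-- The new error is (1 − β)(u − m(x, y)) + M with M = βX + (1 − β)(c + D), where X is the noise at
the new point and c + D is the oracle increment minus its mean. M has mean zero, so there is no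
cross term, and the variance of the increment is at most its second moment, which the Lipschitz
bound for every sample ties to the displacement. -/
lemma integral_step (hO : IsOracle ν O m L σ) (x x' : Vec d) (y y' : Vec e) (u : E) (β : ℝ) :
    Integrable (fun a => ‖(1 - β) • (u - O a x y) + O a x' y' - m x' y'‖ ^ 2) ν ∧
    ∫ a, ‖(1 - β) • (u - O a x y) + O a x' y' - m x' y'‖ ^ 2 ∂ν ≤
      (1 - β) ^ 2 * ‖u - m x y‖ ^ 2 + 2 * β ^ 2 * σ ^ 2
        + 2 * (1 - β) ^ 2 * L ^ 2 * (‖x - x'‖ ^ 2 + ‖y - y'‖ ^ 2) := by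
  set X : α → E := fun a => O a x' y' - m x' y' with hX
  set D : α → E := fun a => O a x' y' - O a x y with hD
  set c : E := m x y - m x' y' with hc
  have hXL : MemLp X 2 ν := memLp_two_of_sub (hO.meas _ _) (hO.var _ _).1
  have hYL : MemLp (fun a => O a x y - m x y) 2 ν := memLp_two_of_sub (hO.meas _ _) (hO.var _ _).1
  have hDL : MemLp D 2 ν := by
    refine ((hXL.sub hYL).sub (memLp_const c)).ae_eq (Filter.Eventually.of_forall fun a => ?_)
    simp only [hX, hD, hc, Pi.sub_apply]; abel
  have hDmean : ∫ a, D a ∂ν = -c := by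
    rw [integral_sub (hO.integrable _ _) (hO.integrable _ _), hO.mean, hO.mean, hc]; abel
  have hXmean : ∫ a, X a ∂ν = 0 := by
    rw [integral_sub (hO.integrable _ _) (integrable_const _), hO.mean]; simp
  obtain ⟨hcD1, hcD2⟩ := integral_norm_const_add_sq hDL c
  have hcDL : MemLp (fun a => c + D a) 2 ν := (memLp_const c).add hDL
  have hcD3 : ∫ a, ‖c + D a‖ ^ 2 ∂ν ≤ L ^ 2 * (‖x - x'‖ ^ 2 + ‖y - y'‖ ^ 2) := by
    have hb : ∫ a, ‖D a‖ ^ 2 ∂ν ≤ L ^ 2 * (‖x - x'‖ ^ 2 + ‖y - y'‖ ^ 2) := by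
      have : ∀ a, ‖D a‖ ^ 2 ≤ L ^ 2 * (‖x - x'‖ ^ 2 + ‖y - y'‖ ^ 2) := by
        intro a
        have h := hO.lip a x y x' y'
        rw [norm_sub_rev] at h
        calc ‖D a‖ ^ 2 ≤ (L * √(‖x - x'‖ ^ 2 + ‖y - y'‖ ^ 2)) ^ 2 := by
              gcongr
          _ = _ := by rw [mul_pow, Real.sq_sqrt (by positivity)]
      refine (integral_mono (hDL.integrable_norm_pow two_ne_zero) (integrable_const _)
        this).trans_eq ?_
      simp
    -- As D has mean −c, the second moment of c + D is that of D minus ‖c‖².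
    rw [hcD2, hDmean, inner_neg_right, real_inner_self_eq_norm_sq]
    nlinarith [sq_nonneg ‖c‖]
  set M : α → E := fun a => β • X a + (1 - β) • (c + D a) with hM
  have hML : MemLp M 2 ν := (hXL.const_smul β).add (hcDL.const_smul (1 - β))
  have hMmean : ∫ a, M a ∂ν = 0 := by
    have h1 : Integrable (fun a => β • X a) ν := (hXL.integrable one_le_two).smul β
    have h2 : Integrable (fun a => (1 - β) • (c + D a)) ν :=
      (hcDL.integrable one_le_two).smul (1 - β)
    rw [integral_add h1 h2, integral_smul, integral_smul, hXmean,
      integral_add (integrable_const _) (hDL.integrable one_le_two), hDmean]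
    simp
  have hr : ∀ a, (1 - β) • (u - O a x y) + O a x' y' - m x' y'
      = (1 - β) • (u - m x y) + M a := by
    intro a
    simp only [hM, hX, hD, hc]
    module
  obtain ⟨h1, h2⟩ := integral_norm_const_add_sq hML ((1 - β) • (u - m x y))
  simp only [hr]
  refine ⟨h1, ?_⟩
  rw [h2, hMmean, inner_zero_right, mul_zero, add_zero, norm_smul, mul_pow, Real.norm_eq_abs,
    sq_abs]
  have hMb : ∫ a, ‖M a‖ ^ 2 ∂ν ≤ 2 * β ^ 2 * σ ^ 2
      + 2 * (1 - β) ^ 2 * (L ^ 2 * (‖x - x'‖ ^ 2 + ‖y - y'‖ ^ 2)) := by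
    have hi1 : Integrable (fun a => 2 * β ^ 2 * ‖X a‖ ^ 2) ν := (hO.var x' y').1.const_mul _
    have hi2 : Integrable (fun a => 2 * (1 - β) ^ 2 * ‖c + D a‖ ^ 2) ν := hcD1.const_mul _
    calc ∫ a, ‖M a‖ ^ 2 ∂ν
        ≤ ∫ a, (2 * β ^ 2 * ‖X a‖ ^ 2 + 2 * (1 - β) ^ 2 * ‖c + D a‖ ^ 2) ∂ν := by
          refine integral_mono (hML.integrable_norm_pow two_ne_zero) (hi1.add hi2) fun a => ?_
          have h3 := norm_add_le (β • X a) ((1 - β) • (c + D a))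
          rw [norm_smul, norm_smul] at h3
          have h4 : ‖M a‖ ^ 2 ≤ (‖β‖ * ‖X a‖ + ‖1 - β‖ * ‖c + D a‖) ^ 2 := by gcongr
          have h5 := sq_nonneg (‖β‖ * ‖X a‖ - ‖1 - β‖ * ‖c + D a‖)
          have h6 : ‖β‖ ^ 2 = β ^ 2 := by simp
          have h7 : ‖1 - β‖ ^ 2 = (1 - β) ^ 2 := by simp
          simp only
          rw [← h6, ← h7]
          nlinarith
      _ = 2 * β ^ 2 * ∫ a, ‖X a‖ ^ 2 ∂ν + 2 * (1 - β) ^ 2 * ∫ a, ‖c + D a‖ ^ 2 ∂ν := by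
          rw [integral_add hi1 hi2, integral_const_mul, integral_const_mul]
      _ ≤ _ := by
          gcongr
          exact (hO.var x' y').2
  linarith

end IsOracle

/-! ### Derivatives in a product -/

section Product

variable {d e : ℕ} {G : Type*} [NormedAddCommGroup G] [NormedSpace ℝ G]

lemma hasFDerivAt_left {h : Vec d × Vec e → G} {h' : Vec d × Vec e →L[ℝ] G} {p : Vec d × Vec e}
    (hd : HasFDerivAt h h' p) :
    HasFDerivAt (fun x => h (x, p.2)) (h'.comp (ContinuousLinearMap.inl ℝ (Vec d) (Vec e))) p.1 :=
  HasFDerivAt.comp (g := h) p.1 hd (hasFDerivAt_prodMk_left p.1 p.2)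

lemma hasFDerivAt_right {h : Vec d × Vec e → G} {h' : Vec d × Vec e →L[ℝ] G} {p : Vec d × Vec e}
    (hd : HasFDerivAt h h' p) :
    HasFDerivAt (fun y => h (p.1, y)) (h'.comp (ContinuousLinearMap.inr ℝ (Vec d) (Vec e))) p.2 :=
  HasFDerivAt.comp (g := h) p.2 hd (hasFDerivAt_prodMk_right p.1 p.2)

/-- The linear map on a product with given partial maps. -/
def ofPartials (A : Vec d →L[ℝ] G) (B : Vec e →L[ℝ] G) : Vec d × Vec e →L[ℝ] G :=
  A.comp (ContinuousLinearMap.fst ℝ (Vec d) (Vec e))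
    + B.comp (ContinuousLinearMap.snd ℝ (Vec d) (Vec e))

lemma ofPartials_apply (A : Vec d →L[ℝ] G) (B : Vec e →L[ℝ] G) (p : Vec d × Vec e) :
    ofPartials A B p = A p.1 + B p.2 := rfl

lemma ofPartials_comp_inl (A : Vec d →L[ℝ] G) (B : Vec e →L[ℝ] G) :
    (ofPartials A B).comp (ContinuousLinearMap.inl ℝ (Vec d) (Vec e)) = A := by
  ext p; simp [ofPartials_apply]

lemma ofPartials_comp_inr (A : Vec d →L[ℝ] G) (B : Vec e →L[ℝ] G) :
    (ofPartials A B).comp (ContinuousLinearMap.inr ℝ (Vec d) (Vec e)) = B := by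
  ext p; simp [ofPartials_apply]

lemma ofPartials_sub (A A' : Vec d →L[ℝ] G) (B B' : Vec e →L[ℝ] G) :
    ofPartials A B - ofPartials A' B' = ofPartials (A - A') (B - B') := by
  refine ContinuousLinearMap.ext fun p => ?_
  simp only [sub_apply, ofPartials_apply]; abel

lemma norm_ofPartials_le (A : Vec d →L[ℝ] G) (B : Vec e →L[ℝ] G) :
    ‖ofPartials A B‖ ≤ ‖A‖ + ‖B‖ := by
  refine ContinuousLinearMap.opNorm_le_bound _ (by positivity) fun p => ?_
  rw [ofPartials_apply, add_mul]
  refine (norm_add_le _ _).trans (add_le_add ?_ ?_)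
  · exact (A.le_opNorm _).trans (by gcongr; exact norm_fst_le p)
  · exact (B.le_opNorm _).trans (by gcongr; exact norm_snd_le p)

lemma eq_ofPartials {h : Vec d × Vec e → G} {p : Vec d × Vec e} (hd : DifferentiableAt ℝ h p) :
    HasFDerivAt h (ofPartials (fderiv ℝ (fun x => h (x, p.2)) p.1)
      (fderiv ℝ (fun y => h (p.1, y)) p.2)) p := by
  have h1 := hd.hasFDerivAt
  rw [(hasFDerivAt_left h1).fderiv, (hasFDerivAt_right h1).fderiv]
  convert h1 using 1
  refine ContinuousLinearMap.ext fun q => ?_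
  simp [ofPartials_apply, ← map_add]

lemma integral_ofPartials {α : Type*} [MeasurableSpace α] {ν : Measure α} [CompleteSpace G]
    {A : α → Vec d →L[ℝ] G} {B : α → Vec e →L[ℝ] G} (hA : Integrable A ν) (hB : Integrable B ν) :
    Integrable (fun a => ofPartials (A a) (B a)) ν ∧
      ∫ a, ofPartials (A a) (B a) ∂ν = ofPartials (∫ a, A a ∂ν) (∫ a, B a ∂ν) := by
  have hA' := ((ContinuousLinearMap.compL ℝ (Vec d × Vec e) (Vec d) G).flip
    (ContinuousLinearMap.fst ℝ (Vec d) (Vec e))).integrable_comp hA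
  have hB' := ((ContinuousLinearMap.compL ℝ (Vec d × Vec e) (Vec e) G).flip
    (ContinuousLinearMap.snd ℝ (Vec d) (Vec e))).integrable_comp hB
  refine ⟨hA'.add hB', (integral_add hA' hB').trans ?_⟩
  rw [ContinuousLinearMap.integral_comp_comm _ hA, ContinuousLinearMap.integral_comp_comm _ hB]
  rfl

lemma sqrt_add_sq_le (x x' : Vec d) (y y' : Vec e) :
    √(‖x - x'‖ ^ 2 + ‖y - y'‖ ^ 2) ≤ ‖x - x'‖ + ‖y - y'‖ := by
  refine Real.sqrt_le_iff.2 ⟨by positivity, ?_⟩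
  nlinarith [norm_nonneg (x - x'), norm_nonneg (y - y')]

/-- The product carries the maximum norm. The crude factor 2 only enters the domination hypotheses
for differentiating under the integral, not the final constants. -/
lemma sqrt_add_sq_le_norm (p q : Vec d × Vec e) :
    √(‖p.1 - q.1‖ ^ 2 + ‖p.2 - q.2‖ ^ 2) ≤ 2 * ‖p - q‖ := by
  have h1 := norm_fst_le (p - q)
  have h2 := norm_snd_le (p - q)
  have h3 := sqrt_add_sq_le p.1 q.1 p.2 q.2
  rw [Prod.fst_sub] at h1
  rw [Prod.snd_sub] at h2
  linarith

end Product

/-- Transposition of matrices, as a continuous linear map. -/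
def transposeL (d e : ℕ) : (Vec d →L[ℝ] Vec e) →L[ℝ] (Vec e →L[ℝ] Vec d) :=
  LinearMap.mkContinuous
    { toFun := fun A => ContinuousLinearMap.adjoint A
      map_add' := fun A B => map_add _ A B
      map_smul' := fun c A => by simp } 1 fun A => by simp

lemma transposeL_apply {d e : ℕ} (A : Vec d →L[ℝ] Vec e) :
    transposeL d e A = ContinuousLinearMap.adjoint A := rfl

lemma transposeL_transposeL {d e : ℕ} (A : Vec d →L[ℝ] Vec e) :
    transposeL e d (transposeL d e A) = A := by simp [transposeL_apply]

namespace Problem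

variable {d e : ℕ} {Ξ Z : Type*} [MeasurableSpace Ξ] [MeasurableSpace Z] {P : Problem d e Ξ Z}
  {k : Consts}

/-! ### The upper-level oracles -/

lemma hasFDerivAt_f (hW : P.WellPosed) (ξ : Ξ) (p : Vec d × Vec e) :
    HasFDerivAt (fun p : Vec d × Vec e => P.f p.1 p.2 ξ)
      (ofPartials (InnerProductSpace.toDual ℝ _ (gradX (P.fAt ξ) p.1 p.2))
        (InnerProductSpace.toDual ℝ _ (gradY (P.fAt ξ) p.1 p.2))) p := by
  have h := eq_ofPartials (hW.diff_f ξ p)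
  rw [gradX, gradY, toDual_gradient, toDual_gradient]
  exact h

lemma hasGradientAt_fAt_left (hW : P.WellPosed) (ξ : Ξ) (x : Vec d) (y : Vec e) :
    HasGradientAt (fun x => P.f x y ξ) (gradX (P.fAt ξ) x y) x := by
  have := hasFDerivAt_left (hasFDerivAt_f hW ξ (x, y))
  rwa [ofPartials_comp_inl] at this

lemma hasGradientAt_fAt_right (hW : P.WellPosed) (ξ : Ξ) (x : Vec d) (y : Vec e) :
    HasGradientAt (fun y => P.f x y ξ) (gradY (P.fAt ξ) x y) y := by
  have := hasFDerivAt_right (hasFDerivAt_f hW ξ (x, y))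
  rwa [ofPartials_comp_inr] at this

lemma measurable_gradX_fAt (hW : P.WellPosed) (x : Vec d) (y : Vec e) :
    Measurable fun ξ => gradX (P.fAt ξ) x y :=
  measurable_of_hasGradientAt (h := fun x => P.f x y) (fun x => hW.measurable_f x y)
    fun ξ => hasGradientAt_fAt_left hW ξ x y

lemma measurable_gradY_fAt (hW : P.WellPosed) (x : Vec d) (y : Vec e) :
    Measurable fun ξ => gradY (P.fAt ξ) x y :=
  measurable_of_hasGradientAt (h := fun y => P.f x y) (fun y => hW.measurable_f x y)
    fun ξ => hasGradientAt_fAt_right hW ξ x y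

/-- Differentiation under the expectation, jointly in (x, y): the chain rule through y* needs the
joint derivative, and its two parts identify the partial gradients of the mean as means of sampled
gradients. -/
lemma hasFDerivAt_fMean_aux (hW : P.WellPosed) (hk : k.Valid) (hO : OracleConditions P k)
    (p : Vec d × Vec e) :
    HasFDerivAt (fun p : Vec d × Vec e => P.fMean p.1 p.2)
      (ofPartials (InnerProductSpace.toDual ℝ _ (∫ ξ, gradX (P.fAt ξ) p.1 p.2 ∂P.lawXi))
        (InnerProductSpace.toDual ℝ _ (∫ ξ, gradY (P.fAt ξ) p.1 p.2 ∂P.lawXi))) p := by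
  have := hW.probXi
  have hx : ∀ p : Vec d × Vec e, Integrable (fun ξ => gradX (P.fAt ξ) p.1 p.2) P.lawXi := fun p =>
    integrable_of_sub (measurable_gradX_fAt hW _ _) (hO.var_fx p.1 p.2).1
  have hy : ∀ p : Vec d × Vec e, Integrable (fun ξ => gradY (P.fAt ξ) p.1 p.2) P.lawXi := fun p =>
    integrable_of_sub (measurable_gradY_fAt hW _ _) (hO.var_fy p.1 p.2).1
  have hi := fun p : Vec d × Vec e => integral_ofPartials
    ((innerSL ℝ).integrable_comp (hx p)) ((innerSL ℝ).integrable_comp (hy p))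
  have key := hasFDerivAt_integral_of_lipschitz (ν := P.lawXi)
    (h := fun (p : Vec d × Vec e) ξ => P.f p.1 p.2 ξ) (L := (k.Lfx + k.Lfy) * 2)
    (fun p => hW.integrable_f p.1 p.2) (fun p => (hi p).1) (fun ξ p => hasFDerivAt_f hW ξ p)
    (fun ξ p q => ?_) p
  · refine key.congr_fderiv ((hi p).2.trans ?_)
    congr 1
    · exact ContinuousLinearMap.integral_comp_comm (innerSL ℝ) (hx p)
    · exact ContinuousLinearMap.integral_comp_comm (innerSL ℝ) (hy p)
  · have h1 := hO.lip_fx ξ p.1 p.2 q.1 q.2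
    have h2 := hO.lip_fy ξ p.1 p.2 q.1 q.2
    have h3 := sqrt_add_sq_le_norm p q
    have h4 := mul_le_mul_of_nonneg_left h3 hk.Lfx_nonneg
    have h5 := mul_le_mul_of_nonneg_left h3 hk.Lfy_nonneg
    rw [ofPartials_sub]
    refine (norm_ofPartials_le _ _).trans ?_
    rw [← map_sub, ← map_sub, innerSL_apply_norm, innerSL_apply_norm]
    linarith

lemma gradX_fMean (hW : P.WellPosed) (hk : k.Valid) (hO : OracleConditions P k)
    (x : Vec d) (y : Vec e) : gradX P.fMean x y = ∫ ξ, gradX (P.fAt ξ) x y ∂P.lawXi := by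
  have := hasFDerivAt_left (hasFDerivAt_fMean_aux hW hk hO (x, y))
  rw [ofPartials_comp_inl] at this
  exact HasGradientAt.gradient this

lemma gradY_fMean (hW : P.WellPosed) (hk : k.Valid) (hO : OracleConditions P k)
    (x : Vec d) (y : Vec e) : gradY P.fMean x y = ∫ ξ, gradY (P.fAt ξ) x y ∂P.lawXi := by
  have := hasFDerivAt_right (hasFDerivAt_fMean_aux hW hk hO (x, y))
  rw [ofPartials_comp_inr] at this
  exact HasGradientAt.gradient this

lemma hasFDerivAt_fMean (hW : P.WellPosed) (hk : k.Valid) (hO : OracleConditions P k)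
    (p : Vec d × Vec e) :
    HasFDerivAt (fun p : Vec d × Vec e => P.fMean p.1 p.2)
      (ofPartials (InnerProductSpace.toDual ℝ _ (gradX P.fMean p.1 p.2))
        (InnerProductSpace.toDual ℝ _ (gradY P.fMean p.1 p.2))) p := by
  rw [gradX_fMean hW hk hO, gradY_fMean hW hk hO]
  exact hasFDerivAt_fMean_aux hW hk hO p

lemma isOracle_fx (hW : P.WellPosed) (hk : k.Valid) (hO : OracleConditions P k) :
    IsOracle P.lawXi (fun ξ => gradX (P.fAt ξ)) (gradX P.fMean) k.Lfx k.sigma where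
  meas := measurable_gradX_fAt hW
  lip := hO.lip_fx
  mean x y := (gradX_fMean hW hk hO x y).symm
  var := hO.var_fx

lemma isOracle_fy (hW : P.WellPosed) (hk : k.Valid) (hO : OracleConditions P k) :
    IsOracle P.lawXi (fun ξ => gradY (P.fAt ξ)) (gradY P.fMean) k.Lfy k.sigma where
  meas := measurable_gradY_fAt hW
  lip := hO.lip_fy
  mean x y := (gradY_fMean hW hk hO x y).symm
  var := hO.var_fy

/-! ### The lower-level oracles -/

lemma hasGradientAt_gAt (hW : P.WellPosed) (ζ : Z) (x : Vec d) (y : Vec e) :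
    HasGradientAt (fun y => P.g x y ζ) (gradY (P.gAt ζ) x y) y :=
  (hW.diff_g ζ x y).hasGradientAt

lemma measurable_gradY_gAt (hW : P.WellPosed) (x : Vec d) (y : Vec e) :
    Measurable fun ζ => gradY (P.gAt ζ) x y :=
  measurable_of_hasGradientAt (h := fun y => P.g x y) (fun y => hW.measurable_g x y)
    fun ζ => hasGradientAt_gAt hW ζ x y

lemma integrable_gradY_gAt (hW : P.WellPosed) (hO : OracleConditions P k) (x : Vec d)
    (y : Vec e) : Integrable (fun ζ => gradY (P.gAt ζ) x y) P.lawZeta :=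
  have := hW.probZeta
  integrable_of_sub (measurable_gradY_gAt hW _ _) (hO.var_gy x y).1

lemma hasGradientAt_gMean_aux (hW : P.WellPosed) (hO : OracleConditions P k)
    (x : Vec d) (y : Vec e) :
    HasGradientAt (P.gMean x) (∫ ζ, gradY (P.gAt ζ) x y ∂P.lawZeta) y := by
  have := hW.probZeta
  have hi := integrable_gradY_gAt hW hO x
  have key := hasFDerivAt_integral_of_lipschitz (ν := P.lawZeta)
    (h := fun y ζ => P.g x y ζ) (L := k.Lgy)
    (fun y => hW.integrable_g x y) (fun y => (innerSL ℝ).integrable_comp (hi y))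
    (fun ζ y => (hasGradientAt_gAt hW ζ x y).hasFDerivAt) (fun ζ p q => ?_) y
  · refine HasFDerivAt.congr_fderiv key ?_
    exact ContinuousLinearMap.integral_comp_comm (innerSL ℝ) (hi y)
  · have h1 := hO.lip_gy ζ x p x q
    rw [sub_self, norm_zero, zero_pow two_ne_zero, zero_add, Real.sqrt_sq (norm_nonneg _)] at h1
    rw [← map_sub, innerSL_apply_norm]
    exact h1

lemma gradY_gMean (hW : P.WellPosed) (hO : OracleConditions P k)
    (x : Vec d) (y : Vec e) : gradY P.gMean x y = ∫ ζ, gradY (P.gAt ζ) x y ∂P.lawZeta :=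
  (hasGradientAt_gMean_aux hW hO x y).gradient

lemma hasGradientAt_gMean (hW : P.WellPosed) (hO : OracleConditions P k)
    (x : Vec d) (y : Vec e) : HasGradientAt (P.gMean x) (gradY P.gMean x y) y := by
  rw [gradY_gMean hW hO]
  exact hasGradientAt_gMean_aux hW hO x y

lemma isOracle_gy (hW : P.WellPosed) (hO : OracleConditions P k) :
    IsOracle P.lawZeta (fun ζ => gradY (P.gAt ζ)) (gradY P.gMean) k.Lgy k.sigma where
  meas := measurable_gradY_gAt hW
  lip := hO.lip_gy
  mean x y := (gradY_gMean hW hO x y).symm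
  var := hO.var_gy

lemma transposeL_hessXY (h : Vec d → Vec e → ℝ) (x : Vec d) (y : Vec e) :
    transposeL e d (hessXY h x y) = fderiv ℝ (fun x' => gradY h x' y) x :=
  transposeL_transposeL _

lemma hasFDerivAt_gradY_gAt (hW : P.WellPosed) (ζ : Z) (p : Vec d × Vec e) :
    HasFDerivAt (fun p : Vec d × Vec e => gradY (P.gAt ζ) p.1 p.2)
      (ofPartials (transposeL e d (hessXY (P.gAt ζ) p.1 p.2)) (hessYY (P.gAt ζ) p.1 p.2)) p := by
  have h := eq_ofPartials (hW.diff_gradY_g ζ p)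
  rw [transposeL_hessXY]
  exact h

lemma measurable_hessXY_gAt (hW : P.WellPosed) (x : Vec d) (y : Vec e) :
    Measurable fun ζ => hessXY (P.gAt ζ) x y := by
  have h : Measurable fun ζ => transposeL e d (hessXY (P.gAt ζ) x y) := by
    refine measurable_matrix_of_apply fun p => measurable_apply_of_hasFDerivAt
      (h := fun x ζ => gradY (P.gAt ζ) x y) (p := x) (fun x => measurable_gradY_gAt hW x y) (fun ζ => ?_) p
    have := hasFDerivAt_left (hasFDerivAt_gradY_gAt hW ζ (x, y))
    rwa [ofPartials_comp_inl] at this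
  have h' := (transposeL d e).continuous.measurable.comp h
  simpa only [Function.comp_def, transposeL_transposeL] using h'

lemma measurable_hessYY_gAt (hW : P.WellPosed) (x : Vec d) (y : Vec e) :
    Measurable fun ζ => hessYY (P.gAt ζ) x y := by
  refine measurable_matrix_of_apply fun p => measurable_apply_of_hasFDerivAt
    (h := fun y ζ => gradY (P.gAt ζ) x y) (p := y) (fun y => measurable_gradY_gAt hW x y) (fun ζ => ?_) p
  have := hasFDerivAt_right (hasFDerivAt_gradY_gAt hW ζ (x, y))
  rwa [ofPartials_comp_inr] at this

lemma integrable_of_frobNorm_sub {α : Type*} [MeasurableSpace α] {ν : Measure α}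
    [IsFiniteMeasure ν] {m n : ℕ} {X : α → Vec n →L[ℝ] Vec m} {c : Vec n →L[ℝ] Vec m}
    (hX : Measurable X) (h : Integrable (fun a => frobNorm (X a - c) ^ 2) ν) :
    Integrable X ν := by
  refine integrable_of_sub (c := c) hX (h.mono'
    ((hX.sub measurable_const).norm.pow_const 2).aestronglyMeasurable
    (Filter.Eventually.of_forall fun a => ?_))
  rw [Real.norm_of_nonneg (by positivity)]
  gcongr
  exact opNorm_le_frobNorm _

lemma integrable_hessXY_gAt (hW : P.WellPosed) (hO : OracleConditions P k) (x : Vec d)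
    (y : Vec e) : Integrable (fun ζ => hessXY (P.gAt ζ) x y) P.lawZeta :=
  have := hW.probZeta
  integrable_of_frobNorm_sub (measurable_hessXY_gAt hW _ _) (hO.var_gxy x y).1

lemma integrable_hessYY_gAt (hW : P.WellPosed) (hO : OracleConditions P k) (x : Vec d)
    (y : Vec e) : Integrable (fun ζ => hessYY (P.gAt ζ) x y) P.lawZeta :=
  have := hW.probZeta
  integrable_of_frobNorm_sub (measurable_hessYY_gAt hW _ _) (hO.var_gyy x y).1

/-- Joint differentiability of the mean ∇_y g is what implicit differentiation of y* requires; its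
two parts also give the unbiasedness of the second-order oracles. -/
lemma hasFDerivAt_gradY_gMean_aux (hW : P.WellPosed) (hk : k.Valid) (hO : OracleConditions P k)
    (p : Vec d × Vec e) :
    HasFDerivAt (fun p : Vec d × Vec e => gradY P.gMean p.1 p.2)
      (ofPartials (transposeL e d (∫ ζ, hessXY (P.gAt ζ) p.1 p.2 ∂P.lawZeta))
        (∫ ζ, hessYY (P.gAt ζ) p.1 p.2 ∂P.lawZeta)) p := by
  have := hW.probZeta
  have hx := fun p : Vec d × Vec e => integrable_hessXY_gAt hW hO p.1 p.2
  have hy := fun p : Vec d × Vec e => integrable_hessYY_gAt hW hO p.1 p.2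
  have hi := fun p : Vec d × Vec e => integral_ofPartials
    ((transposeL e d).integrable_comp (hx p)) (hy p)
  have key := hasFDerivAt_integral_of_lipschitz (ν := P.lawZeta)
    (h := fun (p : Vec d × Vec e) ζ => gradY (P.gAt ζ) p.1 p.2) (L := (k.Lgxy + k.Lgyy) * 2)
    (fun p => integrable_gradY_gAt hW hO p.1 p.2) (fun p => (hi p).1)
    (fun ζ p => hasFDerivAt_gradY_gAt hW ζ p) (fun ζ p q => ?_) p
  · have hg : (fun p : Vec d × Vec e => gradY P.gMean p.1 p.2)
        = fun p => ∫ ζ, gradY (P.gAt ζ) p.1 p.2 ∂P.lawZeta :=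
      funext fun p => gradY_gMean hW hO p.1 p.2
    rw [hg, ← ContinuousLinearMap.integral_comp_comm _ (hx p)]
    refine key.congr_fderiv ?_
    exact (hi p).2
  · have h1 := (opNorm_le_frobNorm _).trans (hO.lip_gxy ζ p.1 p.2 q.1 q.2)
    have h2 := (opNorm_le_frobNorm _).trans (hO.lip_gyy ζ p.1 p.2 q.1 q.2)
    have h3 := sqrt_add_sq_le_norm p q
    have h4 := mul_le_mul_of_nonneg_left h3 hk.Lgxy_nonneg
    have h5 := mul_le_mul_of_nonneg_left h3 hk.Lgyy_nonneg
    rw [ofPartials_sub]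
    refine (norm_ofPartials_le _ _).trans ?_
    rw [← map_sub, transposeL_apply, LinearIsometryEquiv.norm_map]
    linarith

lemma hessXY_gMean (hW : P.WellPosed) (hk : k.Valid) (hO : OracleConditions P k)
    (x : Vec d) (y : Vec e) : hessXY P.gMean x y = ∫ ζ, hessXY (P.gAt ζ) x y ∂P.lawZeta := by
  have := hasFDerivAt_left (hasFDerivAt_gradY_gMean_aux hW hk hO (x, y))
  rw [ofPartials_comp_inl] at this
  rw [hessXY, this.fderiv]
  exact transposeL_transposeL _

lemma hessYY_gMean (hW : P.WellPosed) (hk : k.Valid) (hO : OracleConditions P k)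
    (x : Vec d) (y : Vec e) : hessYY P.gMean x y = ∫ ζ, hessYY (P.gAt ζ) x y ∂P.lawZeta := by
  have := hasFDerivAt_right (hasFDerivAt_gradY_gMean_aux hW hk hO (x, y))
  rw [ofPartials_comp_inr] at this
  exact this.fderiv

lemma hasFDerivAt_gradY_gMean (hW : P.WellPosed) (hk : k.Valid) (hO : OracleConditions P k)
    (p : Vec d × Vec e) :
    HasFDerivAt (fun p : Vec d × Vec e => gradY P.gMean p.1 p.2)
      (ofPartials (transposeL e d (hessXY P.gMean p.1 p.2)) (hessYY P.gMean p.1 p.2)) p := by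
  rw [hessXY_gMean hW hk hO, hessYY_gMean hW hk hO]
  exact hasFDerivAt_gradY_gMean_aux hW hk hO p

lemma hasFDerivAt_gradY_gMean_left (hW : P.WellPosed) (hk : k.Valid) (hO : OracleConditions P k)
    (x : Vec d) (y : Vec e) :
    HasFDerivAt (fun x => gradY P.gMean x y) (transposeL e d (hessXY P.gMean x y)) x := by
  have := hasFDerivAt_left (hasFDerivAt_gradY_gMean hW hk hO (x, y))
  rwa [ofPartials_comp_inl] at this

lemma hasFDerivAt_gradY_gMean_right (hW : P.WellPosed) (hk : k.Valid) (hO : OracleConditions P k)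
    (x : Vec d) (y : Vec e) :
    HasFDerivAt (gradY P.gMean x) (hessYY P.gMean x y) y := by
  have := hasFDerivAt_right (hasFDerivAt_gradY_gMean hW hk hO (x, y))
  rwa [ofPartials_comp_inr] at this

/-- Passing to columns places the oracle in a Hilbert space whose norm is the Frobenius norm, as the
variance computation needs. -/
lemma isOracle_gxy (hW : P.WellPosed) (hk : k.Valid) (hO : OracleConditions P k) :
    IsOracle P.lawZeta (fun ζ x y => columns (hessXY (P.gAt ζ) x y))
      (fun x y => columns (hessXY P.gMean x y)) k.Lgxy k.sigma where
  meas x y := columns.continuous.measurable.comp (measurable_hessXY_gAt hW x y)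
  lip ζ x y x' y' := by
    rw [← map_sub, ← frobNorm_eq]
    exact hO.lip_gxy ζ x y x' y'
  mean x y := by
    rw [hessXY_gMean hW hk hO]
    exact ContinuousLinearMap.integral_comp_comm _ (integrable_hessXY_gAt hW hO x y)
  var x y := by
    simp only [← map_sub, ← frobNorm_eq]
    exact hO.var_gxy x y

lemma isOracle_gyy (hW : P.WellPosed) (hk : k.Valid) (hO : OracleConditions P k) :
    IsOracle P.lawZeta (fun ζ x y => columns (hessYY (P.gAt ζ) x y))
      (fun x y => columns (hessYY P.gMean x y)) k.Lgyy k.sigma where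
  meas x y := columns.continuous.measurable.comp (measurable_hessYY_gAt hW x y)
  lip ζ x y x' y' := by
    rw [← map_sub, ← frobNorm_eq]
    exact hO.lip_gyy ζ x y x' y'
  mean x y := by
    rw [hessYY_gMean hW hk hO]
    exact ContinuousLinearMap.integral_comp_comm _ (integrable_hessYY_gAt hW hO x y)
  var x y := by
    simp only [← map_sub, ← frobNorm_eq]
    exact hO.var_gyy x y

end Problem

namespace Problem

variable {d e : ℕ} {Ξ Z : Type*} [MeasurableSpace Ξ] [MeasurableSpace Z] {P : Problem d e Ξ Z}
  {k : Consts}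

/-! ### The lower-level problem -/

/-- The convexity assumption concerns the quadratic form only; symmetry holds because this is a
second derivative. Membership in the constraint set is what makes projecting H harmless. -/
lemma hessYY_gMean_mem (hW : P.WellPosed) (hk : k.Valid) (hO : OracleConditions P k)
    (hS : StronglyConvexLower P k) (x : Vec d) (y : Vec e) :
    hessYY P.gMean x y ∈ matricesAbove k.lam := by
  refine ⟨?_, fun p => (hS x y p).1⟩
  rw [ContinuousLinearMap.isSelfAdjoint_iff_isSymmetric]
  intro p q
  have h2 : HasFDerivAt (fun y => innerSL ℝ (gradY P.gMean x y))
      ((innerSL ℝ).comp (hessYY P.gMean x y)) y :=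
    (innerSL ℝ).hasFDerivAt.comp y (hasFDerivAt_gradY_gMean_right hW hk hO x y)
  have := second_derivative_symmetric (fun y => (hasGradientAt_gMean hW hO x y).hasFDerivAt) h2 p q
  simp only [ContinuousLinearMap.comp_apply, innerSL_apply_apply] at this
  simp only [ContinuousLinearMap.coe_coe]
  rw [this, real_inner_comm]

lemma yStar_spec (hW : P.WellPosed) (hk : k.Valid) (hO : OracleConditions P k)
    (hS : StronglyConvexLower P k) (x : Vec d) (y : Vec e) :
    P.gMean x (P.yStar x) ≤ P.gMean x y :=
  Classical.epsilon_spec (exists_minimizer_of_coercive (hasGradientAt_gMean hW hO x)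
    (hasFDerivAt_gradY_gMean_right hW hk hO x) hk.lam_pos fun y p => (hS x y p).1) y

lemma gradY_gMean_yStar (hW : P.WellPosed) (hk : k.Valid) (hO : OracleConditions P k)
    (hS : StronglyConvexLower P k) (x : Vec d) : gradY P.gMean x (P.yStar x) = 0 := by
  have hmin : IsLocalMin (P.gMean x) (P.yStar x) :=
    Filter.Eventually.of_forall (yStar_spec hW hk hO hS x)
  have := hmin.hasFDerivAt_eq_zero (hasGradientAt_gMean hW hO x (P.yStar x)).hasFDerivAt
  simpa using this

/-- Sum of the strong convexity bounds from y to y' and from y' to y. -/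
lemma le_inner_gradY_sub (hW : P.WellPosed) (hk : k.Valid) (hO : OracleConditions P k)
    (hS : StronglyConvexLower P k) (x : Vec d) (y y' : Vec e) :
    k.lam * ‖y - y'‖ ^ 2 ≤ inner ℝ (gradY P.gMean x y - gradY P.gMean x y') (y - y') := by
  have hq := quadratic_le_of_le_hessian (hasGradientAt_gMean hW hO x)
    (hasFDerivAt_gradY_gMean_right hW hk hO x) (fun y p => (hS x y p).1)
  have h1 := hq y (y' - y)
  have h2 := hq y' (y - y')
  rw [add_sub_cancel, ← neg_sub y y', inner_neg_right, norm_neg] at h1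
  rw [add_sub_cancel] at h2
  rw [inner_sub_left]
  linarith

/-- Two facts are combined: strong convexity from y to y*(x), and that the minimum is no larger than
the value after a gradient step of length 1/L_g, which gains ‖∇_y g‖²/(2L_g). The gradient term kept
here later pays for ‖w‖² in the y-step. -/
lemma inner_gradY_ge (hW : P.WellPosed) (hk : k.Valid) (hO : OracleConditions P k)
    (hS : StronglyConvexLower P k) (x : Vec d) (y : Vec e) :
    ‖gradY P.gMean x y‖ ^ 2 / (2 * k.Lg) + k.lam / 2 * ‖y - P.yStar x‖ ^ 2
      ≤ inner ℝ (gradY P.gMean x y) (y - P.yStar x) := by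
  have hLg : 0 < k.Lg := hk.lam_pos.trans_le hk.lam_le
  have h1 := quadratic_le_of_le_hessian (hasGradientAt_gMean hW hO x)
    (hasFDerivAt_gradY_gMean_right hW hk hO x) (fun y p => (hS x y p).1) y (P.yStar x - y)
  have h2 := le_quadratic_of_hessian_le (hasGradientAt_gMean hW hO x)
    (hasFDerivAt_gradY_gMean_right hW hk hO x) (fun y p => (hS x y p).2) y
    (-(1 / k.Lg) • gradY P.gMean x y)
  have h3 := (yStar_spec hW hk hO hS x _).trans h2
  rw [add_sub_cancel, ← neg_sub y, inner_neg_right, norm_neg] at h1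
  rw [real_inner_smul_right, real_inner_self_eq_norm_sq, norm_smul, mul_pow] at h3
  have h4 : P.gMean x y + -(1 / k.Lg) * ‖gradY P.gMean x y‖ ^ 2
      + k.Lg / 2 * (‖-(1 / k.Lg)‖ ^ 2 * ‖gradY P.gMean x y‖ ^ 2)
      = P.gMean x y - ‖gradY P.gMean x y‖ ^ 2 / (2 * k.Lg) := by
    rw [norm_neg, Real.norm_eq_abs, sq_abs]
    field_simp
    ring
  linarith

/-- Cauchy–Schwarz in `inner_gradY_ge`. The lossy factor 2 is harmless, since the bound serves only
for integrability and the crude growth estimate. -/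
lemma norm_gradY_gMean_le (hW : P.WellPosed) (hk : k.Valid) (hO : OracleConditions P k)
    (hS : StronglyConvexLower P k) (x : Vec d) (y : Vec e) :
    ‖gradY P.gMean x y‖ ≤ 2 * k.Lg * ‖y - P.yStar x‖ := by
  have hLg : 0 < k.Lg := hk.lam_pos.trans_le hk.lam_le
  have h1 := inner_gradY_ge hW hk hO hS x y
  have h2 := real_inner_le_norm (gradY P.gMean x y) (y - P.yStar x)
  have h3 : 0 ≤ k.lam / 2 * ‖y - P.yStar x‖ ^ 2 := by have := hk.lam_pos; positivity
  have h4 : ‖gradY P.gMean x y‖ ^ 2 / (2 * k.Lg) ≤ ‖gradY P.gMean x y‖ * ‖y - P.yStar x‖ := by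
    linarith
  rw [div_le_iff₀ (by positivity)] at h4
  rcases (norm_nonneg (gradY P.gMean x y)).eq_or_lt with h0 | h0
  · rw [← h0]; positivity
  · nlinarith

/-- Strong monotonicity at x compares the two minimizers. Since ∇_y g vanishes at both, each for its
own x, the gradient difference is an increment of ∇_y g(·, y*(x')) in x alone, controlled by the
bound on ∇²_xy g. -/
lemma norm_yStar_sub_le (hW : P.WellPosed) (hk : k.Valid) (hO : OracleConditions P k)
    (hS : StronglyConvexLower P k) (x x' : Vec d) :
    ‖P.yStar x - P.yStar x'‖ ≤ k.Ly * ‖x - x'‖ := by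
  have h1 := le_inner_gradY_sub hW hk hO hS x (P.yStar x) (P.yStar x')
  rw [gradY_gMean_yStar hW hk hO hS, ← gradY_gMean_yStar hW hk hO hS x'] at h1
  have h2 : ‖gradY P.gMean x' (P.yStar x') - gradY P.gMean x (P.yStar x')‖
      ≤ k.Cgxy * ‖x' - x‖ :=
    convex_univ.norm_image_sub_le_of_norm_hasFDerivWithin_le
      (fun z _ => (hasFDerivAt_gradY_gMean_left hW hk hO z (P.yStar x')).hasFDerivWithinAt)
      (fun z _ => by
        rw [transposeL_apply, LinearIsometryEquiv.norm_map]
        exact hO.bound_gxy z _) (Set.mem_univ _) (Set.mem_univ _)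
  have h3 := h1.trans (real_inner_le_norm _ _)
  have h4 := h3.trans (mul_le_mul_of_nonneg_right h2 (norm_nonneg _))
  rw [Consts.Ly, div_mul_eq_mul_div, le_div_iff₀ hk.lam_pos, norm_sub_rev x]
  rcases (norm_nonneg (P.yStar x - P.yStar x')).eq_or_lt with h0 | h0
  · rw [← h0, zero_mul]
    exact mul_nonneg hk.Cgxy_nonneg (norm_nonneg _)
  · nlinarith

/-- Expand ∇_y g at (x, y*(x)) along the points (x', y*(x')), where it vanishes identically, and
apply the inverse Hessian to isolate y*(x') − y*(x). The Lipschitz bound on y* turns the remainder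
into o(x' − x), so no implicit function theorem is needed. -/
lemma hasFDerivAt_yStar (hW : P.WellPosed) (hk : k.Valid) (hO : OracleConditions P k)
    (hS : StronglyConvexLower P k) (x : Vec d) :
    HasFDerivAt P.yStar (-((hessYY P.gMean x (P.yStar x)).inverse.comp
      (transposeL e d (hessXY P.gMean x (P.yStar x))))) x := by
  set y := P.yStar x with hy
  set B := hessYY P.gMean x y
  set J := transposeL e d (hessXY P.gMean x y)
  have hB := hessYY_gMean_mem hW hk hO hS x y
  have hO1 : (fun x' => P.yStar x' - P.yStar x) =O[nhds x] fun x' => x' - x :=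
    Asymptotics.IsBigO.of_bound k.Ly
      (Filter.Eventually.of_forall fun x' => norm_yStar_sub_le hW hk hO hS x' x)
  have hO2 : (fun x' => ((x', P.yStar x') : Vec d × Vec e) - (x, y)) =O[nhds x]
      fun x' => x' - x := (Asymptotics.isBigO_refl _ _).prod_left hO1
  have hcont : Filter.Tendsto (fun x' => ((x', P.yStar x') : Vec d × Vec e)) (nhds x)
      (nhds (x, y)) := by
    have h0 : Filter.Tendsto (fun x' : Vec d => x' - x) (nhds x) (nhds 0) := by
      have : Continuous fun x' : Vec d => x' - x := by fun_prop
      simpa using this.tendsto x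
    exact tendsto_sub_nhds_zero_iff.1 (hO2.trans_tendsto h0)
  have h1 := (hasFDerivAt_gradY_gMean hW hk hO (x, y)).isLittleO.comp_tendsto hcont
  have h2 := h1.trans_isBigO hO2
  have h3 : (fun x' => P.yStar x' - P.yStar x - (-(B.inverse.comp J)) (x' - x))
      =o[nhds x] fun x' => x' - x := by
    have h4 := (B.inverse.isBigO_comp _ _).trans_isLittleO h2
    refine h4.neg_left.congr_left fun x' => ?_
    simp only [Function.comp, gradY_gMean_yStar hW hk hO hS, ofPartials_apply, hy,
      Prod.fst_sub, Prod.snd_sub, zero_sub, sub_self, map_neg, map_add, neg_neg]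
    rw [inverse_apply_of_coercive hk.lam_pos hB.2]
    simp only [neg_apply, ContinuousLinearMap.comp_apply, sub_neg_eq_add, J, y]
    rw [add_comm]
  exact HasFDerivAt.of_isLittleO h3

/-! ### The gradient of the objective -/

/-- `∇_x f - ∇²_xy g [∇²_yy g]⁻¹ ∇_y f`. -/
def hyperGrad (P : Problem d e Ξ Z) (x : Vec d) (y : Vec e) : Vec d :=
  gradX P.fMean x y - hessXY P.gMean x y ((hessYY P.gMean x y).inverse (gradY P.fMean x y))

/-- Chain rule through x ↦ (x, y*(x)); the adjoint and the symmetry of the inverse Hessian bring the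
derivative into gradient form. -/
lemma hasGradientAt_F (hW : P.WellPosed) (hk : k.Valid) (hO : OracleConditions P k)
    (hS : StronglyConvexLower P k) (x : Vec d) :
    HasGradientAt P.F (P.hyperGrad x (P.yStar x)) x := by
  have h1 : HasFDerivAt (fun x' => ((x', P.yStar x') : Vec d × Vec e)) _ x :=
    (hasFDerivAt_id x).prodMk (hasFDerivAt_yStar hW hk hO hS x)
  have h2 := HasFDerivAt.comp (g := fun p : Vec d × Vec e => P.fMean p.1 p.2) x
    (hasFDerivAt_fMean hW hk hO (x, P.yStar x)) h1
  refine HasFDerivAt.congr_fderiv h2 ?_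
  refine ContinuousLinearMap.ext fun p => ?_
  have hB := hessYY_gMean_mem hW hk hO hS x (P.yStar x)
  simp only [ContinuousLinearMap.comp_apply, ofPartials_apply, hyperGrad,
    ContinuousLinearMap.prod_apply, InnerProductSpace.toDual_apply_apply, neg_apply,
    inner_neg_right, inner_sub_left, ContinuousLinearMap.id_apply]
  rw [← inner_inverse_comm hk.lam_pos hB, transposeL_apply, ContinuousLinearMap.adjoint_inner_right,
    sub_eq_add_neg]

lemma gradient_F (hW : P.WellPosed) (hk : k.Valid) (hO : OracleConditions P k)
    (hS : StronglyConvexLower P k) (x : Vec d) :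
    gradient P.F x = P.hyperGrad x (P.yStar x) := (hasGradientAt_F hW hk hO hS x).gradient

/-- One factor is exchanged at a time, in the order that needs norm bounds on v and V' only. In the
estimate of the bias these are the projected estimator and the true mixed derivative. -/
lemma norm_apply_inverse_sub_le {l Cg Cf : ℝ} (hl : 0 < l)
    {V V' : Vec e →L[ℝ] Vec d} {H H' : Vec e →L[ℝ] Vec e} {v v' : Vec e}
    (hv : ‖v‖ ≤ Cf) (hV : ‖V'‖ ≤ Cg) (hH : ∀ p, l * ‖p‖ ^ 2 ≤ inner ℝ (H p) p)
    (hH' : ∀ p, l * ‖p‖ ^ 2 ≤ inner ℝ (H' p) p) :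
    ‖V (H.inverse v) - V' (H'.inverse v')‖
      ≤ ‖V - V'‖ * (Cf / l) + Cg * (‖H - H'‖ * (Cf / l) / l) + Cg * (‖v - v'‖ / l) := by
  have hCg : 0 ≤ Cg := (norm_nonneg _).trans hV
  have h : V (H.inverse v) - V' (H'.inverse v') = (V - V') (H.inverse v)
      + V' (H.inverse v - H'.inverse v) + V' (H'.inverse (v - v')) := by
    simp only [map_sub, sub_apply]; abel
  rw [h]
  refine (norm_add₃_le ..).trans (add_le_add (add_le_add ?_ ?_) ?_)
  · refine ((V - V').le_opNorm _).trans ?_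
    gcongr
    exact (norm_inverse_apply_le hl hH v).trans (by gcongr)
  · refine (V'.le_opNorm _).trans ?_
    gcongr
    exact (norm_inverse_sub_inverse_apply_le hl hH hH' v).trans (by gcongr)
  · refine (V'.le_opNorm _).trans ?_
    gcongr
    exact norm_inverse_apply_le hl hH' _

/-- The factor 1 + L_y comes from x ↦ (x, y*(x)), the other factor from the hypergradient formula as
a function of (x, y). -/
lemma norm_gradient_sub_le (hW : P.WellPosed) (hk : k.Valid) (hO : OracleConditions P k)
    (hS : StronglyConvexLower P k) (x x' : Vec d) :
    ‖gradient P.F x - gradient P.F x'‖ ≤ k.gradLip * ‖x - x'‖ := by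
  have := hW.probXi
  have := hW.probZeta
  rw [gradient_F hW hk hO hS, gradient_F hW hk hO hS, hyperGrad, hyperGrad]
  set y := P.yStar x
  set y' := P.yStar x'
  set r := √(‖x - x'‖ ^ 2 + ‖y - y'‖ ^ 2) with hr
  have hrle : r ≤ (1 + k.Ly) * ‖x - x'‖ := by
    have h1 := sqrt_add_sq_le x x' y y'
    have h2 := norm_yStar_sub_le hW hk hO hS x x'
    linarith
  have e1 := (isOracle_fx hW hk hO).lip_mean x y x' y'
  have e2 := (isOracle_fy hW hk hO).lip_mean x y x' y'
  have e3 := (isOracle_gxy hW hk hO).lip_mean x y x' y'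
  have e4 := (isOracle_gyy hW hk hO).lip_mean x y x' y'
  rw [← map_sub, ← frobNorm_eq] at e3 e4
  replace e3 := (opNorm_le_frobNorm _).trans e3
  replace e4 := (opNorm_le_frobNorm _).trans e4
  rw [← hr] at e1 e2 e3 e4
  have e5 := norm_apply_inverse_sub_le hk.lam_pos (v' := gradY P.fMean x' y')
    (V := hessXY P.gMean x y) (hO.bound_fy x y) (hO.bound_gxy x' y')
    (hessYY_gMean_mem hW hk hO hS x y).2 (hessYY_gMean_mem hW hk hO hS x' y').2
  rw [sub_sub_sub_comm]
  refine (norm_sub_le _ _).trans ((add_le_add e1 e5).trans ?_)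
  have hl := hk.lam_pos
  have hCf := hk.Cfy_nonneg
  have hCg := hk.Cgxy_nonneg
  have hLf := hk.Lfx_nonneg
  have := hk.Lfy_nonneg
  have := hk.Lgxy_nonneg
  have := hk.Lgyy_nonneg
  calc _ ≤ k.Lfx * r + (k.Lgxy * r * (k.Cfy / k.lam)
        + k.Cgxy * (k.Lgyy * r * (k.Cfy / k.lam) / k.lam) + k.Cgxy * (k.Lfy * r / k.lam)) := by
        gcongr
    _ = (k.Lfx + k.Lfy * k.Cgxy / k.lam
          + k.Cfy * (k.Lgxy / k.lam + k.Cgxy * k.Lgyy / k.lam ^ 2)) * r := by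
        field_simp; ring
    _ ≤ (k.Lfx + k.Lfy * k.Cgxy / k.lam
          + k.Cfy * (k.Lgxy / k.lam + k.Cgxy * k.Lgyy / k.lam ^ 2)) * ((1 + k.Ly) * ‖x - x'‖) := by
        gcongr
    _ = k.gradLip * ‖x - x'‖ := by rw [Consts.gradLip]; ring

lemma continuous_gradient_F (hW : P.WellPosed) (hk : k.Valid) (hO : OracleConditions P k)
    (hS : StronglyConvexLower P k) : Continuous (gradient P.F) := by
  refine (LipschitzWith.of_dist_le_mul (K := Real.toNNReal k.gradLip) fun x x' => ?_).continuous
  rw [dist_eq_norm, dist_eq_norm]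
  refine (norm_gradient_sub_le hW hk hO hS x x').trans ?_
  gcongr
  exact Real.le_coe_toNNReal _

lemma continuous_yStar (hW : P.WellPosed) (hk : k.Valid) (hO : OracleConditions P k)
    (hS : StronglyConvexLower P k) : Continuous P.yStar :=
  continuous_iff_continuousAt.2 fun x => (hasFDerivAt_yStar hW hk hO hS x).continuousAt

lemma continuous_F (hW : P.WellPosed) (hk : k.Valid) (hO : OracleConditions P k)
    (hS : StronglyConvexLower P k) : Continuous P.F :=
  continuous_iff_continuousAt.2 fun x => (hasGradientAt_F hW hk hO hS x).continuousAt

lemma F_add_le (hW : P.WellPosed) (hk : k.Valid) (hO : OracleConditions P k)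
    (hS : StronglyConvexLower P k) {L : ℝ} (hL : k.gradLip ≤ L) (x p : Vec d) :
    P.F (x + p) ≤ P.F x + inner ℝ (gradient P.F x) p + L / 2 * ‖p‖ ^ 2 :=
  le_quadratic_of_lipschitz (fun x => (hasGradientAt_F hW hk hO hS x).differentiableAt.hasGradientAt)
    (fun x x' => (norm_gradient_sub_le hW hk hO hS x x').trans (by gcongr)) x p

/-- A gradient step of length 1/L cannot go below m. This turns a finite expected gap into a finite
second moment of ∇F. -/
lemma norm_gradient_F_sq_le (hW : P.WellPosed) (hk : k.Valid) (hO : OracleConditions P k)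
    (hS : StronglyConvexLower P k) {L m : ℝ} (hL : k.gradLip ≤ L) (hL0 : 0 < L)
    (hm : ∀ x, m ≤ P.F x) (x : Vec d) : ‖gradient P.F x‖ ^ 2 ≤ 2 * L * (P.F x - m) := by
  have h1 := F_add_le hW hk hO hS hL x (-(1 / L) • gradient P.F x)
  have h2 := (hm _).trans h1
  rw [real_inner_smul_right, real_inner_self_eq_norm_sq, norm_smul, mul_pow, norm_neg,
    Real.norm_eq_abs, sq_abs] at h2
  have h4 : P.F x + -(1 / L) * ‖gradient P.F x‖ ^ 2
      + L / 2 * ((1 / L) ^ 2 * ‖gradient P.F x‖ ^ 2)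
      = P.F x - ‖gradient P.F x‖ ^ 2 / (2 * L) := by
    field_simp
    ring
  rw [h4] at h2
  have h5 : ‖gradient P.F x‖ ^ 2 / (2 * L) ≤ P.F x - m := by linarith
  rw [div_le_iff₀ (by positivity)] at h5
  linarith

/-- Descent lemma with −2⟨∇F, z⟩ = ‖∇F − z‖² − ‖∇F‖² − ‖z‖². The negative ‖z‖² is kept to absorb the
displacement terms of the other recursions. -/
lemma F_sub_smul_le (hW : P.WellPosed) (hk : k.Valid) (hO : OracleConditions P k)
    (hS : StronglyConvexLower P k) {L : ℝ} (hL : k.gradLip ≤ L) (x z : Vec d) (s : ℝ) :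
    P.F (x - s • z) ≤ P.F x - s / 2 * ‖gradient P.F x‖ ^ 2
      + s / 2 * ‖gradient P.F x - z‖ ^ 2 - s / 2 * (1 - s * L) * ‖z‖ ^ 2 := by
  have h1 := F_add_le hW hk hO hS hL x (-(s • z))
  rw [← sub_eq_add_neg, inner_neg_right, real_inner_smul_right, norm_neg, norm_smul, mul_pow,
    Real.norm_eq_abs, sq_abs] at h1
  have h2 := norm_sub_sq_real (gradient P.F x) z
  refine h1.trans_eq ?_
  rw [h2]
  ring

/-! ### Errors of one step -/

/-- Each estimator is compared with the true derivative at (x, y), and that with the one at (x,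
y*(x)) at the cost of L‖y − y*(x)‖. The constants come from squaring: an outer factor 2 separates
the u-part from the rest, a factor 3 separates V, H and v, and a factor 2 separates error from
distance. -/
lemma norm_gradient_F_sub_sq_le (hW : P.WellPosed) (hk : k.Valid) (hO : OracleConditions P k)
    (hS : StronglyConvexLower P k) (x : Vec d) (y : Vec e) {u : Vec d} {v : Vec e}
    {V : Vec e →L[ℝ] Vec d} {H : Vec e →L[ℝ] Vec e} (hv : ‖v‖ ≤ k.Cfy)
    (hH : H ∈ matricesAbove k.lam) :
    ‖gradient P.F x - (u - V (H.inverse v))‖ ^ 2 ≤ 2 * (k.C0 * ‖y - P.yStar x‖ ^ 2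
      + k.C1 * ‖u - gradX P.fMean x y‖ ^ 2
      + k.C2 * frobNorm (V - hessXY P.gMean x y) ^ 2
      + k.C3 * frobNorm (H - hessYY P.gMean x y) ^ 2
      + k.C4 * ‖v - gradY P.fMean x y‖ ^ 2) := by
  have := hW.probXi
  have := hW.probZeta
  rw [gradient_F hW hk hO hS, hyperGrad]
  set ys := P.yStar x
  set δ := ‖y - ys‖ with hδ
  have e1 := (isOracle_fx hW hk hO).lip_mean x y x ys
  have e2 := (isOracle_fy hW hk hO).lip_mean x y x ys
  have e3 := (isOracle_gxy hW hk hO).lip_mean x y x ys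
  have e4 := (isOracle_gyy hW hk hO).lip_mean x y x ys
  rw [← map_sub, ← frobNorm_eq] at e3 e4
  replace e3 := (opNorm_le_frobNorm _).trans e3
  replace e4 := (opNorm_le_frobNorm _).trans e4
  rw [sub_self, norm_zero, zero_pow two_ne_zero, zero_add, Real.sqrt_sq (norm_nonneg _), ← hδ]
    at e1 e2 e3 e4
  have e5 := norm_apply_inverse_sub_le hk.lam_pos (v' := gradY P.fMean x ys) (V := V) hv
    (hO.bound_gxy x ys) hH.2 (hessYY_gMean_mem hW hk hO hS x ys).2
  have tri : ∀ {A : Type _} [NormedAddCommGroup A] (a b c : A), ‖a - c‖ ≤ ‖a - b‖ + ‖b - c‖ :=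
    fun a b c => norm_sub_le_norm_sub_add_norm_sub a b c
  have f1 := (tri u (gradX P.fMean x y) (gradX P.fMean x ys)).trans (add_le_add_right e1 _)
  have f2 := (tri v (gradY P.fMean x y) (gradY P.fMean x ys)).trans (add_le_add_right e2 _)
  have f3 := (tri V (hessXY P.gMean x y) (hessXY P.gMean x ys)).trans
    (add_le_add (opNorm_le_frobNorm _) e3)
  have f4 := (tri H (hessYY P.gMean x y) (hessYY P.gMean x ys)).trans
    (add_le_add (opNorm_le_frobNorm _) e4)
  set a1 := ‖u - gradX P.fMean x y‖
  set a2 := ‖v - gradY P.fMean x y‖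
  set a3 := frobNorm (V - hessXY P.gMean x y)
  set a4 := frobNorm (H - hessYY P.gMean x y)
  have hl := hk.lam_pos
  have hCf := hk.Cfy_nonneg
  have hCg := hk.Cgxy_nonneg
  set q := k.Cfy / k.lam with hq
  have hq0 : 0 ≤ q := by positivity
  have hnorm : ‖gradX P.fMean x ys - hessXY P.gMean x ys
        ((hessYY P.gMean x ys).inverse (gradY P.fMean x ys)) - (u - V (H.inverse v))‖
      ≤ (a1 + k.Lfx * δ) + ((a3 + k.Lgxy * δ) * q
        + k.Cgxy * ((a4 + k.Lgyy * δ) * q / k.lam) + k.Cgxy * ((a2 + k.Lfy * δ) / k.lam)) := by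
    rw [← norm_neg, neg_sub, sub_sub_sub_comm]
    refine (norm_sub_le _ _).trans (add_le_add f1 (e5.trans ?_))
    gcongr
  have sq2 : ∀ a b : ℝ, (a + b) ^ 2 ≤ 2 * a ^ 2 + 2 * b ^ 2 := fun a b => by
    nlinarith [sq_nonneg (a - b)]
  have sq3 : ∀ a b c : ℝ, (a + b + c) ^ 2 ≤ 3 * a ^ 2 + 3 * b ^ 2 + 3 * c ^ 2 := fun a b c => by
    nlinarith [sq_nonneg (a - b), sq_nonneg (b - c), sq_nonneg (a - c)]
  have hsq : ∀ c a L : ℝ, (c * (a + L * δ)) ^ 2 ≤ c ^ 2 * (2 * a ^ 2 + 2 * (L * δ) ^ 2) :=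
    fun c a L => by
      rw [mul_pow]
      exact mul_le_mul_of_nonneg_left (sq2 _ _) (sq_nonneg _)
  have h1 := sq2 a1 (k.Lfx * δ)
  have h3 := hsq q a3 k.Lgxy
  have h4 := hsq (k.Cgxy * q / k.lam) a4 k.Lgyy
  have h2 := hsq (k.Cgxy / k.lam) a2 k.Lfy
  calc _ ≤ ((a1 + k.Lfx * δ) + (q * (a3 + k.Lgxy * δ)
        + k.Cgxy * q / k.lam * (a4 + k.Lgyy * δ) + k.Cgxy / k.lam * (a2 + k.Lfy * δ))) ^ 2 := by
        refine pow_le_pow_left₀ (norm_nonneg _) (hnorm.trans_eq ?_) 2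
        ring
    _ ≤ _ := by
        refine (sq2 _ _).trans ((add_le_add (mul_le_mul_of_nonneg_left h1 zero_le_two)
          (mul_le_mul_of_nonneg_left ((sq3 _ _ _).trans (add_le_add (add_le_add
            (mul_le_mul_of_nonneg_left h3 zero_le_three)
            (mul_le_mul_of_nonneg_left h4 zero_le_three))
            (mul_le_mul_of_nonneg_left h2 zero_le_three))) zero_le_two)).trans_eq ?_)
        simp only [Consts.C0, Consts.C1, Consts.C2, Consts.C3, Consts.C4, hq]
        field_simp
        ring

/-- Expand the square with w = G + ε. `inner_gradY_ge` supplies contraction and a multiple of ‖G‖²;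
because 3τ ≤ 1/L_g, the latter becomes a negative multiple of ‖w‖² that competes with s²‖w‖².
Young's inequality handles ⟨ε, y − y*⟩ at the cost of half of the contraction. -/
lemma norm_sub_yStar_step_sq_le (hW : P.WellPosed) (hk : k.Valid) (hO : OracleConditions P k)
    (hS : StronglyConvexLower P k) {τ : ℝ} (hτ : 0 ≤ τ) (hτL : τ ≤ 1 / (3 * k.Lg)) {s : ℝ}
    (hs : 0 ≤ s) (x : Vec d) (y w : Vec e) :
    ‖y - s • w - P.yStar x‖ ^ 2 ≤ (1 - s * k.lam / 2) * ‖y - P.yStar x‖ ^ 2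
      + 3 * s / k.lam * ‖w - gradY P.gMean x y‖ ^ 2 - s * (3 / 2 * τ - s) * ‖w‖ ^ 2 := by
  have hl := hk.lam_pos
  have hLg : 0 < k.Lg := hl.trans_le hk.lam_le
  set G := gradY P.gMean x y
  set p := y - P.yStar x
  set ε := w - G with hε
  have hw : w = G + ε := by rw [hε]; abel
  have h1 : ‖y - s • w - P.yStar x‖ ^ 2 = ‖p‖ ^ 2 - 2 * s * inner ℝ w p + s ^ 2 * ‖w‖ ^ 2 := by
    have : y - s • w - P.yStar x = p - s • w := by simp only [p]; abel
    rw [this, norm_sub_sq_real, real_inner_smul_right, norm_smul, mul_pow, Real.norm_eq_abs, sq_abs,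
      real_inner_comm]
    ring
  have h2 := inner_gradY_ge hW hk hO hS x y
  have hτ3 : 3 * τ ≤ 1 / k.Lg := by
    rw [le_div_iff₀ (by positivity)] at hτL ⊢
    linarith
  have h3 : 3 / 2 * τ * ‖G‖ ^ 2 ≤ ‖G‖ ^ 2 / (2 * k.Lg) := by
    have := mul_le_mul_of_nonneg_right hτ3 (by positivity : 0 ≤ ‖G‖ ^ 2 / 2)
    calc _ = 3 * τ * (‖G‖ ^ 2 / 2) := by ring
      _ ≤ _ := this
      _ = _ := by field_simp
  have h4 : inner ℝ w p = inner ℝ G p + inner ℝ ε p := by rw [hw, inner_add_left]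
  have h5 : -(inner ℝ ε p) ≤ k.lam / 4 * ‖p‖ ^ 2 + 1 / k.lam * ‖ε‖ ^ 2 := by
    have h6 := neg_le_of_abs_le (abs_real_inner_le_norm ε p)
    have h7 : ‖ε‖ * ‖p‖ ≤ k.lam / 4 * ‖p‖ ^ 2 + 1 / k.lam * ‖ε‖ ^ 2 := by
      have : k.lam / 4 * ‖p‖ ^ 2 + 1 / k.lam * ‖ε‖ ^ 2 - ‖ε‖ * ‖p‖
          = (k.lam * ‖p‖ / 2 - ‖ε‖) ^ 2 / k.lam := by field_simp; ring
      have h8 : 0 ≤ (k.lam * ‖p‖ / 2 - ‖ε‖) ^ 2 / k.lam := by positivity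
      linarith
    linarith
  have h9 : ‖w‖ ^ 2 ≤ 2 * ‖G‖ ^ 2 + 2 * ‖ε‖ ^ 2 := by
    have : ‖w‖ ≤ ‖G‖ + ‖ε‖ := hw ▸ norm_add_le G ε
    nlinarith [norm_nonneg w, sq_nonneg (‖G‖ - ‖ε‖)]
  have h10 : 3 * τ ≤ 1 / k.lam := hτ3.trans (one_div_le_one_div_of_le hl hk.lam_le)
  have h11 : 3 * τ * ‖ε‖ ^ 2 ≤ 1 / k.lam * ‖ε‖ ^ 2 := by gcongr
  have h12 : 3 / 2 * τ * ‖w‖ ^ 2 ≤ 3 / 2 * τ * (2 * ‖G‖ ^ 2 + 2 * ‖ε‖ ^ 2) := by gcongr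
  have h13 : -(2 * inner ℝ w p) ≤ -(k.lam / 2) * ‖p‖ ^ 2 + 3 / k.lam * ‖ε‖ ^ 2
      - 3 / 2 * τ * ‖w‖ ^ 2 := by
    have : 3 / k.lam * ‖ε‖ ^ 2 = 3 * (1 / k.lam * ‖ε‖ ^ 2) := by ring
    rw [this, h4]
    linarith
  have h14 := mul_le_mul_of_nonneg_left h13 hs
  have h15 : 3 * s / k.lam * ‖ε‖ ^ 2 = s * (3 / k.lam * ‖ε‖ ^ 2) := by ring
  rw [h1, h15]
  linarith

/-- Young's inequality for the drift of y*. The weight a is later ητλ/4, which gives up half of the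
remaining contraction. -/
lemma norm_sub_yStar_sq_le (hW : P.WellPosed) (hk : k.Valid) (hO : OracleConditions P k)
    (hS : StronglyConvexLower P k) {a : ℝ} (ha : 0 < a) (x x' : Vec d) (y : Vec e) :
    ‖y - P.yStar x'‖ ^ 2 ≤ (1 + a) * ‖y - P.yStar x‖ ^ 2
      + (1 + 1 / a) * k.Ly ^ 2 * ‖x - x'‖ ^ 2 := by
  have h1 := norm_sub_le_norm_sub_add_norm_sub y (P.yStar x) (P.yStar x')
  have h2 := norm_yStar_sub_le hW hk hO hS x x'
  have h3 : ‖y - P.yStar x'‖ ^ 2 ≤ (‖y - P.yStar x‖ + k.Ly * ‖x - x'‖) ^ 2 := by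
    gcongr; linarith
  have h4 : (1 + a) * ‖y - P.yStar x‖ ^ 2 + (1 + 1 / a) * k.Ly ^ 2 * ‖x - x'‖ ^ 2
      - (‖y - P.yStar x‖ + k.Ly * ‖x - x'‖) ^ 2
      = (a * ‖y - P.yStar x‖ - k.Ly * ‖x - x'‖) ^ 2 / a := by field_simp; ring
  have h5 : 0 ≤ (a * ‖y - P.yStar x‖ - k.Ly * ‖x - x'‖) ^ 2 / a := by positivity
  linarith

end Problem

/-! ### Independent samples -/

/-- In terms of laws this is associativity of the product of three measures. -/
lemma IndepFun.prodMk_left_of_indepFun {Ω A B C : Type*} [MeasurableSpace Ω] [MeasurableSpace A]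
    [MeasurableSpace B] [MeasurableSpace C] {μ : Measure Ω} [IsProbabilityMeasure μ] {X : Ω → A}
    {Y : Ω → B} {W : Ω → C} (hX : Measurable X) (hY : Measurable Y) (hW : Measurable W)
    (h : IndepFun X (fun ω => (Y ω, W ω)) μ) (h' : IndepFun Y W μ) :
    IndepFun (fun ω => (X ω, Y ω)) W μ := by
  have := Measure.isProbabilityMeasure_map (μ := μ) hX.aemeasurable
  have := Measure.isProbabilityMeasure_map (μ := μ) hY.aemeasurable
  have := Measure.isProbabilityMeasure_map (μ := μ) hW.aemeasurable
  have hXY : IndepFun X Y μ := h.comp measurable_id measurable_fst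
  rw [indepFun_iff_map_prod_eq_prod_map_map hX.aemeasurable (hY.prodMk hW).aemeasurable,
    (indepFun_iff_map_prod_eq_prod_map_map hY.aemeasurable hW.aemeasurable).1 h'] at h
  rw [indepFun_iff_map_prod_eq_prod_map_map (hX.prodMk hY).aemeasurable hW.aemeasurable,
    (indepFun_iff_map_prod_eq_prod_map_map hX.aemeasurable hY.aemeasurable).1 hXY,
    ← MeasurableEquiv.prodAssoc.map_measurableEquiv_injective.eq_iff, Measure.prodAssoc_prod, ← h,
    Measure.map_map MeasurableEquiv.prodAssoc.measurable ((hX.prodMk hY).prodMk hW)]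
  rfl

/-- Fubini plays the part of conditional expectation: the joint law is a product, so the fresh
sample is integrated first with the past frozen. Integrability of φ follows from that of ψ. -/
lemma expectLE_of_indepFun {Ω α S : Type*} [MeasurableSpace Ω] [MeasurableSpace α]
    [MeasurableSpace S] {μ : Measure Ω} [IsProbabilityMeasure μ] {ν : Measure α} {X : Ω → S}
    {ξ : Ω → α} (hX : Measurable X) (hξ : Measurable ξ) (h : IndepFun X ξ μ) (hν : μ.map ξ = ν)
    {φ : S → α → ℝ} {ψ : S → ℝ} (hφ : Measurable (Function.uncurry φ)) (hφ0 : ∀ s a, 0 ≤ φ s a)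
    (hψ : Measurable ψ) (hψi : Integrable (fun ω => ψ (X ω)) μ)
    (hle : ∀ s, ExpectLE ν (φ s) (ψ s)) :
    ExpectLE μ (fun ω => φ (X ω) (ξ ω)) (∫ ω, ψ (X ω) ∂μ) := by
  have := Measure.isProbabilityMeasure_map (μ := μ) hX.aemeasurable
  have hpν : IsProbabilityMeasure ν := hν ▸ Measure.isProbabilityMeasure_map hξ.aemeasurable
  have hlaw : μ.map (fun ω => (X ω, ξ ω)) = (μ.map X).prod ν := by
    rw [(indepFun_iff_map_prod_eq_prod_map_map hX.aemeasurable hξ.aemeasurable).1 h, hν]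
  have hψi' : Integrable ψ (μ.map X) :=
    (integrable_map_measure hψ.aestronglyMeasurable hX.aemeasurable).2 hψi
  have hsm : StronglyMeasurable fun s => ∫ a, ‖φ s a‖ ∂ν :=
    hφ.norm.stronglyMeasurable.integral_prod_right
  have hint : Integrable (Function.uncurry φ) ((μ.map X).prod ν) := by
    refine (integrable_prod_iff hφ.aestronglyMeasurable).2
      ⟨Filter.Eventually.of_forall fun s => (hle s).1, ?_⟩
    refine hψi'.mono' hsm.aestronglyMeasurable (Filter.Eventually.of_forall fun s => ?_)
    rw [Real.norm_of_nonneg (integral_nonneg fun _ => norm_nonneg _)]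
    refine le_trans (le_of_eq ?_) (hle s).2
    exact integral_congr_ae (Filter.Eventually.of_forall fun a => Real.norm_of_nonneg (hφ0 s a))
  have hm := (hX.prodMk hξ)
  have hint' := hint
  rw [← hlaw] at hint'
  refine ⟨(integrable_map_measure hφ.aestronglyMeasurable hm.aemeasurable).1 hint', ?_⟩
  have e1 : ∫ ω, φ (X ω) (ξ ω) ∂μ = ∫ q, Function.uncurry φ q ∂((μ.map X).prod ν) := by
    rw [← hlaw, integral_map hm.aemeasurable hφ.aestronglyMeasurable]
    rfl
  rw [e1, integral_prod _ hint, ← integral_map hX.aemeasurable hψ.aestronglyMeasurable]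
  exact integral_mono hint.integral_prod_left hψi' fun s => (hle s).2

lemma integrable_of_le {Ω : Type*} [MeasurableSpace Ω] {μ : Measure Ω} {f g : Ω → ℝ}
    (hg : Integrable g μ) (hf : Measurable f) (h0 : ∀ ω, 0 ≤ f ω) (h : ∀ ω, f ω ≤ g ω) :
    Integrable f μ :=
  hg.mono' hf.aestronglyMeasurable (Filter.Eventually.of_forall fun ω => by
    rw [Real.norm_of_nonneg (h0 ω)]; exact h ω)

/-- Lifts `integral_step` to random points: the whole state X is measurable for the past, hence
independent of the sample. The update enters only through the inequality `hstep`, which also covers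
projected estimators. -/
lemma IsOracle.expectLE_step {α E : Type*} [MeasurableSpace α] {ν : Measure α}
    [IsProbabilityMeasure ν] {d e : ℕ}
    [NormedAddCommGroup E] [InnerProductSpace ℝ E] [MeasurableSpace E] [BorelSpace E]
    [SecondCountableTopology E] [CompleteSpace E]
    {O : α → Vec d → Vec e → E} {m : Vec d → Vec e → E} {L σ : ℝ} (hO : IsOracle ν O m L σ)
    {Ω : Type*} {m0 mΩ : MeasurableSpace Ω} (hm0 : m0 ≤ mΩ) {μ : Measure Ω}
    [IsProbabilityMeasure μ] {ξ : Ω → α} (hξ : Measurable ξ) (hν : μ.map ξ = ν)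
    (hind : Indep m0 (MeasurableSpace.comap ξ inferInstance) μ)
    {x x' : Ω → Vec d} {y y' : Ω → Vec e} {u u' : Ω → E} (hx : Measurable[m0] x)
    (hx' : Measurable[m0] x') (hy : Measurable[m0] y) (hy' : Measurable[m0] y')
    (hu : Measurable[m0] u) (hu' : Measurable u') {β : ℝ}
    (hstep : ∀ ω, ‖u' ω - m (x' ω) (y' ω)‖ ≤
      ‖(1 - β) • (u ω - O (ξ ω) (x ω) (y ω)) + O (ξ ω) (x' ω) (y' ω) - m (x' ω) (y' ω)‖)
    (hiu : Integrable (fun ω => ‖u ω - m (x ω) (y ω)‖ ^ 2) μ)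
    (hix : Integrable (fun ω => ‖x ω - x' ω‖ ^ 2) μ)
    (hiy : Integrable (fun ω => ‖y ω - y' ω‖ ^ 2) μ) :
    ExpectLE μ (fun ω => ‖u' ω - m (x' ω) (y' ω)‖ ^ 2)
      ((1 - β) ^ 2 * ∫ ω, ‖u ω - m (x ω) (y ω)‖ ^ 2 ∂μ + 2 * β ^ 2 * σ ^ 2
        + 2 * (1 - β) ^ 2 * L ^ 2 *
          (∫ ω, ‖x ω - x' ω‖ ^ 2 ∂μ + ∫ ω, ‖y ω - y' ω‖ ^ 2 ∂μ)) := by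
  let X : Ω → (Vec d × Vec e) × (Vec d × Vec e) × E := fun ω => ((x ω, y ω), (x' ω, y' ω), u ω)
  have hX0 : Measurable[m0] X := (hx.prodMk hy).prodMk ((hx'.prodMk hy').prodMk hu)
  have hX : Measurable X := hX0.mono hm0 le_rfl
  have hI : IndepFun X ξ μ :=
    (IndepFun_iff_Indep X ξ μ).2 (indep_of_indep_of_le_left hind hX0.comap_le)
  let φ : (Vec d × Vec e) × (Vec d × Vec e) × E → α → ℝ := fun s a =>
    ‖(1 - β) • (s.2.2 - O a s.1.1 s.1.2) + O a s.2.1.1 s.2.1.2 - m s.2.1.1 s.2.1.2‖ ^ 2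
  let ψ : (Vec d × Vec e) × (Vec d × Vec e) × E → ℝ := fun s =>
    (1 - β) ^ 2 * ‖s.2.2 - m s.1.1 s.1.2‖ ^ 2 + 2 * β ^ 2 * σ ^ 2
      + 2 * (1 - β) ^ 2 * L ^ 2 * (‖s.1.1 - s.2.1.1‖ ^ 2 + ‖s.1.2 - s.2.1.2‖ ^ 2)
  have hφ : Measurable (Function.uncurry φ) := by
    have h1 := hO.measurable_comp (Ω := ((Vec d × Vec e) × (Vec d × Vec e) × E) × α)
      (ξ := fun q => q.2) (x := fun q => q.1.1.1) (y := fun q => q.1.1.2)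
      (by fun_prop) (by fun_prop) (by fun_prop)
    have h2 := hO.measurable_comp (Ω := ((Vec d × Vec e) × (Vec d × Vec e) × E) × α)
      (ξ := fun q => q.2) (x := fun q => q.1.2.1.1) (y := fun q => q.1.2.1.2)
      (by fun_prop) (by fun_prop) (by fun_prop)
    have h3 := hO.measurable_mean_comp (Ω := ((Vec d × Vec e) × (Vec d × Vec e) × E) × α)
      (x := fun q => q.1.2.1.1) (y := fun q => q.1.2.1.2) (by fun_prop) (by fun_prop)
    have h4 : Measurable fun q : ((Vec d × Vec e) × (Vec d × Vec e) × E) × α => q.1.2.2 := by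
      fun_prop
    exact ((((h4.sub h1).const_smul (1 - β)).add h2).sub h3).norm.pow_const 2
  have hψ : Measurable ψ := by
    have h3 := hO.measurable_mean_comp (Ω := (Vec d × Vec e) × (Vec d × Vec e) × E)
      (x := fun q => q.1.1) (y := fun q => q.1.2) (by fun_prop) (by fun_prop)
    have h4 : Measurable fun q : (Vec d × Vec e) × (Vec d × Vec e) × E => q.2.2 := by
      fun_prop
    have h5 : Measurable fun q : (Vec d × Vec e) × (Vec d × Vec e) × E =>
        ‖q.1.1 - q.2.1.1‖ ^ 2 + ‖q.1.2 - q.2.1.2‖ ^ 2 := by fun_prop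
    exact ((((h4.sub h3).norm.pow_const 2).const_mul _).add measurable_const).add (h5.const_mul _)
  have hi1 : Integrable (fun ω => (1 - β) ^ 2 * ‖u ω - m (x ω) (y ω)‖ ^ 2) μ := hiu.const_mul _
  have hi2 : Integrable (fun ω => (1 - β) ^ 2 * ‖u ω - m (x ω) (y ω)‖ ^ 2
      + 2 * β ^ 2 * σ ^ 2) μ := hi1.add (integrable_const _)
  have hi3 : Integrable (fun ω => 2 * (1 - β) ^ 2 * L ^ 2 *
      (‖x ω - x' ω‖ ^ 2 + ‖y ω - y' ω‖ ^ 2)) μ := (hix.add hiy).const_mul _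
  obtain ⟨h1, h2⟩ := expectLE_of_indepFun hX hξ hI hν hφ (fun s a => sq_nonneg _) hψ
    (hi2.add hi3) (fun s => hO.integral_step s.1.1 s.2.1.1 s.1.2 s.2.1.2 s.2.2 β)
  have hmean := (hO.measurable_mean_comp (hx'.mono hm0 le_rfl) (hy'.mono hm0 le_rfl))
  have hle : ∀ ω, ‖u' ω - m (x' ω) (y' ω)‖ ^ 2 ≤ φ (X ω) (ξ ω) := fun ω =>
    pow_le_pow_left₀ (norm_nonneg _) (hstep ω) 2
  have hi := integrable_of_le h1 ((hu'.sub hmean).norm.pow_const 2) (fun _ => sq_nonneg _) hle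
  refine ⟨hi, (integral_mono hi h1 hle).trans (h2.trans_eq ?_)⟩
  rw [← integral_add hix hiy, ← integral_const_mul, ← integral_const_mul]
  refine (integral_add hi2 hi3).trans ?_
  rw [integral_add hi1 (integrable_const _)]
  simp

/-! ### The history of a run -/

namespace Sequences

variable {d e : ℕ} {Ξ Z Ω : Type*} [MeasurableSpace Ξ] [MeasurableSpace Z]

/-- The initial estimators and the samples of the first `t` iterations. -/
def history (s : Sequences d e Ξ Z Ω) (t : ℕ) (ω : Ω) :
    (Vec d × Vec e × (Vec e →L[ℝ] Vec d) × (Vec e →L[ℝ] Vec e) × Vec e) ×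
      (Finset.range t → Ξ × Z) :=
  ((s.u 1 ω, s.v 1 ω, s.V 1 ω, s.H 1 ω, s.w 1 ω), fun i => (s.xi (i + 1) ω, s.zeta (i + 1) ω))

/-- The σ-algebra of the history. -/
@[reducible]
def past (s : Sequences d e Ξ Z Ω) (t : ℕ) : MeasurableSpace Ω :=
  MeasurableSpace.comap (s.history t) inferInstance

lemma measurable_history (s : Sequences d e Ξ Z Ω) (t : ℕ) :
    Measurable[s.past t] (s.history t) := comap_measurable _

lemma past_mono (s : Sequences d e Ξ Z Ω) (t : ℕ) : s.past t ≤ s.past (t + 1) := by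
  have hm := s.measurable_history (t + 1)
  refine measurable_iff_comap_le.1 ?_
  refine Measurable.prodMk (measurable_fst.comp hm)
    (@measurable_pi_lambda _ _ _ (s.past (t + 1)) _ _ fun i => ?_)
  exact (measurable_pi_apply (⟨i, Finset.mem_range.2
    ((Finset.mem_range.1 i.2).trans t.lt_succ_self)⟩ : Finset.range (t + 1))).comp
      (measurable_snd.comp hm)

lemma measurable_sample (s : Sequences d e Ξ Z Ω) (t : ℕ) :
    Measurable[s.past (t + 1)] fun ω => (s.xi (t + 1) ω, s.zeta (t + 1) ω) :=
  (measurable_pi_apply (⟨t, Finset.self_mem_range_succ t⟩ : Finset.range (t + 1))).comp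
    (measurable_snd.comp (s.measurable_history (t + 1)))

variable [mΩ : MeasurableSpace Ω] {s : Sequences d e Ξ Z Ω} {P : Problem d e Ξ Z} {k : Consts}
  {h : Params} {D : ℝ} {μ : Measure Ω} {x₀ : Vec d} {y₀ : Vec e}

lemma measurable_init (hI : s.Initial P k D μ x₀ y₀) :
    Measurable fun ω => (s.u 1 ω, s.v 1 ω, s.V 1 ω, s.H 1 ω, s.w 1 ω) :=
  hI.measurable_u.prodMk (hI.measurable_v.prodMk (hI.measurable_V.prodMk
    (hI.measurable_H.prodMk hI.measurable_w)))

lemma measurable_samples (hS : s.Sampling P μ) (t : ℕ) :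
    Measurable fun ω (i : Finset.range t) => (s.xi (i + 1) ω, s.zeta (i + 1) ω) :=
  measurable_pi_lambda _ fun i => (hS.measurable_xi i).prodMk (hS.measurable_zeta i)

lemma past_le (hS : s.Sampling P μ) (hI : s.Initial P k D μ x₀ y₀) (t : ℕ) : s.past t ≤ mΩ :=
  measurable_iff_comap_le.1 ((measurable_init hI).prodMk (measurable_samples hS t))

/-- The initial estimators are independent of the entire sample sequence, and the earlier samples of
the next one; the two independences are then joined. -/
lemma indepFun_history [IsProbabilityMeasure μ] (hS : s.Sampling P μ)
    (hI : s.Initial P k D μ x₀ y₀) (t : ℕ) :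
    IndepFun (s.history t) (fun ω => (s.xi (t + 1) ω, s.zeta (t + 1) ω)) μ := by
  have hm : ∀ i, Measurable fun ω => (s.xi (i + 1) ω, s.zeta (i + 1) ω) := fun i =>
    (hS.measurable_xi i).prodMk (hS.measurable_zeta i)
  -- Index i stands for sample i + 1, so the blocks are the samples 1, …, t and the sample t + 1.
  have h1 := hS.indep.indepFun_finset (Finset.range t) {t} (by simp) hm
  have h2 := h1.comp measurable_id
    (measurable_pi_apply (⟨t, Finset.mem_singleton_self t⟩ : ({t} : Finset ℕ)))
  have h3 : Measurable fun q : ℕ → Ξ × Z => ((fun i : Finset.range t => q i), q t) :=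
    (measurable_pi_lambda _ fun i => measurable_pi_apply _).prodMk (measurable_pi_apply _)
  exact IndepFun.prodMk_left_of_indepFun (measurable_init hI) (measurable_samples hS t) (hm t)
    (hS.indep_init.comp measurable_id h3) h2

lemma indep_past_xi [IsProbabilityMeasure μ] (hS : s.Sampling P μ)
    (hI : s.Initial P k D μ x₀ y₀) (t : ℕ) :
    Indep (s.past t) (MeasurableSpace.comap (s.xi (t + 1)) inferInstance) μ :=
  (IndepFun_iff_Indep _ _ _).1
    ((indepFun_history hS hI t).comp measurable_id measurable_fst)

lemma indep_past_zeta [IsProbabilityMeasure μ] (hS : s.Sampling P μ)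
    (hI : s.Initial P k D μ x₀ y₀) (t : ℕ) :
    Indep (s.past t) (MeasurableSpace.comap (s.zeta (t + 1)) inferInstance) μ :=
  (IndepFun_iff_Indep _ _ _).1
    ((indepFun_history hS hI t).comp measurable_id measurable_snd)

end Sequences

lemma Params.Admissible.eta_pos {h : Params} {k : Consts} (hh : h.Admissible k) (t : ℕ) :
    0 < h.eta t := by
  have h1 := hh.c_pos
  have h2 : 0 < h.c0 + t := by have := hh.c0_ge_two; positivity
  exact div_pos h1 (Real.rpow_pos_of_pos h2 _)

/-! ### Measurability of the iterates and estimators with respect to the history -/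

lemma measurable_of_columns {α : Type*} {mα : MeasurableSpace α} {m n : ℕ}
    {A : α → Vec n →L[ℝ] Vec m} (hA : Measurable fun a => columns (A a)) : Measurable A := by
  refine measurable_matrix_of_apply fun p => ?_
  simp only [apply_eq_sum_columns]
  refine Finset.measurable_sum _ fun j _ => ?_
  exact ((PiLp.proj 2 (fun _ : Fin n => Vec m) j (𝕜 := ℝ)).continuous.measurable.comp
    hA).const_smul (p j)

lemma measurable_sub_smul {α E : Type*} {mα : MeasurableSpace α} [NormedAddCommGroup E]
    [NormedSpace ℝ E] [MeasurableSpace E] [BorelSpace E] [SecondCountableTopology E]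
    {f g : α → E} (hf : Measurable f) (hg : Measurable g) (c : ℝ) :
    Measurable fun a => f a - c • g a := by fun_prop

lemma measurable_momentum {α E : Type*} {mα : MeasurableSpace α} [NormedAddCommGroup E]
    [NormedSpace ℝ E] [MeasurableSpace E] [BorelSpace E] [SecondCountableTopology E]
    {a o o' : α → E} (ha : Measurable a) (ho : Measurable o) (ho' : Measurable o') (c : ℝ) :
    Measurable fun ω => c • (a ω - o ω) + o' ω := by fun_prop

namespace Sequences

variable {d e : ℕ} {Ξ Z Ω : Type*} [MeasurableSpace Ξ] [MeasurableSpace Z]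

/-- The iterates and estimators after `t` iterations are functions of the history. -/
structure Adapted (s : Sequences d e Ξ Z Ω) (t : ℕ) : Prop where
  x : Measurable[s.past t] (s.x t)
  y : Measurable[s.past t] (s.y t)
  u : Measurable[s.past t] (s.u (t + 1))
  v : Measurable[s.past t] (s.v (t + 1))
  V : Measurable[s.past t] (s.V (t + 1))
  H : Measurable[s.past t] (s.H (t + 1))
  w : Measurable[s.past t] (s.w (t + 1))

variable [mΩ : MeasurableSpace Ω] {s : Sequences d e Ξ Z Ω} {P : Problem d e Ξ Z} {k : Consts}
  {h : Params} {D : ℝ} {μ : Measure Ω} {x₀ : Vec d} {y₀ : Vec e}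

lemma H_mem (hrun : s.IsSVRB P k h D μ x₀ y₀) (t : ℕ) (ω : Ω) :
    s.H (t + 1) ω ∈ matricesAbove k.lam := by
  cases t with
  | zero => exact hrun.init.H_mem ω
  | succ t => exact (hrun.updates.H_step t ω).1

lemma norm_v_le (hrun : s.IsSVRB P k h D μ x₀ y₀) (t : ℕ) (ω : Ω) :
    ‖s.v (t + 1) ω‖ ≤ k.Cfy := by
  cases t with
  | zero => exact mem_closedBall_zero_iff.1 (hrun.init.v_mem ω)
  | succ t => exact mem_closedBall_zero_iff.1 (hrun.updates.v_step t ω).1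

lemma Adapted.z (hk : k.Valid) (hrun : s.IsSVRB P k h D μ x₀ y₀) {t : ℕ} (hA : s.Adapted t) :
    Measurable[s.past t] (s.z (t + 1)) := by
  have h1 := measurable_inverse_apply (mα := s.past t) hk.lam_pos hA.H hA.v (H_mem hrun t)
  have hc : Continuous fun q : (Vec e →L[ℝ] Vec d) × Vec e => q.1 q.2 := by fun_prop
  exact hA.u.sub (hc.measurable.comp (hA.V.prodMk h1))

/-- The step to x_{t+1} uses estimators built from the samples 1, …, t. Thus both points at which
sample t + 1 is evaluated are fixed before it is drawn, which is what makes the new noise centred.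
-/
lemma Adapted.x_succ (hk : k.Valid) (hrun : s.IsSVRB P k h D μ x₀ y₀) {t : ℕ}
    (hA : s.Adapted t) : Measurable[s.past t] (s.x (t + 1)) := by
  rw [funext (hrun.updates.x_step t)]
  exact measurable_sub_smul hA.x (hA.z hk hrun) _

lemma Adapted.y_succ (hrun : s.IsSVRB P k h D μ x₀ y₀) {t : ℕ}
    (hA : s.Adapted t) : Measurable[s.past t] (s.y (t + 1)) := by
  rw [funext (hrun.updates.y_step t)]
  exact measurable_sub_smul hA.y hA.w _

/-- Induction along the updates: oracles at random points are jointly measurable, and projections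
act through continuous maps. -/
lemma adapted (hW : P.WellPosed) (hk : k.Valid) (hO : OracleConditions P k)
    (hrun : s.IsSVRB P k h D μ x₀ y₀) (t : ℕ) : s.Adapted t := by
  induction t with
  | zero =>
    have hm := measurable_fst.comp (s.measurable_history 0)
    exact
      { x := by rw [funext hrun.init.x_zero]; exact measurable_const
        y := by rw [funext hrun.init.y_zero]; exact measurable_const
        u := measurable_fst.comp hm
        v := measurable_fst.comp (measurable_snd.comp hm)
        V := measurable_fst.comp (measurable_snd.comp (measurable_snd.comp hm))
        H := measurable_fst.comp (measurable_snd.comp (measurable_snd.comp (measurable_snd.comp hm)))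
        w := measurable_snd.comp (measurable_snd.comp
          (measurable_snd.comp (measurable_snd.comp hm))) }
  | succ t hA =>
    have hmono := s.past_mono t
    have hx := hA.x.mono hmono le_rfl
    have hy := hA.y.mono hmono le_rfl
    have hx' := (hA.x_succ hk hrun).mono hmono le_rfl
    have hy' := (hA.y_succ hrun).mono hmono le_rfl
    have hξ := measurable_fst.comp (s.measurable_sample t)
    have hζ := measurable_snd.comp (s.measurable_sample t)
    have o1 := P.isOracle_fx hW hk hO
    have o2 := P.isOracle_fy hW hk hO
    have o3 := P.isOracle_gxy hW hk hO
    have o4 := P.isOracle_gyy hW hk hO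
    have o5 := P.isOracle_gy hW hO
    refine ⟨hx', hy', ?_, ?_, ?_, ?_, ?_⟩
    · rw [funext (hrun.updates.u_step t)]
      exact measurable_momentum (hA.u.mono hmono le_rfl) (o1.measurable_comp hξ hx hy)
        (o1.measurable_comp hξ hx' hy') _
    · obtain ⟨π, hπ, hproj⟩ := exists_continuous_projection (ContinuousLinearMap.id ℝ (Vec e))
        (N := norm) (fun _ => rfl) (fun _ => le_rfl) (convex_closedBall 0 k.Cfy)
      rw [funext fun ω => hproj _ _ (hrun.updates.v_step t ω)]
      exact hπ.measurable.comp (measurable_momentum (hA.v.mono hmono le_rfl)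
        (o2.measurable_comp hξ hx hy) (o2.measurable_comp hξ hx' hy') _)
    · obtain ⟨π, hπ, hproj⟩ := exists_continuous_projection columns frobNorm_eq
        opNorm_le_frobNorm (convex_matricesBelow (d := d) (e := e) k.Cgxy)
      rw [funext fun ω => hproj _ _ (hrun.updates.V_step t ω)]
      exact hπ.measurable.comp (measurable_momentum (hA.V.mono hmono le_rfl)
        (measurable_of_columns (o3.measurable_comp hζ hx hy))
        (measurable_of_columns (o3.measurable_comp hζ hx' hy')) _)
    · obtain ⟨π, hπ, hproj⟩ := exists_continuous_projection columns frobNorm_eq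
        opNorm_le_frobNorm (convex_matricesAbove (e := e) k.lam)
      rw [funext fun ω => hproj _ _ (hrun.updates.H_step t ω)]
      exact hπ.measurable.comp (measurable_momentum (hA.H.mono hmono le_rfl)
        (measurable_of_columns (o4.measurable_comp hζ hx hy))
        (measurable_of_columns (o4.measurable_comp hζ hx' hy')) _)
    · rw [funext (hrun.updates.w_step t)]
      exact measurable_momentum (hA.w.mono hmono le_rfl) (o5.measurable_comp hζ hx hy)
        (o5.measurable_comp hζ hx' hy') _

end Sequences

/-! ### Second moments of a run -/

/-- Sequences of expectations: the gap `a` of the objective, the squared errors of `y` and of the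
five estimators, and the second moments of `∇F`, `z` and `w`. -/
structure Moments where
  a : ℕ → ℝ
  b : ℕ → ℝ
  eu : ℕ → ℝ
  ev : ℕ → ℝ
  eV : ℕ → ℝ
  eH : ℕ → ℝ
  ew : ℕ → ℝ
  G : ℕ → ℝ
  Z : ℕ → ℝ
  W : ℕ → ℝ

/-- The bound for the squared distance of `z` from `∇F`. -/
def Moments.bias (m : Moments) (k : Consts) (t : ℕ) : ℝ :=
  2 * (k.C0 * m.b t + k.C1 * m.eu t + k.C2 * m.eV t + k.C3 * m.eH t + k.C4 * m.ev t)

/-- The recursion for the squared error of an estimator with momentum parameters `β` and Lipschitz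
constant `L`. -/
def Moments.ErrorStep (m : Moments) (k : Consts) (h : Params) (β : ℕ → ℝ) (L : ℝ) (E : ℕ → ℝ) :
    Prop :=
  ∀ t, E (t + 1) ≤ (1 - β (t + 1)) ^ 2 * E t + 2 * β (t + 1) ^ 2 * k.sigma ^ 2
    + 2 * (1 - β (t + 1)) ^ 2 * L ^ 2 *
      ((h.eta t * h.gam) ^ 2 * m.Z t + (h.eta t * h.tau) ^ 2 * m.W t)

/-- The inequalities between the expectations. -/
structure Moments.Bounds (m : Moments) (k : Consts) (h : Params) (D : ℝ) : Prop where
  a_nonneg : ∀ t, 0 ≤ m.a t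
  b_nonneg : ∀ t, 0 ≤ m.b t
  eu_nonneg : ∀ t, 0 ≤ m.eu t
  ev_nonneg : ∀ t, 0 ≤ m.ev t
  eV_nonneg : ∀ t, 0 ≤ m.eV t
  eH_nonneg : ∀ t, 0 ≤ m.eH t
  ew_nonneg : ∀ t, 0 ≤ m.ew t
  G_nonneg : ∀ t, 0 ≤ m.G t
  Z_nonneg : ∀ t, 0 ≤ m.Z t
  W_nonneg : ∀ t, 0 ≤ m.W t
  a_zero : m.a 0 ≤ k.Delta
  b_zero : m.b 0 ≤ D
  eu_zero : m.eu 0 ≤ D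
  ev_zero : m.ev 0 ≤ D
  eV_zero : m.eV 0 ≤ D
  eH_zero : m.eH 0 ≤ D
  ew_zero : m.ew 0 ≤ D
  G_le : ∀ t, m.G t ≤ 2 * h.LF * m.a t
  Z_le : ∀ t, m.Z t ≤ 2 * m.G t + 2 * m.bias k t
  W_le : ∀ t, m.W t ≤ 2 * m.ew t + 8 * k.Lg ^ 2 * m.b t
  a_step : ∀ t, m.a (t + 1) ≤ m.a t - h.eta t * h.gam / 2 * m.G t
    + h.eta t * h.gam / 2 * m.bias k t
    - h.eta t * h.gam / 2 * (1 - h.eta t * h.gam * h.LF) * m.Z t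
  b_step : ∀ t, m.b (t + 1) ≤ (1 + h.eta t * h.tau * k.lam / 4) *
      ((1 - h.eta t * h.tau * k.lam / 2) * m.b t + 3 * (h.eta t * h.tau) / k.lam * m.ew t
        - h.eta t * h.tau * (3 / 2 * h.tau - h.eta t * h.tau) * m.W t)
    + (1 + 1 / (h.eta t * h.tau * k.lam / 4)) * k.Ly ^ 2 * ((h.eta t * h.gam) ^ 2 * m.Z t)
  eu_step : m.ErrorStep k h (h.betaFx k) k.Lfx m.eu
  ev_step : m.ErrorStep k h (h.betaFy k) k.Lfy m.ev
  eV_step : m.ErrorStep k h (h.betaGxy k) k.Lgxy m.eV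
  eH_step : m.ErrorStep k h (h.betaGyy k) k.Lgyy m.eH
  ew_step : m.ErrorStep k h (h.betaGy k) k.Lgy m.ew

namespace Sequences

variable {d e : ℕ} {Ξ Z Ω : Type*} [MeasurableSpace Ξ] [MeasurableSpace Z]
  [mΩ : MeasurableSpace Ω] {s : Sequences d e Ξ Z Ω} {P : Problem d e Ξ Z} {k : Consts}
  {h : Params} {D : ℝ} {μ : Measure Ω} {x₀ : Vec d} {y₀ : Vec e}

/-- The expectations that belong to a run; `m₀` is a lower bound of the objective. -/
def moments (s : Sequences d e Ξ Z Ω) (P : Problem d e Ξ Z) (m₀ : ℝ) (μ : Measure Ω) : Moments where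
  a t := ∫ ω, (P.F (s.x t ω) - m₀) ∂μ
  b t := ∫ ω, ‖s.y t ω - P.yStar (s.x t ω)‖ ^ 2 ∂μ
  eu t := ∫ ω, ‖s.u (t + 1) ω - gradX P.fMean (s.x t ω) (s.y t ω)‖ ^ 2 ∂μ
  ev t := ∫ ω, ‖s.v (t + 1) ω - gradY P.fMean (s.x t ω) (s.y t ω)‖ ^ 2 ∂μ
  eV t := ∫ ω, frobNorm (s.V (t + 1) ω - hessXY P.gMean (s.x t ω) (s.y t ω)) ^ 2 ∂μ
  eH t := ∫ ω, frobNorm (s.H (t + 1) ω - hessYY P.gMean (s.x t ω) (s.y t ω)) ^ 2 ∂μ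
  ew t := ∫ ω, ‖s.w (t + 1) ω - gradY P.gMean (s.x t ω) (s.y t ω)‖ ^ 2 ∂μ
  G t := ∫ ω, ‖gradient P.F (s.x t ω)‖ ^ 2 ∂μ
  Z t := ∫ ω, ‖s.z (t + 1) ω‖ ^ 2 ∂μ
  W t := ∫ ω, ‖s.w (t + 1) ω‖ ^ 2 ∂μ

/-- The random variables at time `t` whose expectations are bounded have expectations. -/
structure FiniteMoments (s : Sequences d e Ξ Z Ω) (P : Problem d e Ξ Z) (m₀ : ℝ) (μ : Measure Ω)
    (t : ℕ) : Prop where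
  a : Integrable (fun ω => P.F (s.x t ω) - m₀) μ
  b : Integrable (fun ω => ‖s.y t ω - P.yStar (s.x t ω)‖ ^ 2) μ
  eu : Integrable (fun ω => ‖s.u (t + 1) ω - gradX P.fMean (s.x t ω) (s.y t ω)‖ ^ 2) μ
  ev : Integrable (fun ω => ‖s.v (t + 1) ω - gradY P.fMean (s.x t ω) (s.y t ω)‖ ^ 2) μ
  eV : Integrable (fun ω =>
    frobNorm (s.V (t + 1) ω - hessXY P.gMean (s.x t ω) (s.y t ω)) ^ 2) μ
  eH : Integrable (fun ω =>
    frobNorm (s.H (t + 1) ω - hessYY P.gMean (s.x t ω) (s.y t ω)) ^ 2) μ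
  ew : Integrable (fun ω => ‖s.w (t + 1) ω - gradY P.gMean (s.x t ω) (s.y t ω)‖ ^ 2) μ

end Sequences

/-- `f` has the expectation `c`. -/
def HasMean {Ω : Type*} [MeasurableSpace Ω] (μ : Measure Ω) (f : Ω → ℝ) (c : ℝ) : Prop :=
  Integrable f μ ∧ ∫ ω, f ω ∂μ = c

namespace HasMean

variable {Ω : Type*} [MeasurableSpace Ω] {μ : Measure Ω} {f g : Ω → ℝ} {c c' : ℝ}

lemma add (hf : HasMean μ f c) (hg : HasMean μ g c') : HasMean μ (fun ω => f ω + g ω) (c + c') :=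
  ⟨hf.1.add hg.1, by rw [integral_add hf.1 hg.1, hf.2, hg.2]⟩

lemma sub (hf : HasMean μ f c) (hg : HasMean μ g c') : HasMean μ (fun ω => f ω - g ω) (c - c') :=
  ⟨hf.1.sub hg.1, by rw [integral_sub hf.1 hg.1, hf.2, hg.2]⟩

lemma const_mul (hf : HasMean μ f c) (r : ℝ) : HasMean μ (fun ω => r * f ω) (r * c) :=
  ⟨hf.1.const_mul r, by rw [integral_const_mul, hf.2]⟩

lemma of_integrable (hf : Integrable f μ) : HasMean μ f (∫ ω, f ω ∂μ) := ⟨hf, rfl⟩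

/-- A pointwise bound by a variable with known mean yields integrability and the inequality at once;
the one-step estimates are assembled this way. -/
lemma expectLE (hg : HasMean μ g c) (hf : Measurable f) (h0 : ∀ ω, 0 ≤ f ω)
    (hle : ∀ ω, f ω ≤ g ω) : ExpectLE μ f c :=
  have hi := integrable_of_le hg.1 hf h0 hle
  ⟨hi, hg.2 ▸ integral_mono hi hg.1 hle⟩

end HasMean

/-! ### One-step inequalities for the expectations of a run -/

/-- A run of the method with admissible parameters on a problem that satisfies the assumptions. -/
structure Setting {d e : ℕ} {Ξ Z Ω : Type*} [MeasurableSpace Ξ] [MeasurableSpace Z]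
    [MeasurableSpace Ω] (s : Sequences d e Ξ Z Ω) (P : Problem d e Ξ Z) (k : Consts) (h : Params)
    (D : ℝ) (μ : Measure Ω) (x₀ : Vec d) (y₀ : Vec e) : Prop where
  valid : k.Valid
  admissible : h.Admissible k
  wellPosed : P.WellPosed
  convex : StronglyConvexLower P k
  oracle : OracleConditions P k
  run : s.IsSVRB P k h D μ x₀ y₀

namespace Setting

variable {d e : ℕ} {Ξ Z Ω : Type*} [MeasurableSpace Ξ] [MeasurableSpace Z]
  [mΩ : MeasurableSpace Ω] {s : Sequences d e Ξ Z Ω} {P : Problem d e Ξ Z} {k : Consts}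
  {h : Params} {D : ℝ} {μ : Measure Ω} {x₀ : Vec d} {y₀ : Vec e}

/-- The expectations of the run. -/
abbrev mom (_ : Setting s P k h D μ x₀ y₀) : Moments := s.moments P (P.F x₀ - k.Delta) μ

/-- The random variables at time `t` have expectations. -/
abbrev Finite (_ : Setting s P k h D μ x₀ y₀) (t : ℕ) : Prop :=
  s.FiniteMoments P (P.F x₀ - k.Delta) μ t

lemma lower_bound (S : Setting s P k h D μ x₀ y₀) (x : Vec d) : P.F x₀ - k.Delta ≤ P.F x := by
  have := S.run.init.gap x
  linarith

lemma past_le (S : Setting s P k h D μ x₀ y₀) (t : ℕ) : s.past t ≤ mΩ := Sequences.past_le S.run.sampling S.run.init t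

lemma adapted (S : Setting s P k h D μ x₀ y₀) (t : ℕ) : s.Adapted t :=
  Sequences.adapted S.wellPosed S.valid S.oracle S.run t

lemma measurable_x (S : Setting s P k h D μ x₀ y₀) (t : ℕ) : Measurable (s.x t) := (S.adapted t).x.mono (S.past_le t) le_rfl

lemma measurable_y (S : Setting s P k h D μ x₀ y₀) (t : ℕ) : Measurable (s.y t) := (S.adapted t).y.mono (S.past_le t) le_rfl

lemma measurable_z (S : Setting s P k h D μ x₀ y₀) (t : ℕ) : Measurable (s.z (t + 1)) :=
  ((S.adapted t).z S.valid S.run).mono (S.past_le t) le_rfl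

lemma measurable_w (S : Setting s P k h D μ x₀ y₀) (t : ℕ) : Measurable (s.w (t + 1)) :=
  (S.adapted t).w.mono (S.past_le t) le_rfl

lemma measurable_gradient_F (S : Setting s P k h D μ x₀ y₀) (t : ℕ) : Measurable fun ω => gradient P.F (s.x t ω) :=
  (P.continuous_gradient_F S.wellPosed S.valid S.oracle S.convex).measurable.comp (S.measurable_x t)

lemma measurable_yStar (S : Setting s P k h D μ x₀ y₀) (t : ℕ) : Measurable fun ω => P.yStar (s.x t ω) :=
  (P.continuous_yStar S.wellPosed S.valid S.oracle S.convex).measurable.comp (S.measurable_x t)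

lemma norm_x_sub_sq (S : Setting s P k h D μ x₀ y₀) (t : ℕ) (ω : Ω) :
    ‖s.x t ω - s.x (t + 1) ω‖ ^ 2 = (h.eta t * h.gam) ^ 2 * ‖s.z (t + 1) ω‖ ^ 2 := by
  rw [S.run.updates.x_step, sub_sub_cancel, norm_smul, mul_pow, Real.norm_eq_abs, sq_abs]

lemma norm_y_sub_sq (S : Setting s P k h D μ x₀ y₀) (t : ℕ) (ω : Ω) :
    ‖s.y t ω - s.y (t + 1) ω‖ ^ 2 = (h.eta t * h.tau) ^ 2 * ‖s.w (t + 1) ω‖ ^ 2 := by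
  rw [S.run.updates.y_step, sub_sub_cancel, norm_smul, mul_pow, Real.norm_eq_abs, sq_abs]

/-- The squared distance of `z` from `∇F` is at most this random variable. -/
def biasFn (_ : Setting s P k h D μ x₀ y₀) (t : ℕ) (ω : Ω) : ℝ :=
  2 * (k.C0 * ‖s.y t ω - P.yStar (s.x t ω)‖ ^ 2
    + k.C1 * ‖s.u (t + 1) ω - gradX P.fMean (s.x t ω) (s.y t ω)‖ ^ 2
    + k.C2 * frobNorm (s.V (t + 1) ω - hessXY P.gMean (s.x t ω) (s.y t ω)) ^ 2
    + k.C3 * frobNorm (s.H (t + 1) ω - hessYY P.gMean (s.x t ω) (s.y t ω)) ^ 2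
    + k.C4 * ‖s.v (t + 1) ω - gradY P.fMean (s.x t ω) (s.y t ω)‖ ^ 2)

lemma norm_gradient_F_sub_z_sq_le (S : Setting s P k h D μ x₀ y₀) (t : ℕ) (ω : Ω) :
    ‖gradient P.F (s.x t ω) - s.z (t + 1) ω‖ ^ 2 ≤ S.biasFn t ω :=
  P.norm_gradient_F_sub_sq_le S.wellPosed S.valid S.oracle S.convex _ _
    (Sequences.norm_v_le S.run t ω) (Sequences.H_mem S.run t ω)

variable {S : Setting s P k h D μ x₀ y₀}

lemma hasMean_biasFn {t : ℕ} (hF : S.Finite t) : HasMean μ (S.biasFn t) (S.mom.bias k t) :=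
  (((((HasMean.of_integrable hF.b).const_mul _).add
    ((HasMean.of_integrable hF.eu).const_mul _)).add
    ((HasMean.of_integrable hF.eV).const_mul _)).add
    ((HasMean.of_integrable hF.eH).const_mul _)).add
    ((HasMean.of_integrable hF.ev).const_mul _) |>.const_mul 2

lemma expectLE_G {t : ℕ} (hF : S.Finite t) :
    ExpectLE μ (fun ω => ‖gradient P.F (s.x t ω)‖ ^ 2) (2 * h.LF * S.mom.a t) :=
  ((HasMean.of_integrable hF.a).const_mul (2 * h.LF)).expectLE
    ((S.measurable_gradient_F t).norm.pow_const 2) (fun _ => sq_nonneg _)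
    (fun ω => P.norm_gradient_F_sq_le S.wellPosed S.valid S.oracle S.convex S.admissible.LF_ge
      S.admissible.LF_pos S.lower_bound (s.x t ω))

lemma expectLE_Z {t : ℕ} (hF : S.Finite t) :
    ExpectLE μ (fun ω => ‖s.z (t + 1) ω‖ ^ 2) (2 * S.mom.G t + 2 * S.mom.bias k t) := by
  refine (((HasMean.of_integrable (expectLE_G hF).1).const_mul 2).add
    ((hasMean_biasFn hF).const_mul 2)).expectLE ((S.measurable_z t).norm.pow_const 2)
    (fun ω => sq_nonneg _) fun ω => ?_
  have h1 := S.norm_gradient_F_sub_z_sq_le t ω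
  have h2 := norm_sub_norm_le (s.z (t + 1) ω) (gradient P.F (s.x t ω))
  rw [norm_sub_rev] at h2
  nlinarith [norm_nonneg (s.z (t + 1) ω), norm_nonneg (gradient P.F (s.x t ω)),
    sq_nonneg (‖gradient P.F (s.x t ω)‖ - ‖gradient P.F (s.x t ω) - s.z (t + 1) ω‖),
    norm_nonneg (gradient P.F (s.x t ω) - s.z (t + 1) ω)]

lemma expectLE_W {t : ℕ} (hF : S.Finite t) :
    ExpectLE μ (fun ω => ‖s.w (t + 1) ω‖ ^ 2)
      (2 * S.mom.ew t + 8 * k.Lg ^ 2 * S.mom.b t) := by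
  refine (((HasMean.of_integrable hF.ew).const_mul 2).add
    ((HasMean.of_integrable hF.b).const_mul (8 * k.Lg ^ 2))).expectLE
    ((S.measurable_w t).norm.pow_const 2) (fun ω => sq_nonneg _) fun ω => ?_
  have h1 := P.norm_gradY_gMean_le S.wellPosed S.valid S.oracle S.convex (s.x t ω) (s.y t ω)
  have h2 := norm_sub_norm_le (s.w (t + 1) ω) (gradY P.gMean (s.x t ω) (s.y t ω))
  set q := ‖s.w (t + 1) ω - gradY P.gMean (s.x t ω) (s.y t ω)‖
  set r := 2 * k.Lg * ‖s.y t ω - P.yStar (s.x t ω)‖ with hr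
  have h3 : ‖s.w (t + 1) ω‖ ^ 2 ≤ (q + r) ^ 2 := by gcongr; linarith
  calc _ ≤ (q + r) ^ 2 := h3
    _ ≤ 2 * q ^ 2 + 2 * r ^ 2 := by nlinarith [sq_nonneg (q - r)]
    _ = _ := by rw [hr]; ring

lemma a_step {t : ℕ} (hF : S.Finite t) :
    ExpectLE μ (fun ω => P.F (s.x (t + 1) ω) - (P.F x₀ - k.Delta))
      (S.mom.a t - h.eta t * h.gam / 2 * S.mom.G t + h.eta t * h.gam / 2 * S.mom.bias k t
        - h.eta t * h.gam / 2 * (1 - h.eta t * h.gam * h.LF) * S.mom.Z t) := by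
  have hc : 0 ≤ h.eta t * h.gam / 2 := by
    have := S.admissible.eta_pos t
    have := S.admissible.gam_pos
    positivity
  refine ((((HasMean.of_integrable hF.a).sub
    ((HasMean.of_integrable (expectLE_G hF).1).const_mul _)).add
    ((hasMean_biasFn hF).const_mul _)).sub
    ((HasMean.of_integrable (expectLE_Z hF).1).const_mul _)).expectLE ?_ (fun ω => ?_) fun ω => ?_
  · exact ((P.continuous_F S.wellPosed S.valid S.oracle S.convex).measurable.comp
      (S.measurable_x _)).sub measurable_const
  · have := S.lower_bound (s.x (t + 1) ω)
    linarith
  · have h1 := P.F_sub_smul_le S.wellPosed S.valid S.oracle S.convex S.admissible.LF_ge (s.x t ω)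
      (s.z (t + 1) ω) (h.eta t * h.gam)
    have h2 := mul_le_mul_of_nonneg_left (S.norm_gradient_F_sub_z_sq_le t ω) hc
    rw [S.run.updates.x_step]
    linarith

/-- The y-step is taken with x_t fixed; then y* drifts from x_t to x_{t+1}, with Young weight ητλ/4.
-/
lemma b_step {t : ℕ} (hF : S.Finite t) :
    ExpectLE μ (fun ω => ‖s.y (t + 1) ω - P.yStar (s.x (t + 1) ω)‖ ^ 2)
      ((1 + h.eta t * h.tau * k.lam / 4) *
        ((1 - h.eta t * h.tau * k.lam / 2) * S.mom.b t
          + 3 * (h.eta t * h.tau) / k.lam * S.mom.ew t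
          - h.eta t * h.tau * (3 / 2 * h.tau - h.eta t * h.tau) * S.mom.W t)
      + (1 + 1 / (h.eta t * h.tau * k.lam / 4)) * k.Ly ^ 2
        * ((h.eta t * h.gam) ^ 2 * S.mom.Z t)) := by
  have hη := S.admissible.eta_pos t
  have hτ := S.admissible.tau_pos
  have hl := S.valid.lam_pos
  refine ((((((HasMean.of_integrable hF.b).const_mul _).add
    ((HasMean.of_integrable hF.ew).const_mul _)).sub
    ((HasMean.of_integrable (expectLE_W hF).1).const_mul _)).const_mul _).add
    (((HasMean.of_integrable (expectLE_Z hF).1).const_mul _).const_mul _)).expectLE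
    (((S.measurable_y _).sub (S.measurable_yStar _)).norm.pow_const 2)
    (fun ω => sq_nonneg _) fun ω => ?_
  have h1 := P.norm_sub_yStar_sq_le S.wellPosed S.valid S.oracle S.convex
    (a := h.eta t * h.tau * k.lam / 4) (by positivity) (s.x t ω) (s.x (t + 1) ω) (s.y (t + 1) ω)
  have h2 := P.norm_sub_yStar_step_sq_le S.wellPosed S.valid S.oracle S.convex hτ.le
    S.admissible.tau_le (s := h.eta t * h.tau) (by positivity) (s.x t ω) (s.y t ω) (s.w (t + 1) ω)
  rw [← S.run.updates.y_step] at h2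
  rw [S.norm_x_sub_sq] at h1
  exact h1.trans (add_le_add_left (mul_le_mul_of_nonneg_left h2 (by positivity)) _)

lemma error_step [IsProbabilityMeasure μ] {t : ℕ} (hF : S.Finite t) {α E : Type*}
    [MeasurableSpace α] {ν : Measure α} [IsProbabilityMeasure ν]
    [NormedAddCommGroup E] [InnerProductSpace ℝ E] [MeasurableSpace E] [BorelSpace E]
    [SecondCountableTopology E] [CompleteSpace E]
    {O : α → Vec d → Vec e → E} {m : Vec d → Vec e → E} {L σ : ℝ} (hO : IsOracle ν O m L σ)
    {ξ : Ω → α} (hξ : Measurable ξ) (hν : μ.map ξ = ν)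
    (hind : Indep (s.past t) (MeasurableSpace.comap ξ inferInstance) μ)
    {u u' : Ω → E} (hu : Measurable[s.past t] u) (hu' : Measurable u') {β : ℝ}
    (hstep : ∀ ω, ‖u' ω - m (s.x (t + 1) ω) (s.y (t + 1) ω)‖ ≤
      ‖(1 - β) • (u ω - O (ξ ω) (s.x t ω) (s.y t ω)) + O (ξ ω) (s.x (t + 1) ω) (s.y (t + 1) ω)
        - m (s.x (t + 1) ω) (s.y (t + 1) ω)‖)
    (hiu : Integrable (fun ω => ‖u ω - m (s.x t ω) (s.y t ω)‖ ^ 2) μ) :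
    ExpectLE μ (fun ω => ‖u' ω - m (s.x (t + 1) ω) (s.y (t + 1) ω)‖ ^ 2)
      ((1 - β) ^ 2 * ∫ ω, ‖u ω - m (s.x t ω) (s.y t ω)‖ ^ 2 ∂μ + 2 * β ^ 2 * σ ^ 2
        + 2 * (1 - β) ^ 2 * L ^ 2 *
          ((h.eta t * h.gam) ^ 2 * S.mom.Z t + (h.eta t * h.tau) ^ 2 * S.mom.W t)) := by
  have hA := S.adapted t
  have key := hO.expectLE_step (S.past_le t) hξ hν hind hA.x (hA.x_succ S.valid S.run) hA.y
    (hA.y_succ S.run) hu hu' hstep hiu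
  simp only [S.norm_x_sub_sq, S.norm_y_sub_sq, integral_const_mul] at key
  exact key ((expectLE_Z hF).1.const_mul _) ((expectLE_W hF).1.const_mul _)

/-- The true matrix m lies in K, so projecting cannot increase the Frobenius distance to it; the
columns are where the matrix oracles take their values. -/
lemma norm_columns_sub_mean_le {d e : ℕ} {K : Set (Vec e →L[ℝ] Vec d)} (hK : Convex ℝ K)
    {A A' O O' m : Vec e →L[ℝ] Vec d} {c : ℝ} (hm : m ∈ K)
    (hp : IsProjection frobNorm K (c • (A - O) + O') A') :
    ‖columns A' - columns m‖ ≤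
      ‖c • (columns A - columns O) + columns O' - columns m‖ := by
  have := hp.norm_sub_mem_le columns.toLinearMap frobNorm_eq hK hm
  rw [frobNorm_eq, frobNorm_eq] at this
  simpa only [map_sub, map_add, map_smul] using this

variable [IsProbabilityMeasure μ]

lemma eu_step {t : ℕ} (hF : S.Finite t) :
    ExpectLE μ (fun ω => ‖s.u (t + 2) ω - gradX P.fMean (s.x (t + 1) ω) (s.y (t + 1) ω)‖ ^ 2)
      ((1 - h.betaFx k (t + 1)) ^ 2 * S.mom.eu t + 2 * h.betaFx k (t + 1) ^ 2 * k.sigma ^ 2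
        + 2 * (1 - h.betaFx k (t + 1)) ^ 2 * k.Lfx ^ 2 *
          ((h.eta t * h.gam) ^ 2 * S.mom.Z t + (h.eta t * h.tau) ^ 2 * S.mom.W t)) := by
  have := S.wellPosed.probXi
  refine error_step hF (P.isOracle_fx S.wellPosed S.valid S.oracle)
    (S.run.sampling.measurable_xi t) (S.run.sampling.law_xi t)
    (Sequences.indep_past_xi S.run.sampling S.run.init t) (S.adapted t).u
    ((S.adapted (t + 1)).u.mono (S.past_le _) le_rfl) (fun ω => ?_) hF.eu
  rw [S.run.updates.u_step]

lemma ev_step {t : ℕ} (hF : S.Finite t) :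
    ExpectLE μ (fun ω => ‖s.v (t + 2) ω - gradY P.fMean (s.x (t + 1) ω) (s.y (t + 1) ω)‖ ^ 2)
      ((1 - h.betaFy k (t + 1)) ^ 2 * S.mom.ev t + 2 * h.betaFy k (t + 1) ^ 2 * k.sigma ^ 2
        + 2 * (1 - h.betaFy k (t + 1)) ^ 2 * k.Lfy ^ 2 *
          ((h.eta t * h.gam) ^ 2 * S.mom.Z t + (h.eta t * h.tau) ^ 2 * S.mom.W t)) := by
  have := S.wellPosed.probXi
  refine error_step hF (P.isOracle_fy S.wellPosed S.valid S.oracle)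
    (S.run.sampling.measurable_xi t) (S.run.sampling.law_xi t)
    (Sequences.indep_past_xi S.run.sampling S.run.init t) (S.adapted t).v
    ((S.adapted (t + 1)).v.mono (S.past_le _) le_rfl) (fun ω => ?_) hF.ev
  exact (S.run.updates.v_step t ω).norm_sub_mem_le LinearMap.id (fun _ => rfl)
    (convex_closedBall 0 k.Cfy) (mem_closedBall_zero_iff.2 (S.oracle.bound_fy _ _))

lemma ew_step {t : ℕ} (hF : S.Finite t) :
    ExpectLE μ (fun ω => ‖s.w (t + 2) ω - gradY P.gMean (s.x (t + 1) ω) (s.y (t + 1) ω)‖ ^ 2)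
      ((1 - h.betaGy k (t + 1)) ^ 2 * S.mom.ew t + 2 * h.betaGy k (t + 1) ^ 2 * k.sigma ^ 2
        + 2 * (1 - h.betaGy k (t + 1)) ^ 2 * k.Lgy ^ 2 *
          ((h.eta t * h.gam) ^ 2 * S.mom.Z t + (h.eta t * h.tau) ^ 2 * S.mom.W t)) := by
  have := S.wellPosed.probZeta
  refine error_step hF (P.isOracle_gy S.wellPosed S.oracle)
    (S.run.sampling.measurable_zeta t) (S.run.sampling.law_zeta t)
    (Sequences.indep_past_zeta S.run.sampling S.run.init t) (S.adapted t).w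
    ((S.adapted (t + 1)).w.mono (S.past_le _) le_rfl) (fun ω => ?_) hF.ew
  rw [S.run.updates.w_step]

lemma eV_step {t : ℕ} (hF : S.Finite t) :
    ExpectLE μ (fun ω =>
        frobNorm (s.V (t + 2) ω - hessXY P.gMean (s.x (t + 1) ω) (s.y (t + 1) ω)) ^ 2)
      ((1 - h.betaGxy k (t + 1)) ^ 2 * S.mom.eV t + 2 * h.betaGxy k (t + 1) ^ 2 * k.sigma ^ 2
        + 2 * (1 - h.betaGxy k (t + 1)) ^ 2 * k.Lgxy ^ 2 *
          ((h.eta t * h.gam) ^ 2 * S.mom.Z t + (h.eta t * h.tau) ^ 2 * S.mom.W t)) := by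
  have := S.wellPosed.probZeta
  have hi := hF.eV
  simp only [frobNorm_eq, map_sub] at hi
  simp only [frobNorm_eq, map_sub, Sequences.moments]
  exact error_step hF (P.isOracle_gxy S.wellPosed S.valid S.oracle)
    (S.run.sampling.measurable_zeta t) (S.run.sampling.law_zeta t)
    (Sequences.indep_past_zeta S.run.sampling S.run.init t)
    (u := fun ω => columns (s.V (t + 1) ω)) (u' := fun ω => columns (s.V (t + 2) ω))
    (columns.continuous.measurable.comp (S.adapted t).V)
    (columns.continuous.measurable.comp ((S.adapted (t + 1)).V.mono (S.past_le _) le_rfl))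
    (fun ω => norm_columns_sub_mean_le (convex_matricesBelow _) (S.oracle.bound_gxy _ _)
      (S.run.updates.V_step t ω)) hi

lemma eH_step {t : ℕ} (hF : S.Finite t) :
    ExpectLE μ (fun ω =>
        frobNorm (s.H (t + 2) ω - hessYY P.gMean (s.x (t + 1) ω) (s.y (t + 1) ω)) ^ 2)
      ((1 - h.betaGyy k (t + 1)) ^ 2 * S.mom.eH t + 2 * h.betaGyy k (t + 1) ^ 2 * k.sigma ^ 2
        + 2 * (1 - h.betaGyy k (t + 1)) ^ 2 * k.Lgyy ^ 2 *
          ((h.eta t * h.gam) ^ 2 * S.mom.Z t + (h.eta t * h.tau) ^ 2 * S.mom.W t)) := by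
  have := S.wellPosed.probZeta
  have hi := hF.eH
  simp only [frobNorm_eq, map_sub] at hi
  simp only [frobNorm_eq, map_sub, Sequences.moments]
  exact error_step hF (P.isOracle_gyy S.wellPosed S.valid S.oracle)
    (S.run.sampling.measurable_zeta t) (S.run.sampling.law_zeta t)
    (Sequences.indep_past_zeta S.run.sampling S.run.init t)
    (u := fun ω => columns (s.H (t + 1) ω)) (u' := fun ω => columns (s.H (t + 2) ω))
    (columns.continuous.measurable.comp (S.adapted t).H)
    (columns.continuous.measurable.comp ((S.adapted (t + 1)).H.mono (S.past_le _) le_rfl))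
    (fun ω => norm_columns_sub_mean_le (convex_matricesAbove _)
      (P.hessYY_gMean_mem S.wellPosed S.valid S.oracle S.convex _ _)
      (S.run.updates.H_step t ω)) hi

/-- The one-step bounds carry integrability along with the inequality, so induction starts from the
integrability of the initial errors. -/
lemma finite (S : Setting s P k h D μ x₀ y₀) (t : ℕ) : S.Finite t := by
  induction t with
  | zero =>
    have hI := S.run.init
    constructor <;> simp only [hI.x_zero, hI.y_zero]
    · exact integrable_const _
    · exact integrable_const _
    · exact hI.err_u.1
    · exact hI.err_v.1
    · exact hI.err_V.1
    · exact hI.err_H.1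
    · exact hI.err_w.1
  | succ t hF =>
    exact ⟨(a_step hF).1, (b_step hF).1, (eu_step hF).1, (ev_step hF).1, (eV_step hF).1,
      (eH_step hF).1, (ew_step hF).1⟩

lemma integrable_gradient_sq (S : Setting s P k h D μ x₀ y₀) (t : ℕ) :
    Integrable (fun ω => ‖gradient P.F (s.x t ω)‖ ^ 2) μ := (expectLE_G (S.finite t)).1

/-- The passage from the run to real sequences: all constants below are found from these
inequalities alone, which makes them uniform over problems and dimensions. -/
lemma bounds (S : Setting s P k h D μ x₀ y₀) : S.mom.Bounds k h D where
  a_nonneg t := integral_nonneg fun ω => sub_nonneg.2 (S.lower_bound _)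
  b_nonneg t := integral_nonneg fun ω => sq_nonneg _
  eu_nonneg t := integral_nonneg fun ω => sq_nonneg _
  ev_nonneg t := integral_nonneg fun ω => sq_nonneg _
  eV_nonneg t := integral_nonneg fun ω => sq_nonneg _
  eH_nonneg t := integral_nonneg fun ω => sq_nonneg _
  ew_nonneg t := integral_nonneg fun ω => sq_nonneg _
  G_nonneg t := integral_nonneg fun ω => sq_nonneg _
  Z_nonneg t := integral_nonneg fun ω => sq_nonneg _
  W_nonneg t := integral_nonneg fun ω => sq_nonneg _
  a_zero := by simp [Sequences.moments, S.run.init.x_zero]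
  b_zero := by simpa [Sequences.moments, S.run.init.x_zero, S.run.init.y_zero] using S.run.init.err_y
  eu_zero := by
    simpa only [Sequences.moments, S.run.init.x_zero, S.run.init.y_zero] using S.run.init.err_u.2
  ev_zero := by
    simpa only [Sequences.moments, S.run.init.x_zero, S.run.init.y_zero] using S.run.init.err_v.2
  eV_zero := by
    simpa only [Sequences.moments, S.run.init.x_zero, S.run.init.y_zero] using S.run.init.err_V.2
  eH_zero := by
    simpa only [Sequences.moments, S.run.init.x_zero, S.run.init.y_zero] using S.run.init.err_H.2
  ew_zero := by
    simpa only [Sequences.moments, S.run.init.x_zero, S.run.init.y_zero] using S.run.init.err_w.2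
  G_le t := (expectLE_G (S.finite t)).2
  Z_le t := (expectLE_Z (S.finite t)).2
  W_le t := (expectLE_W (S.finite t)).2
  a_step t := (a_step (S.finite t)).2
  b_step t := (b_step (S.finite t)).2
  eu_step t := (eu_step (S.finite t)).2
  ev_step t := (ev_step (S.finite t)).2
  eV_step t := (eV_step (S.finite t)).2
  eH_step t := (eH_step (S.finite t)).2
  ew_step t := (ew_step (S.finite t)).2

end Setting

/-! ### The step sizes -/

namespace Params

/-- `(c₀ + t)^(1/3)`. -/
def root (h : Params) (t : ℕ) : ℝ := (h.c0 + t) ^ (1 / 3 : ℝ)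

lemma eta_eq (h : Params) (t : ℕ) : h.eta t = h.c / h.root t := rfl

namespace Admissible

variable {h : Params} {k : Consts}

lemma c0_add_pos (hh : h.Admissible k) (t : ℕ) : 0 < h.c0 + t := by
  have := hh.c0_ge_two
  positivity

lemma root_pos (hh : h.Admissible k) (t : ℕ) : 0 < h.root t :=
  Real.rpow_pos_of_pos (hh.c0_add_pos t) _

lemma root_pow_three (hh : h.Admissible k) (t : ℕ) : h.root t ^ 3 = h.c0 + t := by
  rw [root, ← Real.rpow_natCast, ← Real.rpow_mul (hh.c0_add_pos t).le]
  norm_num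

lemma eta_pow_three (hh : h.Admissible k) (t : ℕ) : h.eta t ^ 3 = h.c ^ 3 / (h.c0 + t) := by
  rw [eta_eq, div_pow, hh.root_pow_three]

lemma eta_antitone (hh : h.Admissible k) : Antitone h.eta := by
  intro t t' htt'
  have h1 : (t : ℝ) ≤ t' := by exact_mod_cast htt'
  have := hh.c_pos
  have := hh.c0_add_pos t
  rw [eta, eta]
  gcongr

lemma _root_.Bilevel.Params.tendsto_eta (h : Params) : Filter.Tendsto h.eta Filter.atTop (nhds 0) := by
  have h1 : Filter.Tendsto (fun t : ℕ => h.c0 + t) Filter.atTop Filter.atTop :=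
    Filter.tendsto_atTop_add_const_left _ _ tendsto_natCast_atTop_atTop
  exact ((tendsto_rpow_atTop (by norm_num : (0 : ℝ) < 1 / 3)).comp h1).const_div_atTop _

lemma _root_.Bilevel.Params.eventually_eta_mul_le (h : Params) (X : ℝ) {r : ℝ} (hr : 0 < r) :
    ∀ᶠ t in Filter.atTop, h.eta t * X ≤ r := by
  have h1 := h.tendsto_eta.mul_const X
  rw [zero_mul] at h1
  exact (h1.eventually_lt_const hr).mono fun t ht => ht.le

/-- With ρ = (c₀ + t)^{1/3}, the cube of ρ + 1/(3ρ²) exceeds ρ³ + 1, so ρ grows by at most 1/(3ρ²);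
relative to ρ this is η³/(3c³). -/
lemma inv_eta_succ_le (hh : h.Admissible k) (t : ℕ) :
    1 / h.eta (t + 1) ≤ 1 / h.eta t * (1 + h.eta t ^ 3 / (3 * h.c ^ 3)) := by
  have hp := hh.root_pos t
  have hp' := hh.root_pos (t + 1)
  have hc := hh.c_pos
  have h1 : h.root (t + 1) ^ 3 = h.root t ^ 3 + 1 := by
    rw [hh.root_pow_three, hh.root_pow_three]; push_cast; ring
  have h2 : h.root (t + 1) ≤ h.root t + 1 / (3 * h.root t ^ 2) := by
    refine le_of_pow_le_pow_left₀ three_ne_zero (by positivity) ?_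
    rw [h1]
    have h3 : (h.root t + 1 / (3 * h.root t ^ 2)) ^ 3
        = h.root t ^ 3 + 1 + (3 * h.root t * (1 / (3 * h.root t ^ 2)) ^ 2
          + (1 / (3 * h.root t ^ 2)) ^ 3) := by
      field_simp; ring
    rw [h3]
    exact le_add_of_nonneg_right (by positivity)
  have h4 : 1 / h.eta t * (1 + h.eta t ^ 3 / (3 * h.c ^ 3))
      = (h.root t + 1 / (3 * h.root t ^ 2)) / h.c := by
    rw [eta_eq]; field_simp
  rw [h4, eta_eq, one_div_div]
  gcongr

end Admissible

end Params

/-! ### Consequences of the conditions on constants and parameters -/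

namespace Consts.Valid

variable {k : Consts}

lemma C0_nonneg (hk : k.Valid) : 0 ≤ k.C0 := by
  have := hk.lam_pos
  rw [C0]; positivity

lemma C2_nonneg (k : Consts) : 0 ≤ k.C2 := by rw [C2]; positivity

lemma C3_nonneg (k : Consts) : 0 ≤ k.C3 := by rw [C3]; positivity

lemma C4_nonneg (k : Consts) : 0 ≤ k.C4 := by rw [C4]; positivity

lemma Ly_nonneg (hk : k.Valid) : 0 ≤ k.Ly := div_nonneg hk.Cgxy_nonneg hk.lam_pos.le

end Consts.Valid

namespace Params.Admissible

open Consts.Valid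

variable {h : Params} {k : Consts}

lemma bigC_nonneg (hk : k.Valid) (hh : h.Admissible k) : 0 ≤ h.bigC k := by
  have := hk.C0_nonneg
  have := hk.lam_pos
  have := hh.tau_pos
  exact le_max_of_le_left (by positivity)

/-- First entry of the maximum defining C: it makes the contraction of b outweigh the C₀ b term of
the bias. -/
lemma C0_le (hk : k.Valid) (hh : h.Admissible k) : k.C0 ≤ h.bigC k * h.tau * k.lam / 4 := by
  have := hk.lam_pos
  have := hh.tau_pos
  have h1 : 4 * k.C0 / (h.tau * k.lam) ≤ h.bigC k := le_max_left _ _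
  rw [div_le_iff₀ (by positivity)] at h1
  linarith

/-- Second entry of the maximum: it makes the ‖w‖² gained by the y-step cover the displacement terms
of the estimators. -/
lemma sumLsq_le (hh : h.Admissible k) : 4 * k.sumLsq ≤ h.bigC k * h.gam := by
  have h1 : 4 * k.sumLsq / h.gam ≤ h.bigC k := le_max_right _ _
  rwa [div_le_iff₀ hh.gam_pos] at h1

/-- The first bound on γ, squared; it limits the cost of the drift of y* in the weighted sum. -/
lemma bigC_mul_Ly_sq_le (hk : k.Valid) (hh : h.Admissible k) :
    h.bigC k * k.Ly ^ 2 * h.gam ^ 2 ≤ h.tau * k.lam / 64 := by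
  have hC := bigC_nonneg hk hh
  have hLy := hk.Ly_nonneg
  have hg := hh.gam_pos
  have h2 : 0 ≤ h.tau * k.lam := (mul_pos hh.tau_pos hk.lam_pos).le
  have h1 := pow_le_pow_left₀ (by positivity) hh.gam_le_first 2
  rw [Real.sq_sqrt h2, mul_pow, mul_pow, mul_pow, Real.sq_sqrt hC] at h1
  linarith

end Params.Admissible

/-! ### Decrease of the potential -/

/-- The step size `η` is small enough for the potential to decrease. -/
structure SmallStep (k : Consts) (h : Params) (η : ℝ) : Prop where
  le_half : η ≤ 1 / 2
  tau : η * (h.tau * k.lam) ≤ 4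
  smooth : η * (h.gam * h.LF) ≤ 1 / 4
  ratio : η * (7 * h.LF) ≤ 3
  cube : η * (1 / (3 * h.c ^ 3)) ≤ 1
  beta_fx : η * (1 / (7 * h.LF * h.c ^ 3) + k.C1 * h.gam) ≤ 1
  beta_fy : η * (1 / (7 * h.LF * h.c ^ 3) + k.C4 * h.gam) ≤ 1
  beta_gxy : η * (1 / (7 * h.LF * h.c ^ 3) + k.C2 * h.gam) ≤ 1
  beta_gyy : η * (1 / (7 * h.LF * h.c ^ 3) + k.C3 * h.gam) ≤ 1
  beta_gy : η * (1 / (7 * h.LF * h.c ^ 3) + 8 * h.bigC k * h.gam * h.tau / k.lam) ≤ 1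

/-- Each condition bounds η_t times a fixed number, and η_t → 0. The threshold depends on constants
and parameters only. -/
lemma eventually_smallStep (k : Consts) (h : Params) :
    ∀ᶠ t in Filter.atTop, SmallStep k h (h.eta t) := by
  have h1 := h.eventually_eta_mul_le 1 (r := 1 / 2) (by norm_num)
  simp only [mul_one] at h1
  filter_upwards [h1, h.eventually_eta_mul_le (h.tau * k.lam) four_pos,
    h.eventually_eta_mul_le (h.gam * h.LF) (r := 1 / 4) (by norm_num),
    h.eventually_eta_mul_le (7 * h.LF) three_pos,
    h.eventually_eta_mul_le (1 / (3 * h.c ^ 3)) one_pos,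
    h.eventually_eta_mul_le (1 / (7 * h.LF * h.c ^ 3) + k.C1 * h.gam) one_pos,
    h.eventually_eta_mul_le (1 / (7 * h.LF * h.c ^ 3) + k.C4 * h.gam) one_pos,
    h.eventually_eta_mul_le (1 / (7 * h.LF * h.c ^ 3) + k.C2 * h.gam) one_pos,
    h.eventually_eta_mul_le (1 / (7 * h.LF * h.c ^ 3) + k.C3 * h.gam) one_pos,
    h.eventually_eta_mul_le (1 / (7 * h.LF * h.c ^ 3) + 8 * h.bigC k * h.gam * h.tau / k.lam)
      one_pos] with t a1 a2 a3 a4 a5 a6 a7 a8 a9 a10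
  exact ⟨a1, a2, a3, a4, a5, a6, a7, a8, a9, a10⟩

namespace Moments

variable {m : Moments} {k : Consts} {h : Params} {D : ℝ}

/-- The sum of the squared errors of the estimators. -/
def errors (m : Moments) (t : ℕ) : ℝ := m.eu t + m.ev t + m.eV t + m.eH t + m.ew t

/-- The potential. -/
def potential (m : Moments) (k : Consts) (h : Params) (t : ℕ) : ℝ :=
  m.a t + h.bigC k * h.gam * m.b t + 1 / h.eta t * m.errors t

/-- The momentum β = (κ + A)η² has two tasks. The part κη² pays for the relative growth r of the
weight 1/η_t, because 7L_F η ≤ 3 gives r ≤ κη². The part Aη² leaves −ηA E, which cancels bias terms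
in the potential. -/
lemma ErrorStep.weighted (hh : h.Admissible k) {A L : ℝ} {E : ℕ → ℝ}
    (hE : m.ErrorStep k h (h.momentum A) L E) {t : ℕ} (hs : SmallStep k h (h.eta t)) (hA : 0 ≤ A)
    (hβ : h.eta t * (1 / (7 * h.LF * h.c ^ 3) + A) ≤ 1) (h0 : 0 ≤ E t) (h0' : 0 ≤ E (t + 1))
    (hZ : 0 ≤ m.Z t) (hW : 0 ≤ m.W t) :
    1 / h.eta (t + 1) * E (t + 1) ≤ 1 / h.eta t * E t - h.eta t * A * E t
      + 4 * (1 / (7 * h.LF * h.c ^ 3) + A) ^ 2 * k.sigma ^ 2 * h.eta t ^ 3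
      + 4 * L ^ 2 * h.eta t * (h.gam ^ 2 * m.Z t + h.tau ^ 2 * m.W t) := by
  have hη := hh.eta_pos t
  have hc := hh.c_pos
  have hLF := hh.LF_pos
  have h1 := hh.inv_eta_succ_le t
  have h2 := hE t
  set η := h.eta t
  set κ := 1 / (7 * h.LF * h.c ^ 3) with hκ
  have hβeq : h.momentum A (t + 1) = (κ + A) * η ^ 2 := rfl
  rw [hβeq] at h2
  set r := η ^ 3 / (3 * h.c ^ 3) with hr
  have hκ0 : 0 ≤ κ := by positivity
  have hr0 : 0 ≤ r := by positivity
  have hη1 : η ≤ 1 := hs.le_half.trans (by norm_num)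
  have hr1 : r ≤ 1 := by
    have : r = η * (1 / (3 * h.c ^ 3)) * (η * η) := by rw [hr]; ring
    rw [this]
    exact mul_le_one₀ hs.cube (by positivity) (mul_le_one₀ hη1 hη.le hη1)
  have hrκ : r ≤ κ * η ^ 2 := by
    have e1 : r = η ^ 2 / (21 * h.LF * h.c ^ 3) * (η * (7 * h.LF)) := by
      rw [hr]; field_simp; ring
    have e2 : κ * η ^ 2 = η ^ 2 / (21 * h.LF * h.c ^ 3) * 3 := by
      rw [hκ]; field_simp; ring
    rw [e1, e2]
    exact mul_le_mul_of_nonneg_left hs.ratio (by positivity)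
  set β := (κ + A) * η ^ 2 with hβd
  have hβ0 : 0 ≤ β := by positivity
  have hβ1 : β ≤ 1 := by
    have : β = η * (κ + A) * η := by rw [hβd]; ring
    rw [this]
    exact mul_le_one₀ hβ hη.le hη1
  set X := (η * h.gam) ^ 2 * m.Z t + (η * h.tau) ^ 2 * m.W t with hX
  have hX0 : 0 ≤ X := by positivity
  have hsq : (1 - β) ^ 2 ≤ 1 - β := by nlinarith
  have hsq1 : (1 - β) ^ 2 ≤ 1 := hsq.trans (by linarith)
  have h3 : E (t + 1) ≤ (1 - β) * E t + (2 * β ^ 2 * k.sigma ^ 2 + 2 * L ^ 2 * X) := by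
    have e1 := mul_le_mul_of_nonneg_right hsq h0
    have e2 := mul_le_mul_of_nonneg_right hsq1 (by positivity : 0 ≤ 2 * L ^ 2 * X)
    linarith
  set N := 2 * β ^ 2 * k.sigma ^ 2 + 2 * L ^ 2 * X with hN
  have hN0 : 0 ≤ N := by positivity
  -- The product (1 + r)(1 − β) is at most 1 − Aη² once −rβ is dropped; on the noise, 1 + r ≤ 2
  -- suffices.
  have h4 : (1 + r) * E (t + 1) ≤ (1 - A * η ^ 2) * E t + 2 * N := by
    have e1 : (1 + r) * E (t + 1) ≤ (1 + r) * (1 - β) * E t + (1 + r) * N := by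
      rw [mul_assoc, ← mul_add]
      exact mul_le_mul_of_nonneg_left h3 (by positivity)
    have e2 : (1 + r) * (1 - β) ≤ 1 - A * η ^ 2 := by
      have : β = κ * η ^ 2 + A * η ^ 2 := by rw [hβd]; ring
      linarith [mul_nonneg hr0 hβ0]
    have e3 := mul_le_mul_of_nonneg_right e2 h0
    have e4 : (1 + r) * N ≤ 2 * N := mul_le_mul_of_nonneg_right (by linarith) hN0
    linarith
  calc 1 / h.eta (t + 1) * E (t + 1) ≤ 1 / η * (1 + r) * E (t + 1) := by gcongr
    _ = 1 / η * ((1 + r) * E (t + 1)) := by ring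
    _ ≤ 1 / η * ((1 - A * η ^ 2) * E t + 2 * N) := by gcongr
    _ = _ := by
      rw [hN, hX, hβd]
      field_simp
      ring

namespace Bounds

open Consts.Valid

/-- With q = ητλ/4 the contraction is (1 + q)(1 − 2q) ≤ 1 − q, and Cq ≥ ηC₀. The factor 1/q from
Young's inequality meets η² from the displacement, and the first bound on γ reduces the product to
η/8. -/
lemma b_weighted (hk : k.Valid) (hh : h.Admissible k) (hm : m.Bounds k h D) {t : ℕ}
    (hs : SmallStep k h (h.eta t)) :
    h.bigC k * m.b (t + 1) ≤ h.bigC k * m.b t - h.eta t * k.C0 * m.b t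
      + h.eta t * (8 * h.bigC k * h.tau / k.lam) * m.ew t
      - h.eta t * h.bigC k * h.tau ^ 2 * m.W t + h.eta t / 8 * m.Z t := by
  have hη := hh.eta_pos t
  have hl := hk.lam_pos
  have hτ := hh.tau_pos
  have hC := Params.Admissible.bigC_nonneg hk hh
  have hb := hm.b_nonneg t
  have hw := hm.ew_nonneg t
  have hW := hm.W_nonneg t
  have hZ := hm.Z_nonneg t
  have h1 := hm.b_step t
  have h2 := hs.le_half
  have h3 := hs.tau
  have h4 := Params.Admissible.C0_le hk hh
  have h5 := Params.Admissible.bigC_mul_Ly_sq_le hk hh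
  set η := h.eta t
  set q := η * h.tau * k.lam / 4 with hq
  have hq0 : 0 < q := by positivity
  have hq1 : q ≤ 1 := by rw [hq]; linarith
  have e0 : η * h.tau * k.lam / 2 = 2 * q := by rw [hq]; ring
  rw [e0] at h1
  have hCq : η * k.C0 ≤ h.bigC k * q := by
    calc η * k.C0 ≤ η * (h.bigC k * h.tau * k.lam / 4) := by gcongr
      _ = _ := by rw [hq]; ring
  have e1 : (1 + q) * (1 - 2 * q) * m.b t ≤ (1 - q) * m.b t := by
    gcongr; nlinarith [sq_nonneg q]
  have e2 : (1 + q) * (3 * (η * h.tau) / k.lam) * m.ew t ≤ 8 * η * h.tau / k.lam * m.ew t := by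
    have : (1 + q) * (3 * (η * h.tau) / k.lam) ≤ 2 * (3 * (η * h.tau) / k.lam) := by
      gcongr; linarith
    have e : 2 * (3 * (η * h.tau) / k.lam) ≤ 8 * η * h.tau / k.lam := by
      have : 8 * η * h.tau / k.lam - 2 * (3 * (η * h.tau) / k.lam) = 2 * η * h.tau / k.lam := by
        ring
      have : 0 ≤ 2 * η * h.tau / k.lam := by positivity
      linarith
    exact mul_le_mul_of_nonneg_right (this.trans e) hw
  have e3 : η * h.tau ^ 2 * m.W t
      ≤ (1 + q) * (η * h.tau * (3 / 2 * h.tau - η * h.tau)) * m.W t := by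
    have e : (1 + q) * (η * h.tau * (3 / 2 * h.tau - η * h.tau))
        = η * h.tau ^ 2 * ((1 + q) * (3 / 2 - η)) := by ring
    rw [e]
    -- Here η ≤ 1/2 makes 3/2 − η at least 1.
    have e' : 1 ≤ (1 + q) * (3 / 2 - η) := by nlinarith
    exact mul_le_mul_of_nonneg_right (le_mul_of_one_le_right (by positivity) e') hW
  have e4 : h.bigC k * ((1 + 1 / q) * k.Ly ^ 2 * ((η * h.gam) ^ 2 * m.Z t)) ≤ η / 8 * m.Z t := by
    have e : h.bigC k * ((1 + 1 / q) * k.Ly ^ 2 * ((η * h.gam) ^ 2 * m.Z t))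
        = (1 + 1 / q) * η ^ 2 * m.Z t * (h.bigC k * k.Ly ^ 2 * h.gam ^ 2) := by ring
    rw [e]
    calc _ ≤ (1 + 1 / q) * η ^ 2 * m.Z t * (h.tau * k.lam / 64) := by gcongr
      _ = (1 + q) * η / 16 * m.Z t := by rw [hq]; field_simp; ring
      _ ≤ η / 8 * m.Z t := mul_le_mul_of_nonneg_right (by nlinarith) hZ
  have h6 := mul_le_mul_of_nonneg_left h1 hC
  have h7 : h.bigC k * ((1 + q) * ((1 - 2 * q) * m.b t + 3 * (η * h.tau) / k.lam * m.ew t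
        - η * h.tau * (3 / 2 * h.tau - η * h.tau) * m.W t))
      ≤ h.bigC k * ((1 - q) * m.b t + 8 * η * h.tau / k.lam * m.ew t - η * h.tau ^ 2 * m.W t) := by
    refine mul_le_mul_of_nonneg_left ?_ hC
    linarith
  have h8 : η * (8 * h.bigC k * h.tau / k.lam) * m.ew t
      = h.bigC k * (8 * η * h.tau / k.lam * m.ew t) := by ring
  rw [h8]
  have h9 := mul_le_mul_of_nonneg_right hCq hb
  rw [mul_add] at h6
  linarith

/-- The coefficients A are matched to their targets: C_iγ cancels the bias in the gap, and 8Cγτ/λ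
cancels the error of w in `b_weighted`. -/
lemma errors_weighted (hk : k.Valid) (hh : h.Admissible k) (hm : m.Bounds k h D) {t : ℕ}
    (hs : SmallStep k h (h.eta t)) :
    1 / h.eta (t + 1) * m.errors (t + 1) ≤ 1 / h.eta t * m.errors t
      - h.eta t * h.gam * (k.C1 * m.eu t + k.C4 * m.ev t + k.C2 * m.eV t + k.C3 * m.eH t)
      - h.eta t * (8 * h.bigC k * h.gam * h.tau / k.lam) * m.ew t
      + 4 * ((1 / (7 * h.LF * h.c ^ 3) + k.C1 * h.gam) ^ 2
          + (1 / (7 * h.LF * h.c ^ 3) + k.C4 * h.gam) ^ 2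
          + (1 / (7 * h.LF * h.c ^ 3) + k.C2 * h.gam) ^ 2
          + (1 / (7 * h.LF * h.c ^ 3) + k.C3 * h.gam) ^ 2
          + (1 / (7 * h.LF * h.c ^ 3) + 8 * h.bigC k * h.gam * h.tau / k.lam) ^ 2)
          * k.sigma ^ 2 * h.eta t ^ 3
      + 4 * k.sumLsq * h.eta t * (h.gam ^ 2 * m.Z t + h.tau ^ 2 * m.W t) := by
  have hg := hh.gam_pos
  have hτ := hh.tau_pos
  have hl := hk.lam_pos
  have hC := Params.Admissible.bigC_nonneg hk hh
  have hZ := hm.Z_nonneg t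
  have hW := hm.W_nonneg t
  have f1 := hm.eu_step.weighted hh hs (mul_nonneg zero_le_two hg.le) hs.beta_fx
    (hm.eu_nonneg _) (hm.eu_nonneg _) hZ hW
  have f2 := hm.ev_step.weighted hh hs (mul_nonneg (C4_nonneg k) hg.le) hs.beta_fy
    (hm.ev_nonneg _) (hm.ev_nonneg _) hZ hW
  have f3 := hm.eV_step.weighted hh hs (mul_nonneg (C2_nonneg k) hg.le) hs.beta_gxy
    (hm.eV_nonneg _) (hm.eV_nonneg _) hZ hW
  have f4 := hm.eH_step.weighted hh hs (mul_nonneg (C3_nonneg k) hg.le) hs.beta_gyy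
    (hm.eH_nonneg _) (hm.eH_nonneg _) hZ hW
  have f5 := hm.ew_step.weighted hh hs (by positivity) hs.beta_gy
    (hm.ew_nonneg _) (hm.ew_nonneg _) hZ hW
  simp only [errors, Consts.sumLsq]
  linarith

/-- The coefficient of the noise in the decrease of the potential. -/
def noise (k : Consts) (h : Params) : ℝ :=
  4 * ((1 / (7 * h.LF * h.c ^ 3) + k.C1 * h.gam) ^ 2
    + (1 / (7 * h.LF * h.c ^ 3) + k.C4 * h.gam) ^ 2
    + (1 / (7 * h.LF * h.c ^ 3) + k.C2 * h.gam) ^ 2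
    + (1 / (7 * h.LF * h.c ^ 3) + k.C3 * h.gam) ^ 2
    + (1 / (7 * h.LF * h.c ^ 3) + 8 * h.bigC k * h.gam * h.tau / k.lam) ^ 2) * k.sigma ^ 2

lemma noise_nonneg (k : Consts) (h : Params) : 0 ≤ noise k h := by rw [noise]; positivity

/-- Bias terms cancel exactly. Of ‖z‖², the descent step provides at least (3/8)ηγ, spent as 1/8 on
the drift of y* and 1/4 on the estimators. Of ‖w‖², the y-step provides Cγητ², which covers the
estimators since 4Σ ≤ Cγ. -/
lemma potential_succ_le (hk : k.Valid) (hh : h.Admissible k) (hm : m.Bounds k h D) {t : ℕ}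
    (hs : SmallStep k h (h.eta t)) :
    m.potential k h (t + 1) ≤ m.potential k h t - h.eta t * h.gam / 2 * m.G t
      + noise k h * h.eta t ^ 3 := by
  have hη := hh.eta_pos t
  have hg := hh.gam_pos
  have hZ := hm.Z_nonneg t
  have hW := hm.W_nonneg t
  have h1 := hm.a_step t
  have h2 := mul_le_mul_of_nonneg_left (hm.b_weighted hk hh hs) hg.le
  have h3 := hm.errors_weighted hk hh hs
  have h4 := hh.sumLsq_le
  have h5 := hh.gam_le_second
  have h6 := hs.smooth
  have hWc : 4 * k.sumLsq * h.eta t * (h.tau ^ 2 * m.W t)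
      ≤ h.bigC k * h.gam * h.eta t * (h.tau ^ 2 * m.W t) := by gcongr
  have hZc : 4 * k.sumLsq * h.eta t * (h.gam ^ 2 * m.Z t) ≤ h.eta t * h.gam / 4 * m.Z t := by
    have : 4 * k.sumLsq * h.eta t * (h.gam ^ 2 * m.Z t)
        = h.eta t * h.gam / 4 * m.Z t * (h.gam * (16 * k.sumLsq)) := by ring
    rw [this]
    exact mul_le_of_le_one_right (by positivity) h5
  have hZd : h.eta t * h.gam / 2 * (h.eta t * (h.gam * h.LF)) * m.Z t
      ≤ h.eta t * h.gam / 2 * (1 / 4) * m.Z t := by gcongr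
  have hbias : m.bias k t = 2 * (k.C0 * m.b t + k.C1 * m.eu t + k.C2 * m.eV t + k.C3 * m.eH t
    + k.C4 * m.ev t) := rfl
  have hn : noise k h * h.eta t ^ 3 = 4 * ((1 / (7 * h.LF * h.c ^ 3) + k.C1 * h.gam) ^ 2
    + (1 / (7 * h.LF * h.c ^ 3) + k.C4 * h.gam) ^ 2
    + (1 / (7 * h.LF * h.c ^ 3) + k.C2 * h.gam) ^ 2
    + (1 / (7 * h.LF * h.c ^ 3) + k.C3 * h.gam) ^ 2
    + (1 / (7 * h.LF * h.c ^ 3) + 8 * h.bigC k * h.gam * h.tau / k.lam) ^ 2)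
      * k.sigma ^ 2 * h.eta t ^ 3 := rfl
  rw [← hn] at h3
  rw [hbias] at h1
  have hZ8 : 0 ≤ h.eta t * h.gam * m.Z t := by positivity
  simp only [potential]
  have hw : h.gam * (h.eta t * (8 * h.bigC k * h.tau / k.lam) * m.ew t)
      = h.eta t * (8 * h.bigC k * h.gam * h.tau / k.lam) * m.ew t := by ring
  linarith

end Bounds

/-! ### Growth of the moments -/

/-- The sum of the gap and of all squared errors. -/
def total (m : Moments) (t : ℕ) : ℝ := m.a t + m.b t + m.errors t

/-- `f` at time `t + 1` is bounded by an affine function of the total at time `t`, with a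
coefficient that depends on the constants and parameters only. -/
def Controlled (k : Consts) (h : Params) (D : ℝ) (f : Moments → ℕ → ℝ) : Prop :=
  ∃ R, 0 ≤ R ∧ ∀ m : Moments, m.Bounds k h D → ∀ t, f m (t + 1) ≤ R * (m.total t + 1)

lemma Controlled.add {f g : Moments → ℕ → ℝ} (hf : Controlled k h D f)
    (hg : Controlled k h D g) : Controlled k h D (fun m t => f m t + g m t) := by
  obtain ⟨R, hR, h1⟩ := hf
  obtain ⟨R', hR', h2⟩ := hg
  refine ⟨R + R', by positivity, fun m hm t => ?_⟩
  have := h1 m hm t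
  have := h2 m hm t
  rw [add_mul]
  linarith

namespace Bounds

open Consts.Valid

lemma errors_nonneg (hm : m.Bounds k h D) (t : ℕ) : 0 ≤ m.errors t := by
  have := hm.eu_nonneg t
  have := hm.ev_nonneg t
  have := hm.eV_nonneg t
  have := hm.eH_nonneg t
  have := hm.ew_nonneg t
  rw [errors]
  positivity

lemma total_nonneg (hm : m.Bounds k h D) (t : ℕ) : 0 ≤ m.total t := by
  have := hm.a_nonneg t
  have := hm.b_nonneg t
  have := hm.errors_nonneg t
  rw [total]
  positivity

lemma le_total (hm : m.Bounds k h D) (t : ℕ) :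
    m.a t ≤ m.total t ∧ m.b t ≤ m.total t ∧ m.errors t ≤ m.total t ∧ m.eu t ≤ m.total t ∧
      m.ev t ≤ m.total t ∧ m.eV t ≤ m.total t ∧ m.eH t ≤ m.total t ∧ m.ew t ≤ m.total t := by
  have := hm.a_nonneg t
  have := hm.b_nonneg t
  have := hm.eu_nonneg t
  have := hm.ev_nonneg t
  have := hm.eV_nonneg t
  have := hm.eH_nonneg t
  have := hm.ew_nonneg t
  simp only [total, errors]
  refine ⟨?_, ?_, ?_, ?_, ?_, ?_, ?_, ?_⟩ <;> linarith

lemma bias_le (hk : k.Valid) (hm : m.Bounds k h D) (t : ℕ) :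
    m.bias k t ≤ 2 * (k.C0 + k.C1 + k.C2 + k.C3 + k.C4) * m.total t := by
  obtain ⟨-, h1, -, h2, h3, h4, h5, -⟩ := hm.le_total t
  have e0 := mul_le_mul_of_nonneg_left h1 hk.C0_nonneg
  have e1 : k.C1 * m.eu t ≤ k.C1 * m.total t := mul_le_mul_of_nonneg_left h2 zero_le_two
  have e2 := mul_le_mul_of_nonneg_left h4 (C2_nonneg k)
  have e3 := mul_le_mul_of_nonneg_left h5 (C3_nonneg k)
  have e4 := mul_le_mul_of_nonneg_left h3 (C4_nonneg k)
  rw [bias]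
  linarith

lemma Z_le_total (hk : k.Valid) (hh : h.Admissible k) (hm : m.Bounds k h D) (t : ℕ) :
    m.Z t ≤ (4 * h.LF + 4 * (k.C0 + k.C1 + k.C2 + k.C3 + k.C4)) * m.total t := by
  have h1 := hm.Z_le t
  have h2 := hm.G_le t
  have h3 := hm.bias_le hk t
  have h4 := mul_le_mul_of_nonneg_left (hm.le_total t).1 hh.LF_pos.le
  linarith

lemma W_le_total (hm : m.Bounds k h D) (t : ℕ) :
    m.W t ≤ (2 + 8 * k.Lg ^ 2) * m.total t := by
  obtain ⟨-, h1, -, -, -, -, -, h2⟩ := hm.le_total t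
  have h3 := mul_le_mul_of_nonneg_left h1 (by positivity : 0 ≤ 8 * k.Lg ^ 2)
  have h4 := hm.W_le t
  linarith

lemma controlled_a (hk : k.Valid) (hh : h.Admissible k) : Controlled k h D a := by
  have hE := hh.eta_pos 0
  have hg := hh.gam_pos
  have hLF := hh.LF_pos
  set E := h.eta 0 with hEd
  set Cb := 2 * (k.C0 + k.C1 + k.C2 + k.C3 + k.C4)
  have hCb : 0 ≤ Cb := by
    have := hk.C0_nonneg
    have := C2_nonneg k
    have := C3_nonneg k
    have := C4_nonneg k
    have : 0 ≤ k.C1 := zero_le_two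
    positivity
  set Rz := 4 * h.LF + 4 * (k.C0 + k.C1 + k.C2 + k.C3 + k.C4) with hRz
  have hRz0 : 0 ≤ Rz := by
    have : Rz = 4 * h.LF + 2 * Cb := by ring
    rw [this]; positivity
  refine ⟨1 + E * h.gam / 2 * Cb + (E * h.gam) ^ 2 * h.LF / 2 * Rz, by positivity,
    fun m hm t => ?_⟩
  have hη := hh.eta_pos t
  have hηE : h.eta t ≤ E := hh.eta_antitone (Nat.zero_le t)
  have hM := hm.total_nonneg t
  have h1 := hm.a_step t
  have hG := hm.G_nonneg t
  have hZ := hm.Z_nonneg t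
  have e1 : h.eta t * h.gam / 2 * m.bias k t ≤ E * h.gam / 2 * (Cb * m.total t) := by
    calc _ ≤ h.eta t * h.gam / 2 * (Cb * m.total t) := by
          gcongr
          exact hm.bias_le hk t
      _ ≤ _ := by gcongr
  have e2 : (h.eta t * h.gam) ^ 2 * h.LF / 2 * m.Z t
      ≤ (E * h.gam) ^ 2 * h.LF / 2 * (Rz * m.total t) := by
    gcongr
    exact hm.Z_le_total hk hh t
  have e3 : 0 ≤ h.eta t * h.gam / 2 * m.G t := by positivity
  have e4 : 0 ≤ h.eta t * h.gam / 2 * m.Z t := by positivity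
  have e5 := (hm.le_total t).1
  have e6 : 0 ≤ 1 + E * h.gam / 2 * Cb + (E * h.gam) ^ 2 * h.LF / 2 * Rz := by positivity
  linarith

lemma controlled_b (hk : k.Valid) (hh : h.Admissible k) : Controlled k h D b := by
  have hE := hh.eta_pos 0
  have hg := hh.gam_pos
  have hτ := hh.tau_pos
  have hl := hk.lam_pos
  have hLF := hh.LF_pos
  set E := h.eta 0 with hEd
  set Rz := 4 * h.LF + 4 * (k.C0 + k.C1 + k.C2 + k.C3 + k.C4) with hRz
  have hRz0 : 0 ≤ Rz := by
    have := hk.C0_nonneg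
    have := C2_nonneg k
    have := C3_nonneg k
    have := C4_nonneg k
    have : 0 ≤ k.C1 := zero_le_two
    positivity
  set Rw := 2 + 8 * k.Lg ^ 2
  refine ⟨(1 + E * h.tau * k.lam / 4) * (1 + 3 * (E * h.tau) / k.lam + (E * h.tau) ^ 2 * Rw)
    + k.Ly ^ 2 * (E ^ 2 * h.gam ^ 2 + 4 * E * h.gam ^ 2 / (h.tau * k.lam)) * Rz, by positivity,
    fun m hm t => ?_⟩
  have hη := hh.eta_pos t
  have hηE : h.eta t ≤ E := hh.eta_antitone (Nat.zero_le t)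
  have hM := hm.total_nonneg t
  have h1 := hm.b_step t
  have hb := hm.b_nonneg t
  have hew := hm.ew_nonneg t
  have hW := hm.W_nonneg t
  have hZ := hm.Z_nonneg t
  obtain ⟨-, hb', -, -, -, -, -, hew'⟩ := hm.le_total t
  set η := h.eta t
  have e1 : (1 - η * h.tau * k.lam / 2) * m.b t + 3 * (η * h.tau) / k.lam * m.ew t
      - η * h.tau * (3 / 2 * h.tau - η * h.tau) * m.W t
      ≤ (1 + 3 * (E * h.tau) / k.lam + (E * h.tau) ^ 2 * Rw) * m.total t := by
    have f1 : 0 ≤ η * h.tau * k.lam / 2 * m.b t := by positivity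
    have f2 : 3 * (η * h.tau) / k.lam * m.ew t ≤ 3 * (E * h.tau) / k.lam * m.total t := by gcongr
    have f3 : 0 ≤ η * h.tau * (3 / 2 * h.tau) * m.W t := by positivity
    have f4 : (η * h.tau) ^ 2 * m.W t ≤ (E * h.tau) ^ 2 * (Rw * m.total t) := by
      gcongr
      exact hm.W_le_total t
    linarith
  have e2 : (1 + 1 / (η * h.tau * k.lam / 4)) * k.Ly ^ 2 * ((η * h.gam) ^ 2 * m.Z t)
      ≤ k.Ly ^ 2 * (E ^ 2 * h.gam ^ 2 + 4 * E * h.gam ^ 2 / (h.tau * k.lam)) * (Rz * m.total t) := by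
    -- The 1/η of the Young weight is absorbed by the η² of the displacement, leaving an increasing
    -- function of η that is bounded by its value at η_0.
    calc _ = k.Ly ^ 2 * (η ^ 2 * h.gam ^ 2 + 4 * η * h.gam ^ 2 / (h.tau * k.lam)) * m.Z t := by
          field_simp
      _ ≤ _ := by
          gcongr
          exact hm.Z_le_total hk hh t
  calc m.b (t + 1) ≤ (1 + E * h.tau * k.lam / 4) *
          ((1 + 3 * (E * h.tau) / k.lam + (E * h.tau) ^ 2 * Rw) * m.total t)
        + k.Ly ^ 2 * (E ^ 2 * h.gam ^ 2 + 4 * E * h.gam ^ 2 / (h.tau * k.lam))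
          * (Rz * m.total t) := by
        refine h1.trans (add_le_add ?_ e2)
        refine (mul_le_mul_of_nonneg_left e1 (by positivity)).trans ?_
        gcongr
    _ = ((1 + E * h.tau * k.lam / 4) * (1 + 3 * (E * h.tau) / k.lam + (E * h.tau) ^ 2 * Rw)
    + k.Ly ^ 2 * (E ^ 2 * h.gam ^ 2 + 4 * E * h.gam ^ 2 / (h.tau * k.lam)) * Rz) * m.total t := by
        ring
    _ ≤ _ := by gcongr; linarith

/-- Here β may exceed 1, so (1 − β)² is only bounded by (1 + B)², where B is the momentum belonging
to the largest step size η_0. -/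
lemma controlled_of_errorStep (hk : k.Valid) (hh : h.Admissible k) {A L : ℝ} (hA : 0 ≤ A)
    {f : Moments → ℕ → ℝ} (hf : ∀ m : Moments, m.Bounds k h D → ∀ t, f m t ≤ m.total t)
    (hs : ∀ m : Moments, m.Bounds k h D → m.ErrorStep k h (h.momentum A) L (f m)) :
    Controlled k h D f := by
  have hE := hh.eta_pos 0
  have hg := hh.gam_pos
  have hτ := hh.tau_pos
  have hLF := hh.LF_pos
  have hc := hh.c_pos
  set E := h.eta 0 with hEd
  set Rz := 4 * h.LF + 4 * (k.C0 + k.C1 + k.C2 + k.C3 + k.C4) with hRz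
  have hRz0 : 0 ≤ Rz := by
    have := hk.C0_nonneg
    have := C2_nonneg k
    have := C3_nonneg k
    have := C4_nonneg k
    have : 0 ≤ k.C1 := zero_le_two
    positivity
  set Rw := 2 + 8 * k.Lg ^ 2
  set B := (1 / (7 * h.LF * h.c ^ 3) + A) * E ^ 2 with hB
  have hB0 : 0 ≤ B := by positivity
  refine ⟨(1 + B) ^ 2 + 2 * B ^ 2 * k.sigma ^ 2
    + 2 * (1 + B) ^ 2 * L ^ 2 * ((E * h.gam) ^ 2 * Rz + (E * h.tau) ^ 2 * Rw), by positivity,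
    fun m hm t => ?_⟩
  have hη := hh.eta_pos t
  have hηE : h.eta t ≤ E := hh.eta_antitone (Nat.zero_le t)
  have hM := hm.total_nonneg t
  have hW := hm.W_nonneg t
  have hZ := hm.Z_nonneg t
  have hβ0 : 0 ≤ h.momentum A (t + 1) := by
    have : h.momentum A (t + 1) = (1 / (7 * h.LF * h.c ^ 3) + A) * h.eta t ^ 2 := rfl
    rw [this]; positivity
  have hβB : h.momentum A (t + 1) ≤ B := by
    have : h.momentum A (t + 1) = (1 / (7 * h.LF * h.c ^ 3) + A) * h.eta t ^ 2 := rfl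
    rw [this, hB]; gcongr
  have h1 := hs m hm t
  have hft := hf m hm t
  set β := h.momentum A (t + 1)
  have hsq : (1 - β) ^ 2 ≤ (1 + B) ^ 2 := by
    refine sq_le_sq' ?_ ?_ <;> linarith
  calc f m (t + 1) ≤ (1 - β) ^ 2 * f m t + 2 * β ^ 2 * k.sigma ^ 2
        + 2 * (1 - β) ^ 2 * L ^ 2 * ((h.eta t * h.gam) ^ 2 * m.Z t
          + (h.eta t * h.tau) ^ 2 * m.W t) := h1
    _ ≤ (1 + B) ^ 2 * m.total t + 2 * B ^ 2 * k.sigma ^ 2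
        + 2 * (1 + B) ^ 2 * L ^ 2 * ((E * h.gam) ^ 2 * (Rz * m.total t)
          + (E * h.tau) ^ 2 * (Rw * m.total t)) := by
        have e1 : (1 - β) ^ 2 * f m t ≤ (1 + B) ^ 2 * m.total t :=
          (mul_le_mul_of_nonneg_left hft (sq_nonneg _)).trans (mul_le_mul_of_nonneg_right hsq hM)
        have e2 := hm.Z_le_total hk hh t
        have e3 := hm.W_le_total t
        gcongr
    _ = ((1 + B) ^ 2 + 2 * (1 + B) ^ 2 * L ^ 2 * ((E * h.gam) ^ 2 * Rz
          + (E * h.tau) ^ 2 * Rw)) * m.total t + 2 * B ^ 2 * k.sigma ^ 2 := by ring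
    _ ≤ _ := by
        have e1 : 0 ≤ 2 * B ^ 2 * k.sigma ^ 2 * m.total t := by positivity
        have e2 : 0 ≤ (1 + B) ^ 2 + 2 * (1 + B) ^ 2 * L ^ 2 * ((E * h.gam) ^ 2 * Rz
          + (E * h.tau) ^ 2 * Rw) := by positivity
        linarith

lemma controlled_total (hk : k.Valid) (hh : h.Admissible k) : Controlled k h D total := by
  have hg := hh.gam_pos
  have hτ := hh.tau_pos
  have hl := hk.lam_pos
  have hC := Params.Admissible.bigC_nonneg hk hh
  have c1 : Controlled k h D eu := controlled_of_errorStep hk hh (mul_nonneg zero_le_two hg.le)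
    (fun m hm t => (hm.le_total t).2.2.2.1) fun m hm => hm.eu_step
  have c2 : Controlled k h D ev := controlled_of_errorStep hk hh (mul_nonneg (C4_nonneg k) hg.le)
    (fun m hm t => (hm.le_total t).2.2.2.2.1) fun m hm => hm.ev_step
  have c3 : Controlled k h D eV := controlled_of_errorStep hk hh (mul_nonneg (C2_nonneg k) hg.le)
    (fun m hm t => (hm.le_total t).2.2.2.2.2.1) fun m hm => hm.eV_step
  have c4 : Controlled k h D eH := controlled_of_errorStep hk hh (mul_nonneg (C3_nonneg k) hg.le)
    (fun m hm t => (hm.le_total t).2.2.2.2.2.2.1) fun m hm => hm.eH_step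
  have c5 : Controlled k h D ew := controlled_of_errorStep hk hh
    (A := 8 * h.bigC k * h.gam * h.tau / k.lam) (by positivity)
    (fun m hm t => (hm.le_total t).2.2.2.2.2.2.2) fun m hm => hm.ew_step
  exact ((controlled_a hk hh).add (controlled_b hk hh)).add ((((c1.add c2).add c3).add c4).add c5)

/-- Iteration of the affine recursion. The bound depends on t but not on the run, which is enough
for the finitely many iterations before the potential starts to decrease. -/
lemma exists_total_le (hk : k.Valid) (hh : h.Admissible k) (t : ℕ) :
    ∃ ρ, 0 ≤ ρ ∧ ∀ m : Moments, m.Bounds k h D → m.total t ≤ ρ := by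
  induction t with
  | zero =>
    -- One gap bounded by Δ and six errors bounded by D; the absolute value is there because D has
    -- no prescribed sign.
    refine ⟨|k.Delta + 6 * D|, abs_nonneg _, fun m hm => le_trans ?_ (le_abs_self _)⟩
    have := hm.a_zero
    have := hm.b_zero
    have := hm.eu_zero
    have := hm.ev_zero
    have := hm.eV_zero
    have := hm.eH_zero
    have := hm.ew_zero
    simp only [total, errors]
    linarith
  | succ t ih =>
    obtain ⟨ρ, hρ, h1⟩ := ih
    obtain ⟨R, hR, h2⟩ := controlled_total (D := D) hk hh
    refine ⟨R * (ρ + 1), by positivity, fun m hm => (h2 m hm t).trans ?_⟩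
    have := h1 m hm
    gcongr

/-! ### The rate -/

lemma potential_nonneg (hk : k.Valid) (hh : h.Admissible k) (hm : m.Bounds k h D) (t : ℕ) :
    0 ≤ m.potential k h t := by
  have := hm.a_nonneg t
  have := hm.b_nonneg t
  have := hm.errors_nonneg t
  have := hh.eta_pos t
  have := hh.gam_pos
  have := Params.Admissible.bigC_nonneg hk hh
  rw [potential]
  positivity

/-- The potential is telescoped from t₀ on, starting from a value bounded by the crude growth
estimate. Earlier terms are bounded one by one through 𝔼‖∇F‖² ≤ 2L_F a. -/
lemma exists_sum_le (hk : k.Valid) (hh : h.Admissible k) (D : ℝ) :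
    ∃ K, 0 ≤ K ∧ ∀ m : Moments, m.Bounds k h D → ∀ n,
      ∑ t ∈ Finset.range n, h.eta t * m.G t
        ≤ K * (1 + ∑ t ∈ Finset.range n, h.eta t ^ 3) := by
  choose ρ hρ hle using exists_total_le (D := D) hk hh
  obtain ⟨t₀, ht₀⟩ := Filter.eventually_atTop.1 (eventually_smallStep k h)
  have hg := hh.gam_pos
  have hLF := hh.LF_pos
  have hC := Params.Admissible.bigC_nonneg hk hh
  have hN := noise_nonneg k h
  have hη := hh.eta_pos
  set S₁ := (1 + h.bigC k * h.gam + 1 / h.eta t₀) * ρ t₀ with hS1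
  set S₂ := ∑ t ∈ Finset.range t₀, h.eta t * (2 * h.LF * ρ t) with hS2
  have hS1' : 0 ≤ S₁ := by
    have := hρ t₀
    have := hη t₀
    positivity
  have hS2' : 0 ≤ S₂ := Finset.sum_nonneg fun t _ => by
    have := hρ t
    have := hη t
    positivity
  refine ⟨2 / h.gam * (S₁ + noise k h) + S₂, by positivity, fun m hm n => ?_⟩
  have hearly : ∀ n, n ≤ t₀ → ∑ t ∈ Finset.range n, h.eta t * m.G t ≤ S₂ := by
    intro n hn
    calc ∑ t ∈ Finset.range n, h.eta t * m.G t
        ≤ ∑ t ∈ Finset.range t₀, h.eta t * m.G t :=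
          Finset.sum_le_sum_of_subset_of_nonneg (by simpa using hn) fun t _ _ =>
            mul_nonneg (hη t).le (hm.G_nonneg t)
      _ ≤ S₂ := Finset.sum_le_sum fun t _ => by
          have h1 := hm.G_le t
          have h2 := (hm.le_total t).1.trans (hle t m hm)
          have h3 := hη t
          have h4 := mul_le_mul_of_nonneg_left h2 (by positivity : 0 ≤ 2 * h.LF)
          exact mul_le_mul_of_nonneg_left (h1.trans h4) h3.le
  have hpot : m.potential k h t₀ ≤ S₁ := by
    obtain ⟨h1, h2, h3, -⟩ := hm.le_total t₀
    have h4 := hle t₀ m hm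
    have h5 := hη t₀
    have e1 : h.bigC k * h.gam * m.b t₀ ≤ h.bigC k * h.gam * ρ t₀ := by
      gcongr; exact h2.trans h4
    have e2 : 1 / h.eta t₀ * m.errors t₀ ≤ 1 / h.eta t₀ * ρ t₀ := by
      gcongr; exact h3.trans h4
    rw [potential, hS1]
    linarith
  have hcube : ∀ n, 0 ≤ ∑ t ∈ Finset.range n, h.eta t ^ 3 := fun n =>
    Finset.sum_nonneg fun t _ => pow_nonneg (hη t).le 3
  -- The remaining potential is carried along in the induction; the base case charges the early
  -- terms to S₂.
  have hlate : ∀ n, t₀ ≤ n → h.gam / 2 * ∑ t ∈ Finset.range n, h.eta t * m.G t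
      + m.potential k h n
      ≤ S₁ + h.gam / 2 * S₂ + noise k h * ∑ t ∈ Finset.range n, h.eta t ^ 3 := by
    intro n hn
    induction n, hn using Nat.le_induction with
    | base =>
      have h1 := mul_le_mul_of_nonneg_left (hearly t₀ le_rfl) (by positivity : 0 ≤ h.gam / 2)
      have h2 := mul_nonneg hN (hcube t₀)
      linarith
    | succ n hn ih =>
      have h1 := hm.potential_succ_le hk hh (ht₀ n hn)
      rw [Finset.sum_range_succ, Finset.sum_range_succ]
      linarith
  have hc := hcube n
  rcases _root_.le_total n t₀ with hn | hn
  · have h1 := hearly n hn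
    have h2 : 0 ≤ 2 / h.gam * (S₁ + noise k h) := by positivity
    have h3 : 0 ≤ (2 / h.gam * (S₁ + noise k h) + S₂) * ∑ t ∈ Finset.range n, h.eta t ^ 3 := by
      positivity
    linarith
  · have h1 := hlate n hn
    have h2 := hm.potential_nonneg hk hh n
    set Q := ∑ t ∈ Finset.range n, h.eta t ^ 3
    set X := ∑ t ∈ Finset.range n, h.eta t * m.G t
    have h3 : X ≤ 2 / h.gam * (S₁ + h.gam / 2 * S₂ + noise k h * Q) := by
      have : X = 2 / h.gam * (h.gam / 2 * X) := by field_simp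
      rw [this]
      gcongr
      linarith
    refine h3.trans ?_
    have h4 : 2 / h.gam * (S₁ + h.gam / 2 * S₂ + noise k h * Q)
        = 2 / h.gam * (S₁ + noise k h * Q) + S₂ := by field_simp; ring
    have h5 : (2 / h.gam * (S₁ + noise k h) + S₂) * (1 + Q)
        = 2 / h.gam * (S₁ + noise k h * Q) + S₂
          + (2 / h.gam * (noise k h + S₁ * Q) + S₂ * Q) := by ring
    have h6 : 0 ≤ 2 / h.gam * (noise k h + S₁ * Q) + S₂ * Q := by positivity
    rw [h4, h5]
    linarith

/-- η_t³ = c³/(c₀ + t) ≤ c³/(t + 1), a harmonic sum. -/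
lemma sum_eta_cube_le (hh : h.Admissible k) (n : ℕ) :
    ∑ t ∈ Finset.range n, h.eta t ^ 3 ≤ h.c ^ 3 * (1 + Real.log n) := by
  have hc := hh.c_pos
  have h1 := harmonic_le_one_add_log n
  have h2 : ((harmonic n : ℚ) : ℝ) = ∑ t ∈ Finset.range n, ((t : ℝ) + 1)⁻¹ := by
    simp [harmonic]
  rw [h2] at h1
  refine le_trans ?_ (mul_le_mul_of_nonneg_left h1 (by positivity))
  rw [Finset.mul_sum]
  refine Finset.sum_le_sum fun t _ => ?_
  rw [hh.eta_pow_three, div_eq_mul_inv]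
  have hc0 := hh.c0_ge_two
  exact mul_le_mul_of_nonneg_left (inv_anti₀ (by positivity) (by linarith)) (by positivity)

lemma one_le_log_add_two {T : ℕ} (hT : 1 ≤ T) : 1 ≤ Real.log ((T : ℝ) + 2) := by
  have h1 : (1 : ℝ) ≤ T := by exact_mod_cast hT
  rw [Real.le_log_iff_exp_le (by positivity)]
  have := Real.exp_one_lt_d9
  linarith

/-- Since η_t ≥ η_T, the weighted sum controls η_T times the plain sum. Dividing by η_T costs
T^{1/3}, and averaging over T + 1 terms leaves T^{-2/3}. -/
lemma exists_average_le (hk : k.Valid) (hh : h.Admissible k) (D : ℝ) :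
    ∃ K, 0 ≤ K ∧ ∀ m : Moments, m.Bounds k h D → ∀ T : ℕ, 1 ≤ T →
      1 / ((T : ℝ) + 1) * ∑ t ∈ Finset.range (T + 1), m.G t
        ≤ K * Real.log ((T : ℝ) + 2) / (T : ℝ) ^ (2 / 3 : ℝ) := by
  obtain ⟨K, hK, hle⟩ := exists_sum_le hk hh D
  have hc := hh.c_pos
  have hc0 := hh.c0_ge_two
  set q := (h.c0 + 1) ^ (1 / 3 : ℝ) with hq
  have hq0 : 0 ≤ q := Real.rpow_nonneg (by linarith) _
  refine ⟨K * (1 + 2 * h.c ^ 3) * (q / h.c), by positivity, fun m hm T hT => ?_⟩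
  have hT1 : (1 : ℝ) ≤ T := by exact_mod_cast hT
  have hT0 : (0 : ℝ) < T := by linarith
  have hηT := hh.eta_pos T
  have hlog := one_le_log_add_two hT
  set ℓ := Real.log ((T : ℝ) + 2)
  have hG : 0 ≤ ∑ t ∈ Finset.range (T + 1), m.G t := Finset.sum_nonneg fun t _ => hm.G_nonneg t
  have h1 : h.eta T * ∑ t ∈ Finset.range (T + 1), m.G t ≤ K * (1 + 2 * h.c ^ 3) * ℓ := by
    calc _ ≤ ∑ t ∈ Finset.range (T + 1), h.eta t * m.G t := by
          rw [Finset.mul_sum]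
          refine Finset.sum_le_sum fun t ht => ?_
          have := hm.G_nonneg t
          have := hh.eta_antitone (Nat.lt_succ_iff.1 (Finset.mem_range.1 ht))
          gcongr
      _ ≤ K * (1 + ∑ t ∈ Finset.range (T + 1), h.eta t ^ 3) := hle m hm (T + 1)
      _ ≤ K * (1 + h.c ^ 3 * (1 + ℓ)) := by
          have e1 := sum_eta_cube_le hh (T + 1)
          have e2 : Real.log ((T + 1 : ℕ) : ℝ) ≤ ℓ := by
            refine Real.log_le_log (by positivity) ?_
            push_cast; linarith
          have e3 : h.c ^ 3 * (1 + Real.log ((T + 1 : ℕ) : ℝ)) ≤ h.c ^ 3 * (1 + ℓ) := by gcongr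
          gcongr
          exact e1.trans e3
      _ ≤ K * ((1 + 2 * h.c ^ 3) * ℓ) := by
          have : 0 ≤ h.c ^ 3 * (ℓ - 1) := mul_nonneg (by positivity) (by linarith)
          gcongr
          linarith
      _ = _ := by ring
  have h2 : 1 / h.eta T ≤ q / h.c * (T : ℝ) ^ (1 / 3 : ℝ) := by
    -- For T ≥ 1, c₀ + T ≤ (c₀ + 1)T.
    have e1 : h.root T ≤ q * (T : ℝ) ^ (1 / 3 : ℝ) := by
      rw [hq, ← Real.mul_rpow (by linarith) hT0.le, Params.root]
      refine Real.rpow_le_rpow (hh.c0_add_pos T).le ?_ (by norm_num)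
      nlinarith
    rw [Params.eta_eq, one_div_div, div_mul_eq_mul_div]
    gcongr
  have h3 : ∑ t ∈ Finset.range (T + 1), m.G t
      ≤ q / h.c * (T : ℝ) ^ (1 / 3 : ℝ) * (K * (1 + 2 * h.c ^ 3) * ℓ) := by
    calc _ = 1 / h.eta T * (h.eta T * ∑ t ∈ Finset.range (T + 1), m.G t) := by field_simp
      _ ≤ 1 / h.eta T * (K * (1 + 2 * h.c ^ 3) * ℓ) := by gcongr
      _ ≤ _ := by gcongr
  have h4 : 1 / ((T : ℝ) + 1) * (T : ℝ) ^ (1 / 3 : ℝ) ≤ 1 / (T : ℝ) ^ (2 / 3 : ℝ) := by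
    rw [div_mul_eq_mul_div, one_mul, div_le_div_iff₀ (by positivity) (by positivity),
      ← Real.rpow_add hT0, one_mul]
    norm_num
  calc _ ≤ 1 / ((T : ℝ) + 1) *
        (q / h.c * (T : ℝ) ^ (1 / 3 : ℝ) * (K * (1 + 2 * h.c ^ 3) * ℓ)) := by gcongr
    _ = 1 / ((T : ℝ) + 1) * (T : ℝ) ^ (1 / 3 : ℝ) * (q / h.c * (K * (1 + 2 * h.c ^ 3) * ℓ)) := by
        ring
    _ ≤ 1 / (T : ℝ) ^ (2 / 3 : ℝ) * (q / h.c * (K * (1 + 2 * h.c ^ 3) * ℓ)) := by gcongr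
    _ = _ := by ring

end Bounds

end Moments

/-! ### The number of iterations -/

/-- With ℓ = log(1/ε) and N of order ℓ²/ε³, log N is O(ℓ), while N^{2/3} is at least a multiple of
ℓ/ε² because ℓ ≥ 1/2. The power 2 in place of 3/2 keeps the exponent of the logarithm an integer. -/
lemma exists_iterations {K : ℝ} (hK : 0 ≤ K) :
    ∃ (K' : ℝ) (N : ℝ → ℕ), 0 ≤ K' ∧ ∀ ε : ℝ, 0 < ε → ε ≤ 1 / 2 →
      1 ≤ N ε ∧ 2 * (N ε : ℝ) ≤ K' / ε ^ 3 * Real.log (1 / ε) ^ 2 ∧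
      K * Real.log ((N ε : ℝ) + 2) / (N ε : ℝ) ^ (2 / 3 : ℝ) ≤ ε ^ 2 := by
  -- The 30 is twice the 15 in log(N + 2) ≤ 15Bℓ, so that K · 15Bℓ ≤ B²ℓ/2 = ε²w; the 1 ensures B ≥
  -- 1.
  set B := 1 + 30 * K with hB
  have hB1 : 1 ≤ B := by linarith
  have hB0 : 0 < B := by linarith
  refine ⟨4 * B ^ 3, fun ε => ⌈B ^ 3 * Real.log (1 / ε) ^ 2 / ε ^ 3⌉₊, by positivity,
    fun ε hε hε2 => ?_⟩
  set ℓ := Real.log (1 / ε) with hℓ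
  have hinv : 2 ≤ 1 / ε := by rw [le_div_iff₀ hε]; linarith
  have hℓ2 : 1 / 2 ≤ ℓ := by
    have h1 := Real.log_le_log two_pos hinv
    have := Real.log_two_gt_d9
    linarith
  have hℓ0 : 0 < ℓ := by linarith
  set x := B ^ 3 * ℓ ^ 2 / ε ^ 3 with hx
  have hx2 : 2 ≤ x := by
    have h1 : x = B ^ 3 * ℓ ^ 2 * (1 / ε) ^ 3 := by rw [hx]; field_simp
    rw [h1]
    calc (2 : ℝ) = 1 ^ 3 * (1 / 2) ^ 2 * 2 ^ 3 := by norm_num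
      _ ≤ _ := by gcongr
  set N := ⌈x⌉₊ with hN
  have hxN : x ≤ N := Nat.le_ceil x
  have hNx : (N : ℝ) ≤ 2 * x := by
    have := Nat.ceil_lt_add_one (by linarith : 0 ≤ x)
    linarith
  have hN0 : (0 : ℝ) < N := by linarith
  refine ⟨?_, ?_, ?_⟩
  · exact_mod_cast (by linarith : (1 : ℝ) ≤ N)
  · calc 2 * (N : ℝ) ≤ 2 * (2 * x) := by linarith
      _ = _ := by rw [hx]; ring
  · have hlogN : Real.log ((N : ℝ) + 2) ≤ 15 * B * ℓ := by
      have h1 : Real.log ((N : ℝ) + 2) ≤ Real.log (4 * x) :=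
        Real.log_le_log (by positivity) (by linarith)
      have h2 : 4 * x = 2 ^ 2 * B ^ 3 * ℓ ^ 2 * (1 / ε) ^ 3 := by rw [hx]; field_simp; norm_num
      have h3 : Real.log (4 * x) = 2 * Real.log 2 + 3 * Real.log B + 2 * Real.log ℓ + 3 * ℓ := by
        rw [h2, Real.log_mul (by positivity) (by positivity),
          Real.log_mul (by positivity) (by positivity),
          Real.log_mul (by positivity) (by positivity), Real.log_pow, Real.log_pow, Real.log_pow,
          Real.log_pow, ← hℓ]
        push_cast
        ring
      have h4 := Real.log_two_lt_d9
      have h5 := Real.log_le_sub_one_of_pos hB0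
      have h6 := Real.log_le_sub_one_of_pos hℓ0
      have h7 : 0 ≤ (B - 1) * (ℓ - 1 / 2) := mul_nonneg (by linarith) (by linarith)
      have h8 : 0 ≤ (B - 1) * ℓ := mul_nonneg (by linarith) hℓ0.le
      linarith
    set w := (B / ε) ^ 2 * ℓ / 2 with hw
    have hw0 : 0 ≤ w := by positivity
    have hwN : w ≤ (N : ℝ) ^ (2 / 3 : ℝ) := by
      have h1 : w ^ 3 ≤ (N : ℝ) ^ 2 := by
        calc w ^ 3 = (B / ε) ^ 6 * ℓ ^ 3 * (1 / 8) := by rw [hw]; ring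
          _ ≤ (B / ε) ^ 6 * ℓ ^ 3 * ℓ := by gcongr; linarith
          _ = x ^ 2 := by rw [hx]; field_simp
          _ ≤ (N : ℝ) ^ 2 := by gcongr
      have h2 := Real.rpow_le_rpow (by positivity) h1 (by norm_num : (0 : ℝ) ≤ 1 / 3)
      rw [← Real.rpow_natCast, ← Real.rpow_natCast, ← Real.rpow_mul hw0,
        ← Real.rpow_mul hN0.le] at h2
      norm_num at h2
      exact h2
    rw [div_le_iff₀ (by positivity)]
    calc K * Real.log ((N : ℝ) + 2) ≤ K * (15 * B * ℓ) := by gcongr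
      _ = 30 * K * (B * ℓ / 2) := by ring
      _ ≤ B * (B * ℓ / 2) := by gcongr; linarith
      _ = ε ^ 2 * w := by rw [hw]; field_simp
      _ ≤ _ := by gcongr

/-! ### The output of the method -/

lemma integrable_withUniformIndex {Ω : Type*} [MeasurableSpace Ω] {μ : Measure Ω}
    [IsProbabilityMeasure μ] {T : ℕ} {f : ℕ → Ω → ℝ} (hm : ∀ t, Measurable (f t))
    (hf : ∀ t, Integrable (f t) μ) :
    Integrable (fun q : Ω × Fin (T + 1) => f q.2 q.1) (withUniformIndex μ T) := by
  have hmeas : Measurable fun q : Ω × Fin (T + 1) => f q.2 q.1 :=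
    measurable_from_prod_countable_left fun i => hm i
  rw [withUniformIndex, integrable_prod_iff' hmeas.aestronglyMeasurable]
  exact ⟨.of_forall fun i => hf i, .of_finite⟩

lemma integral_withUniformIndex {Ω : Type*} [MeasurableSpace Ω] {μ : Measure Ω}
    [IsProbabilityMeasure μ] {T : ℕ} {f : ℕ → Ω → ℝ} (hm : ∀ t, Measurable (f t))
    (hf : ∀ t, Integrable (f t) μ) :
    ∫ q : Ω × Fin (T + 1), f q.2 q.1 ∂(withUniformIndex μ T)
      = 1 / ((T : ℝ) + 1) * ∑ t ∈ Finset.range (T + 1), ∫ ω, f t ω ∂μ := by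
  have h := integrable_withUniformIndex (T := T) hm hf
  rw [withUniformIndex] at h ⊢
  rw [integral_prod_symm _ h, PMF.integral_eq_sum, Finset.mul_sum, Finset.sum_range]
  refine Finset.sum_congr rfl fun i _ => ?_
  have hT : ((T : ENNReal) + 1).toReal = T + 1 := by
    rw [ENNReal.toReal_add (ENNReal.natCast_ne_top T) ENNReal.one_ne_top]
    simp
  simp [PMF.uniformOfFintype_apply, hT]

end Bilevel

end

/-! ### The rate and the sample complexity -/

theorem theorem1 (k : Bilevel.Consts) (hk : k.Valid) (h : Bilevel.Params) (hh : h.Admissible k)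
    (D : ℝ) :
    ∃ (K : ℝ) (p : ℕ) (N : ℝ → ℕ),
      (∀ ε : ℝ, 0 < ε → ε ≤ 1 / 2 →
        (Bilevel.sampleCount (N ε) : ℝ) ≤ K / ε ^ 3 * Real.log (1 / ε) ^ p) ∧
      ∀ (d e : ℕ) (Ξ Z Ω : Type*) [MeasurableSpace Ξ] [MeasurableSpace Z] [MeasurableSpace Ω]
        (P : Bilevel.Problem d e Ξ Z) (μ : MeasureTheory.Measure Ω)
        [MeasureTheory.IsProbabilityMeasure μ] (s : Bilevel.Sequences d e Ξ Z Ω)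
        (x₀ : Bilevel.Vec d) (y₀ : Bilevel.Vec e),
        P.WellPosed → Bilevel.StronglyConvexLower P k → Bilevel.OracleConditions P k →
        s.IsSVRB P k h D μ x₀ y₀ →
        Differentiable ℝ P.F ∧
        (∀ t, MeasureTheory.Integrable (fun ω => ‖gradient P.F (s.x t ω)‖ ^ 2) μ) ∧
        (∀ T : ℕ, 1 ≤ T →
          ∫ ω, (1 / ((T : ℝ) + 1)) *
              ∑ t ∈ Finset.range (T + 1), ‖gradient P.F (s.x t ω)‖ ^ 2 ∂μ
            ≤ K * Real.log ((T : ℝ) + 2) ^ p / (T : ℝ) ^ (2 / 3 : ℝ)) ∧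
        (∀ ε : ℝ, 0 < ε → ε ≤ 1 / 2 →
          MeasureTheory.Integrable (fun q : Ω × Fin (N ε + 1) => ‖gradient P.F (s.x q.2 q.1)‖)
            (Bilevel.withUniformIndex μ (N ε)) ∧
          ∫ q, ‖gradient P.F (s.x q.2 q.1)‖ ∂(Bilevel.withUniformIndex μ (N ε)) ≤ ε) := by
  obtain ⟨K, hK, havg⟩ := Bilevel.Moments.Bounds.exists_average_le hk hh D
  obtain ⟨K', N, hK', hN⟩ := Bilevel.exists_iterations hK
  -- The sample count requires the power p = 2; the rate needs only the first power, and log(T + 2)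
  -- ≥ 1 allows the second.
  refine ⟨K + K', 2, N, fun ε hε hε2 => ?_, ?_⟩
  · have h1 := (hN ε hε hε2).2.1
    rw [Bilevel.sampleCount]
    push_cast
    refine h1.trans ?_
    gcongr
    linarith
  intro d e Ξ Z Ω _ _ _ P μ _ s x₀ y₀ hW hS hO hrun
  have S : Bilevel.Setting s P k h D μ x₀ y₀ := ⟨hk, hh, hW, hS, hO, hrun⟩
  have hint := S.integrable_gradient_sq
  have hmeas := fun t => (S.measurable_gradient_F t).norm
  have hbound := havg S.mom S.bounds
  have hG : ∀ t, S.mom.G t = ∫ ω, ‖gradient P.F (s.x t ω)‖ ^ 2 ∂μ := fun t => rfl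
  simp only [hG] at hbound
  refine ⟨fun x => (P.hasGradientAt_F hW hk hO hS x).differentiableAt, hint, fun T hT => ?_,
    fun ε hε hε2 => ?_⟩
  · rw [integral_const_mul, integral_finsetSum _ fun t _ => hint t]
    refine (hbound T hT).trans ?_
    have hlog := Bilevel.Moments.Bounds.one_le_log_add_two hT
    gcongr
    · linarith
    · exact le_self_pow₀ hlog two_ne_zero
  -- This inequality replaces Jensen: it gives the integrability of ‖∇F‖ and bounds its mean by ε/2
  -- + ε²/(2ε) = ε.
  · have hamgm : ∀ a : ℝ, 0 ≤ a → a ≤ ε / 2 + 1 / (2 * ε) * a ^ 2 := fun a _ => by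
      have h1 : ε / 2 + 1 / (2 * ε) * a ^ 2 - a = (a - ε) ^ 2 / (2 * ε) := by
        field_simp
        ring
      have h2 : 0 ≤ (a - ε) ^ 2 / (2 * ε) := by positivity
      linarith
    have hint' : ∀ t, Integrable (fun ω => ε / 2 + 1 / (2 * ε) * ‖gradient P.F (s.x t ω)‖ ^ 2) μ :=
      fun t => (integrable_const _).add ((hint t).const_mul _)
    have hint1 : ∀ t, Integrable (fun ω => ‖gradient P.F (s.x t ω)‖) μ := fun t =>
      (hint' t).mono' (hmeas t).aestronglyMeasurable (.of_forall fun ω => by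
        rw [norm_norm]
        exact hamgm _ (norm_nonneg _))
    refine ⟨Bilevel.integrable_withUniformIndex hmeas hint1, ?_⟩
    obtain ⟨h1, -, h2⟩ := hN ε hε hε2
    rw [Bilevel.integral_withUniformIndex hmeas hint1]
    have h3 := (hbound (N ε) h1).trans h2
    calc 1 / ((N ε : ℝ) + 1) * ∑ t ∈ Finset.range (N ε + 1), ∫ ω, ‖gradient P.F (s.x t ω)‖ ∂μ
        ≤ 1 / ((N ε : ℝ) + 1) * ∑ t ∈ Finset.range (N ε + 1),
            (ε / 2 + 1 / (2 * ε) * ∫ ω, ‖gradient P.F (s.x t ω)‖ ^ 2 ∂μ) := by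
          gcongr with t
          refine (integral_mono (hint1 t) (hint' t) fun ω => hamgm _ (norm_nonneg _)).trans ?_
          rw [integral_add (integrable_const _) ((hint t).const_mul _), integral_const_mul]
          simp
      _ = ε / 2 + 1 / (2 * ε) * (1 / ((N ε : ℝ) + 1) * ∑ t ∈ Finset.range (N ε + 1),
            ∫ ω, ‖gradient P.F (s.x t ω)‖ ^ 2 ∂μ) := by
          rw [Finset.sum_add_distrib, ← Finset.mul_sum]
          simp only [Finset.sum_const, Finset.card_range, nsmul_eq_mul]
          push_cast
          field_simp
      _ ≤ ε / 2 + 1 / (2 * ε) * ε ^ 2 := by gcongr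
      _ = ε := by field_simp; norm_num
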